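/- Let $\nu>0$ and $\alpha>\tfrac12$. For $t>0$ let $g_\alpha(t,\cdot)$ be the function on $\mathbb R^2$ with Fourier transform $\int_{\mathbb R^2} g_\alpha(t,x)e^{-i\xi\cdot x}\,dx=e^{-\nu|\xi|^{2\alpha}t}$, let $G_\alpha(t)f=g_\alpha(t)*f$, and let $$K(x)=\nabla^\perp\Big(-\frac1{2\pi|x|}\Big)=\frac{(-x_2,x_1)}{2\pi|x|^3},\qquad \nabla^\perp=(-\partial_2,\partial_1).$$ For $0<\varepsilon<R$ let $A_{\varepsilon,R}=\{z\in\mathbb R^2:\varepsilon<|z|<R\}$ (and $A_{\varepsilon,R}=\emptyset$ if $\varepsilon\ge R$), and put $$\mathrm{p.v.}\,K*f(x)=\lim_{(\varepsilon,R)\to(0,\infty)}\big((\mathbf 1_{A_{\varepsilon,R}}K)*f\big)(x).$$ We say that $\mathrm{p.v.}\,K*f$ converges uniformly over annuli if $\sup_{r,R>0}\|(\mathbf 1_{A_{r,R}}K)*f\|_{L^\infty}<\infty$. Let $T\in(0,\infty)$, $\theta_0\in L^\infty(\mathbb R^2)$ and $u_0\in (L^\infty(\mathbb R^2))^2$. A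 mild solution on $[0,T]$ with data $(\theta_0,u_0)$ is a pair $(\theta,u)\in L^\infty([0,T]\times\mathbb R^2)\times(L^\infty([0,T]\times\mathbb R^2))^2$ such that for each $t\in(0,T]$ one has, for almost every $x\in\mathbb R^2$ and $i=1,2$, $$\theta(t)=G_\alpha(t)\theta_0-\int_0^t\sum_{j=1}^2\partial_jg_\alpha(t-s)*(\theta u_j)(s)\,ds,$$ $$u_i(t)=G_\alpha(t)u_{0,i}-\int_0^t\sum_{j=1}^2\big(\mathrm{p.v.}\,K^i*\partial_jg_\alpha(t-s)\big)*(\theta u_j)(s)\,ds.$$ **Theorem.** Let $\theta_0\in L^\infty(\mathbb R^2)$ and $u_0\in (L^\infty(\mathbb R^2))^2$. For some $T>0$ there exists a mild solution $(\theta,u)$ on $[0,T]$ with data $(\theta_0,u_0)$, and it is unique: every mild solution on $[0,T]$ with the same data agrees with it almost everywhere on $\mathbb R^2$ at each time $t\in(0,T]$. It belongs to $(C((0,T];L^\infty(\mathbb R^2)))^3$ and satisfies $\theta|_{t=0}=\theta_0$ and $u|_{t=0}=u_0$, where, for a suitable representative, $\theta(t,x)\to\theta_0(x)$ and $u(t,x)\to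 u_0(x)$ as $t\to0^+$ for almost every $x$. Moreover, if $u_0=\mathrm{p.v.}\,K*\theta_0$ almost everywhere, with the principal value converging uniformly over annuli, then (for the same representative) $u(t,x)=\mathrm{p.v.}\,K*\theta(t)(x)$ for all $t\in(0,T]$ and all $x\in\mathbb R^2$; in particular the limit exists there. -/

import Mathlib

open MeasureTheory Set Filter Topology
open scoped ENNReal FourierTransform

noncomputable section

namespace SQG

/-- The Euclidean plane. -/
abbrev Plane := EuclideanSpace ℝ (Fin 2)

/-- The fractional heat kernel `g_α(t, ·)` of `∂ₜ + ν Λ^{2α}`, that is, the function whose Fourier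
transform `ξ ↦ ∫ g_α(t, x) e^{-i ξ·x} dx` is `exp(-ν |ξ|^{2α} t)`. Mathlib's inverse transform is
`𝓕⁻ f x = ∫ e^{2π i ⟨v, x⟩} f(v) dv`, so that the frequency is `ξ = 2π v`. The transform
of this even real function is real, and the real part only changes the type. -/
def heatKernel (ν α t : ℝ) (x : Plane) : ℝ :=
  (𝓕⁻ (fun v : Plane => (Real.exp (-ν * ‖(2 * Real.pi) • v‖ ^ (2 * α) * t) : ℂ)) x).re

/-- Convolution on the plane, `(k * f)(x) = ∫ k(x - y) f(y) dy`. -/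
def conv (k f : Plane → ℝ) (x : Plane) : ℝ :=
  ∫ y, k (x - y) * f y

/-- The partial derivative `∂_j f`. -/
def partialDeriv (j : Fin 2) (f : Plane → ℝ) (x : Plane) : ℝ :=
  fderiv ℝ f x (EuclideanSpace.single j 1)

/-- The kernel `K = ∇^⊥ ψ`, with `ψ(x) = -1 / (2π|x|)` and `∇^⊥ = (-∂₂, ∂₁)`, that is,
`K(x) = (-x₂, x₁) / (2π|x|³)`. -/
def K (x : Plane) : Plane :=
  (2 * Real.pi * ‖x‖ ^ 3)⁻¹ • !₂[-x 1, x 0]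

/-- The open annulus around the origin with radii `r` and `R`. -/
def annulus (r R : ℝ) : Set Plane :=
  {z | r < ‖z‖ ∧ ‖z‖ < R}

/-- The truncated convolution `(1_{A_{r,R}(0)} K^i) * f`. -/
def truncConv (r R : ℝ) (i : Fin 2) (f : Plane → ℝ) : Plane → ℝ :=
  conv ((annulus r R).indicator fun z => K z i) f

/-- The limit `(ε, R) → (0, ∞)`. -/
def pvFilter : Filter (ℝ × ℝ) :=
  𝓝[>] (0 : ℝ) ×ˢ atTop

/-- `p.v. K * f` converges at the point `x`, with value `v`. -/
def HasPV (f : Plane → ℝ) (x v : Plane) : Prop :=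
  ∀ i, Tendsto (fun p : ℝ × ℝ => truncConv p.1 p.2 i f x) pvFilter (𝓝 (v i))

/-- The function `p.v. K^i * f`. It is used only for `f = ∂_j g_α(t)` with `t > 0`, for which the
limit exists at every point. -/
def pvConv (i : Fin 2) (f : Plane → ℝ) (x : Plane) : ℝ :=
  limUnder pvFilter fun p : ℝ × ℝ => truncConv p.1 p.2 i f x

/-- `p.v. K * f` converges uniformly over annuli: the sup norms of the truncated convolutions
are bounded uniformly in the two radii. -/
def UniformOverAnnuli (f : Plane → ℝ) : Prop :=
  ∃ C : ℝ, ∀ r R : ℝ, 0 < r → 0 < R → ∀ i,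
    eLpNorm (truncConv r R i f) ∞ volume ≤ ENNReal.ofReal C

/-- `(θ, u)` is a mild solution on `[0, T]` with data `(θ₀, u₀)`: both functions belong to
`L^∞([0, T] × ℝ²)`, and for each `t ∈ (0, T]` the two Duhamel identities
`θ(t) = G_α(t) θ₀ - ∫₀ᵗ ∇G_α(t - s) · (θ u)(s) ds` and
`u(t) = G_α(t) u₀ - ∫₀ᵗ (K * ∇G_α(t - s)) · (θ u)(s) ds` hold in `L^∞(ℝ²)`. -/
structure IsMildSolution (ν α T : ℝ) (θ₀ : Plane → ℝ) (u₀ : Plane → Plane)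
    (θ : ℝ → Plane → ℝ) (u : ℝ → Plane → Plane) : Prop where
  memLp_theta : MemLp (fun p : ℝ × Plane => θ p.1 p.2) ∞
    ((volume.restrict (Icc 0 T)).prod volume)
  memLp_u : MemLp (fun p : ℝ × Plane => u p.1 p.2) ∞
    ((volume.restrict (Icc 0 T)).prod volume)
  theta_eq : ∀ t ∈ Ioc 0 T, ∀ᵐ x : Plane,
    θ t x = conv (heatKernel ν α t) θ₀ x
      - ∫ s in (0 : ℝ)..t, ∑ j,
          conv (partialDeriv j (heatKernel ν α (t - s))) (fun y => θ s y * u s y j) x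
  u_eq : ∀ t ∈ Ioc 0 T, ∀ᵐ x : Plane, ∀ i,
    u t x i = conv (heatKernel ν α t) (fun y => u₀ y i) x
      - ∫ s in (0 : ℝ)..t, ∑ j,
          conv (pvConv i (partialDeriv j (heatKernel ν α (t - s)))) (fun y => θ s y * u s y j) x

/-- `f ∈ C((0, T]; L^∞(ℝ²))`. -/
def ContinuousInLinfty {F : Type*} [NormedAddCommGroup F] (T : ℝ) (f : ℝ → Plane → F) : Prop :=
  (∀ t ∈ Ioc 0 T, MemLp (f t) ∞ volume) ∧
    ∀ t ∈ Ioc 0 T, Tendsto (fun s => eLpNorm (f s - f t) ∞ volume) (𝓝[Ioc 0 T] t) (𝓝 0)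

/-- `f` takes the initial value `f₀`, which is also the limit of `f(t, x)` as `t → 0`, for almost
every `x`. -/
def HasInitialValue {F : Type*} [TopologicalSpace F] (f : ℝ → Plane → F) (f₀ : Plane → F) : Prop :=
  f 0 =ᵐ[volume] f₀ ∧ ∀ᵐ x : Plane, Tendsto (fun t => f t x) (𝓝[>] 0) (𝓝 (f₀ x))

end SQG

end

noncomputable section

namespace SQG

/-! Write `z = (θ, u)`. The mild formulation reads `z = h - D(z)`, where `h` is the linear flow of
the data and `D` is a quadratic Duhamel operator with kernels `∂_j g_α(t)` and `p.v. K^i * ∂_j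
g_α(t)`. Since `K` is homogeneous of degree `-2`, both families are dilations of their profiles at
time one, with `L¹` norm a multiple of `t^{-1/(2α)}`. As `α > 1/2` this is integrable at `t = 0`, so
`D` is a space-time convolution of an `L¹` kernel with a bounded source.

Everything then rests on the integrability of the two profiles. For `∂_j g_α(1)` it follows from
decay of order `(1 + |x|)⁻³` (`exists_decay_oscIntegral`): the only singularity of the symbol is
`|v|^{2α}` at the origin, and its third derivatives are of size `|v|^{2α-3}`, integrable in the
plane exactly when `α > 1/2`. To differentiate legitimately, `|v|²` is replaced by `|v|² + ε`, with
bounds uniform in `ε`. For `p.v. K^i * ∂_j g_α(1)` (`exists_singular_limit`), the singularity of `K`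
at the origin is beaten by oddness and smoothness of the kernel; at infinity `K` is not integrable,
but the derivative can be moved onto `1_{|z| ≥ r} K`, whose variation is of order `1/r`.

Existence for small `T` is a contraction argument for the continuous bounded unknown `v = h - z`
(`exists_duhamel_fixedPoint`). Uniqueness needs no further smallness of the kernels: the weight
`e^{-lt}` makes their `L¹` norms small as `l → ∞` (`duhamel_fixedPoint_unique`). A convolution of
`L¹` with `L^∞` is uniformly continuous (`uniformContinuous_stConv`), which gives continuity in time
and makes `D(z)` vanish as `t → 0`; the linear flow converges to the data at Lebesgue points
(`ae_tendsto_conv_dil`).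

For the relation `u = p.v. K * θ`, convolve the equation of `θ` with `1_A K` and let the annulus `A`
exhaust the plane. In the linear term the limit passes through the heat kernel by domination, which
is the role of uniform convergence over annuli (`tendsto_truncConv_conv`). In the Duhamel term the
truncated kernels converge in space-time `L¹` (`tendsto_truncConv_stConv`). The limits add up to the
equation of `u`. -/

/-! ### Decay of Fourier transforms of monomials times `exp (-a |v|^{2α})` -/

/-- The regularized squared norm `|v|² + ε`. -/
def regSq (ε : ℝ) (v : Plane) : ℝ := v 0 ^ 2 + v 1 ^ 2 + ε

/-- The weight `v₀ⁿ v₁ᵐ (|v|² + ε)ˢ exp (-a (|v|² + ε)^α)`. -/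
def symbolTerm (a α : ℝ) (n m : ℕ) (s ε : ℝ) (v : Plane) : ℝ :=
  v 0 ^ n * v 1 ^ m * regSq ε v ^ s * Real.exp (-a * regSq ε v ^ α)

/-- Families of symbols of order at least `r` at the origin, up to polynomial factors. -/
inductive IsSymbol (a α r : ℝ) : (ℝ → Plane → ℝ) → Prop
  -- The order of a term at the origin is `n + m + 2 s`. The second alternative treats a term with
  -- `s = 0` as being of order `2 α`: its polynomial factor is smooth, so only the factor `|v|^{2α}`
  -- released by differentiating the exponential can become singular.
  | term (n m : ℕ) (s : ℝ) (h : r ≤ n + m + 2 * s ∨ (s = 0 ∧ r ≤ 2 * α)) :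
      IsSymbol a α r (symbolTerm a α n m s)
  | add {F G : ℝ → Plane → ℝ} (hF : IsSymbol a α r F) (hG : IsSymbol a α r G) :
      IsSymbol a α r (fun ε v => F ε v + G ε v)
  | smul (c : ℝ) {F : ℝ → Plane → ℝ} (hF : IsSymbol a α r F) :
      IsSymbol a α r (fun ε v => c * F ε v)

lemma regSq_pos {ε : ℝ} (hε : 0 < ε) (v : Plane) : 0 < regSq ε v := by
  unfold regSq; positivity

lemma regSq_eq_norm (ε : ℝ) (v : Plane) : regSq ε v = ‖v‖ ^ 2 + ε := by
  rw [EuclideanSpace.norm_sq_eq]; simp [regSq, Fin.sum_univ_two]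

lemma continuous_regSq (ε : ℝ) : Continuous (regSq ε) := by
  unfold regSq; fun_prop

lemma IsSymbol.weaken {a α r r' : ℝ} {F : ℝ → Plane → ℝ} (hF : IsSymbol a α r F) (h : r' ≤ r) :
    IsSymbol a α r' F := by
  induction hF with
  | term n m s h' =>
    refine .term _ _ _ (h'.imp (fun h' => h.trans h') fun h' => ⟨h'.1, h.trans h'.2⟩)
  | add _ _ h1 h2 => exact .add h1 h2
  | smul c _ h1 => exact .smul c h1

lemma IsSymbol.continuous {a α r : ℝ} {F : ℝ → Plane → ℝ} (hF : IsSymbol a α r F)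
    {ε : ℝ} (hε : 0 < ε) : Continuous (F ε) := by
  induction hF with
  | term n m s h' =>
    have h1 (p : ℝ) : Continuous fun v => regSq ε v ^ p :=
      (continuous_regSq ε).rpow_const fun v => Or.inl (regSq_pos hε v).ne'
    have := h1 s
    have := h1 α
    unfold symbolTerm
    fun_prop
  | add _ _ h1 h2 => exact h1.add h2
  | smul c _ h1 => exact continuous_const.mul h1

lemma hasLineDerivAt_regSq (ε : ℝ) (v : Plane) (j : Fin 2) :
    HasLineDerivAt ℝ (regSq ε) (2 * v j) v (EuclideanSpace.single j 1) := by
  unfold HasLineDerivAt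
  have : (fun t : ℝ => regSq ε (v + t • EuclideanSpace.single j (1 : ℝ)))
      = fun t => t ^ 2 + 2 * v j * t + regSq ε v := by
    ext t
    fin_cases j <;> simp [regSq] <;> ring
  rw [this]
  have h := (((hasDerivAt_id (0 : ℝ)).pow 2).add ((hasDerivAt_id (0 : ℝ)).const_mul (2 * v j))).add_const
    (regSq ε v)
  refine h.congr_deriv ?_
  simp

/-- Product rule on the monomial, the power and the exponential. The truncated exponents `n - 1` and
`m - 1` are harmless at zero, where the coefficients `n` and `m` vanish. -/
lemma hasLineDerivAt_symbolTerm (a α : ℝ) (n m : ℕ) (s : ℝ) {ε : ℝ} (hε : 0 < ε) (v : Plane) :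
    HasLineDerivAt ℝ (symbolTerm a α n m s ε)
        (n * symbolTerm a α (n - 1) m s ε v
          + (2 * s * symbolTerm a α (n + 1) m (s - 1) ε v
            + -(2 * a * α) * symbolTerm a α (n + 1) m (s + α - 1) ε v))
        v (EuclideanSpace.single 0 1) ∧
      HasLineDerivAt ℝ (symbolTerm a α n m s ε)
        (m * symbolTerm a α n (m - 1) s ε v
          + (2 * s * symbolTerm a α n (m + 1) (s - 1) ε v
            + -(2 * a * α) * symbolTerm a α n (m + 1) (s + α - 1) ε v))
        v (EuclideanSpace.single 1 1) := by
  have hq := regSq_pos hε v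
  have e1 : regSq ε v ^ (s + α - 1) = regSq ε v ^ s * regSq ε v ^ (α - 1) := by
    rw [← Real.rpow_add hq]; congr 1; ring
  have key (j : Fin 2) (k : Fin 2) :
      HasDerivAt (fun t : ℝ => (v + t • EuclideanSpace.single j (1 : ℝ) : Plane) k)
        (if k = j then 1 else 0) 0 := by
    have : (fun t : ℝ => (v + t • EuclideanSpace.single j (1 : ℝ) : Plane) k)
        = fun t => v k + t * (if k = j then 1 else 0) := by
      ext t; simp
    rw [this]
    simpa using ((hasDerivAt_id (0 : ℝ)).mul_const (if k = j then (1 : ℝ) else 0)).const_add (v k)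
  have hE (j : Fin 2) := hasLineDerivAt_regSq ε v j
  unfold HasLineDerivAt at *
  have hne (j : Fin 2) : regSq ε (v + (0 : ℝ) • EuclideanSpace.single j (1 : ℝ)) ≠ 0 := by
    simpa using hq.ne'
  constructor
  · have h := ((((key 0 0).pow n).mul ((key 0 1).pow m)).mul
      ((hE 0).rpow_const (p := s) (Or.inl (hne 0)))).mul
      (((hE 0).rpow_const (p := α) (Or.inl (hne 0))).const_mul (-a)).exp
    refine h.congr_deriv ?_
    simp only [symbolTerm, e1]
    simp
    ring
  · have h := ((((key 1 0).pow n).mul ((key 1 1).pow m)).mul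
      ((hE 1).rpow_const (p := s) (Or.inl (hne 1)))).mul
      (((hE 1).rpow_const (p := α) (Or.inl (hne 1))).const_mul (-a)).exp
    refine h.congr_deriv ?_
    simp only [symbolTerm, e1]
    simp
    ring

/-- Every differentiation costs one order at the origin, and the class is stable under it. -/
lemma IsSymbol.exists_lineDeriv {a α r : ℝ} (hα : 0 < α) {F : ℝ → Plane → ℝ}
    (hF : IsSymbol a α r F) (j : Fin 2) :
    ∃ F', IsSymbol a α (r - 1) F' ∧
      ∀ ε > 0, ∀ v, HasLineDerivAt ℝ (F ε) (F' ε v) v (EuclideanSpace.single j 1) := by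
  induction hF with
  | term n m s h' =>
    have hn : (n : ℝ) - 1 ≤ (n - 1 : ℕ) := by
      have : (n : ℝ) ≤ ((n - 1 : ℕ) : ℝ) + 1 := by exact_mod_cast (by omega : n ≤ n - 1 + 1)
      linarith
    have hm : (m : ℝ) - 1 ≤ (m - 1 : ℕ) := by
      have : (m : ℝ) ≤ ((m - 1 : ℕ) : ℝ) + 1 := by exact_mod_cast (by omega : m ≤ m - 1 + 1)
      linarith
    have hn0 : (0 : ℝ) ≤ n := n.cast_nonneg
    have hm0 : (0 : ℝ) ≤ m := m.cast_nonneg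
    have hz (n' m' : ℕ) (h0 : (n' : ℝ) + m' = n + m + 1) :
        IsSymbol a α (r - 1) fun ε v => 2 * s * symbolTerm a α n' m' (s - 1) ε v := by
      rcases h' with h' | ⟨rfl, h'⟩
      · exact .smul _ (.term _ _ _ (Or.inl (by linarith)))
      -- For `s = 0` the coefficient `2 s` kills the term, so its exponent may be changed from `-1`
      -- to `0`; this keeps it under the second alternative.
      · have h2 : (fun (ε : ℝ) v => 2 * 0 * symbolTerm a α n' m' (0 - 1) ε v)
            = fun ε v => 0 * symbolTerm a α n' m' 0 ε v := by ext; simp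
        rw [h2]
        exact .smul _ (.term _ _ _ (Or.inr ⟨rfl, by linarith⟩))
    have hl (n' m' : ℕ) (h0 : (n' : ℝ) + m' = n + m + 1) :
        IsSymbol a α (r - 1) fun ε v => -(2 * a * α) * symbolTerm a α n' m' (s + α - 1) ε v := by
      refine .smul _ (.term _ _ _ (Or.inl ?_))
      -- In the exceptional case the new order is `n + m + 1 + 2 (α - 1) ≥ 2 α - 1`.
      rcases h' with h' | ⟨rfl, h'⟩ <;> linarith
    fin_cases j
    · refine ⟨_, .add (.smul n (.term (n - 1) m s ?_)) (.add (hz (n + 1) m ?_) (hl (n + 1) m ?_)),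
        fun ε hε v => (hasLineDerivAt_symbolTerm a α n m s hε v).1⟩
      · exact h'.imp (fun h => by linarith) fun h => ⟨h.1, by linarith [h.2]⟩
      · push_cast; ring
      · push_cast; ring
    · refine ⟨_, .add (.smul m (.term n (m - 1) s ?_)) (.add (hz n (m + 1) ?_) (hl n (m + 1) ?_)),
        fun ε hε v => (hasLineDerivAt_symbolTerm a α n m s hε v).2⟩
      · exact h'.imp (fun h => by linarith) fun h => ⟨h.1, by linarith [h.2]⟩
      · push_cast; ring
      · push_cast; ring
  | add _ _ h1 h2 =>
    obtain ⟨F', hF', h1⟩ := h1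
    obtain ⟨G', hG', h2⟩ := h2
    exact ⟨_, .add hF' hG', fun ε hε v => (h1 ε hε v).add (h2 ε hε v)⟩
  | smul c _ h1 =>
    obtain ⟨F', hF', h1⟩ := h1
    exact ⟨_, .smul c hF', fun ε hε v => HasDerivAt.const_mul c (h1 ε hε v)⟩

/-! ### Bounds and integrable majorants for symbols -/

lemma abs_coord_le_norm (v : Plane) (j : Fin 2) : |v j| ≤ ‖v‖ := by
  simpa using PiLp.norm_apply_le v j

lemma abs_monomial_le (n m : ℕ) {ε : ℝ} (hε : 0 ≤ ε) (v : Plane) :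
    |v 0 ^ n * v 1 ^ m| ≤ regSq ε v ^ ((n + m : ℝ) / 2) := by
  have h0 : ‖v‖ ^ 2 ≤ regSq ε v := by rw [regSq_eq_norm]; linarith
  calc |v 0 ^ n * v 1 ^ m| = |v 0| ^ n * |v 1| ^ m := by simp [abs_mul]
    _ ≤ ‖v‖ ^ n * ‖v‖ ^ m := by
        gcongr
        · exact abs_coord_le_norm v 0
        · exact abs_coord_le_norm v 1
    _ = (‖v‖ ^ 2) ^ ((n + m : ℝ) / 2) := by
        rw [← Real.rpow_natCast ‖v‖ 2, ← Real.rpow_mul (norm_nonneg _), ← pow_add,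
          ← Real.rpow_natCast]
        congr 1; push_cast; ring
    _ ≤ _ := by gcongr

lemma rpow_le_one_add_rpow {q p b c : ℝ} (hq : 0 < q) (h1 : c ≤ p) (h2 : p ≤ b) :
    q ^ p ≤ q ^ c + q ^ b := by
  rcases le_total q 1 with h | h
  · have := Real.rpow_le_rpow_of_exponent_ge hq h h1
    have := Real.rpow_nonneg hq.le b
    linarith
  · have := Real.rpow_le_rpow_of_exponent_le h h2
    have := Real.rpow_nonneg hq.le c
    linarith

/-- The power `r / 2` controls the origin and the power `N` controls infinity; the summand `1`
serves the terms with `s = 0`, which are bounded near the origin even when their actual order is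
below `r`. -/
lemma IsSymbol.bound {a α r : ℝ} {F : ℝ → Plane → ℝ} (hF : IsSymbol a α r F) :
    ∃ C : ℝ, 0 ≤ C ∧ ∃ N : ℕ, ∀ ε > 0, ∀ v, |F ε v| ≤
      C * ((1 + regSq ε v ^ (r / 2) + regSq ε v ^ N) * Real.exp (-a * regSq ε v ^ α)) := by
  induction hF with
  | term n m s h' =>
    obtain ⟨N, hN⟩ := exists_nat_ge (max ((n + m : ℝ) / 2 + s) 0)
    refine ⟨1, zero_le_one, N, fun ε hε v => ?_⟩
    have hq := regSq_pos hε v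
    rw [symbolTerm, abs_mul, abs_of_pos (Real.exp_pos _), one_mul]
    refine mul_le_mul_of_nonneg_right ?_ (Real.exp_pos _).le
    rw [abs_mul, abs_of_pos (Real.rpow_pos_of_pos hq s)]
    calc _ ≤ regSq ε v ^ ((n + m : ℝ) / 2) * regSq ε v ^ s := by
          gcongr; exact abs_monomial_le n m hε.le v
      _ = regSq ε v ^ ((n + m : ℝ) / 2 + s) := (Real.rpow_add hq _ _).symm
      _ ≤ _ := by
        rcases h' with h' | ⟨rfl, -⟩
        · have := rpow_le_one_add_rpow (c := r / 2) (b := N) hq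
            (by linarith : r / 2 ≤ (n + m : ℝ) / 2 + s) ((le_max_left _ _).trans hN)
          rw [Real.rpow_natCast] at this
          linarith
        · have := rpow_le_one_add_rpow (c := 0) (b := N) hq
            (by positivity : 0 ≤ (n + m : ℝ) / 2 + 0) ((le_max_left _ _).trans hN)
          rw [Real.rpow_natCast, Real.rpow_zero] at this
          have := Real.rpow_pos_of_pos hq (r / 2)
          linarith
  | @add F G _ _ h1 h2 =>
    obtain ⟨C, hC, N, h1⟩ := h1
    obtain ⟨C', hC', N', h2⟩ := h2
    -- The factor `2` pays for raising both powers to the common `max N N'` through `q ^ k ≤ 1 + q ^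
    -- max N N'`.
    refine ⟨2 * (C + C'), by positivity, max N N', fun ε hε v => ?_⟩
    have hq := regSq_pos hε v
    have aux : ∀ k ≤ max N N', regSq ε v ^ k ≤ 1 + regSq ε v ^ max N N' := fun k hk => by
      have := rpow_le_one_add_rpow (q := regSq ε v) (p := k) (c := 0) (b := (max N N' : ℕ)) hq
        (by positivity) (by exact_mod_cast hk)
      simpa only [Real.rpow_natCast, Real.rpow_zero] using this
    have hr := Real.rpow_pos_of_pos hq (r / 2)
    have hE := (Real.exp_pos (-a * regSq ε v ^ α))
    have hM : 0 < regSq ε v ^ max N N' := by positivity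
    have b (k : ℕ) (hk : k ≤ max N N') :
        (1 + regSq ε v ^ (r / 2) + regSq ε v ^ k) * Real.exp (-a * regSq ε v ^ α) ≤
        2 * ((1 + regSq ε v ^ (r / 2) + regSq ε v ^ max N N') * Real.exp (-a * regSq ε v ^ α)) := by
      rw [← mul_assoc]
      refine mul_le_mul_of_nonneg_right ?_ hE.le
      have := aux k hk
      linarith
    calc |F ε v + G ε v| ≤ |F ε v| + |G ε v| := abs_add_le _ _
      _ ≤ _ := add_le_add (h1 ε hε v) (h2 ε hε v)
      _ ≤ _ := add_le_add (mul_le_mul_of_nonneg_left (b N (le_max_left _ _)) hC)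
        (mul_le_mul_of_nonneg_left (b N' (le_max_right _ _)) hC')
      _ = _ := by ring
  | smul c _ h1 =>
    obtain ⟨C, hC, N, h1⟩ := h1
    refine ⟨|c| * C, by positivity, N, fun ε hε v => ?_⟩
    rw [abs_mul, mul_assoc]
    exact mul_le_mul_of_nonneg_left (h1 ε hε v) (abs_nonneg _)

/-- In polar coordinates the radial density is `y ^ (s + 1)`, integrable at the origin exactly for
`s > -2`. -/
lemma integrable_norm_rpow_mul_exp {a α s : ℝ} (ha : 0 < a) (hα : 0 < α) (hs : -2 < s) :
    Integrable fun v : Plane => ‖v‖ ^ s * Real.exp (-a * ‖v‖ ^ (2 * α)) := by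
  rw [integrable_fun_norm_addHaar volume (f := fun y => y ^ s * Real.exp (-a * y ^ (2 * α)))]
  have := integrableOn_rpow_mul_exp_neg_mul_rpow (s := s + 1) (p := 2 * α) (b := a)
    (by linarith) (by linarith) ha
  refine this.congr_fun (fun y hy => ?_) measurableSet_Ioi
  have hy : 0 < y := hy
  simp only [finrank_euclideanSpace, Fintype.card_fin, smul_eq_mul]
  rw [Real.rpow_add_one hy.ne']
  ring

/-- An integrable majorant of a family of symbols, uniform in the regularization. -/
lemma IsSymbol.exists_majorant {a α r : ℝ} (ha : 0 < a) (hα : 0 < α) (hr : -2 < r) (hr0 : r ≤ 0)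
    {F : ℝ → Plane → ℝ} (hF : IsSymbol a α r F) :
    ∃ G : Plane → ℝ, Integrable G ∧ ∀ ε ∈ Ioc (0 : ℝ) 1, ∀ᵐ v, |F ε v| ≤ G v := by
  obtain ⟨C, hC, N, h⟩ := hF.bound
  refine ⟨fun v => C * ((1 + 2 ^ N) * (‖v‖ ^ (0 : ℝ) * Real.exp (-a * ‖v‖ ^ (2 * α)))
    + ‖v‖ ^ r * Real.exp (-a * ‖v‖ ^ (2 * α))
    + 2 ^ N * (‖v‖ ^ (2 * N : ℝ) * Real.exp (-a * ‖v‖ ^ (2 * α)))), ?_, fun ε hε => ?_⟩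
  · refine Integrable.const_mul (((Integrable.const_mul ?_ _).add ?_).add
      (Integrable.const_mul ?_ _)) _
    · exact integrable_norm_rpow_mul_exp ha hα (by norm_num)
    · exact integrable_norm_rpow_mul_exp ha hα hr
    · exact integrable_norm_rpow_mul_exp ha hα (by
        have : (0 : ℝ) ≤ 2 * N := by positivity
        linarith)
  · have : ∀ᵐ v : Plane, v ≠ 0 := by simp [ae_iff]
    filter_upwards [this] with v hv
    have hv : 0 < ‖v‖ := norm_pos_iff.2 hv
    refine (h ε hε.1 v).trans (mul_le_mul_of_nonneg_left ?_ hC)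
    have h0 : ‖v‖ ^ 2 ≤ regSq ε v := by rw [regSq_eq_norm]; linarith [hε.1]
    have h1 : regSq ε v ≤ 1 + ‖v‖ ^ 2 := by rw [regSq_eq_norm]; linarith [hε.2]
    have hq := regSq_pos hε.1 v
    have e1 : Real.exp (-a * regSq ε v ^ α) ≤ Real.exp (-a * ‖v‖ ^ (2 * α)) := by
      rw [Real.exp_le_exp, Real.rpow_mul hv.le]
      have := Real.rpow_le_rpow (by positivity) h0 hα.le
      rw [Real.rpow_two]
      nlinarith
    -- For `r ≤ 0` the regularization only decreases the singular power, which makes the majorant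
    -- independent of `ε`.
    have e2 : regSq ε v ^ (r / 2) ≤ ‖v‖ ^ r := by
      have := Real.rpow_le_rpow_of_nonpos (by positivity) h0 (by linarith : r / 2 ≤ 0)
      refine this.trans_eq ?_
      rw [← Real.rpow_two, ← Real.rpow_mul hv.le]; congr 1; ring
    have e3 : regSq ε v ^ N ≤ 2 ^ N * (1 + ‖v‖ ^ (2 * N : ℝ)) := by
      have e : ‖v‖ ^ (2 * N : ℝ) = (‖v‖ ^ 2) ^ N := by
        rw [Real.rpow_mul hv.le, Real.rpow_two, Real.rpow_natCast]
      rw [e]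
      refine (pow_le_pow_left₀ hq.le h1 N).trans ?_
      refine (add_pow_le zero_le_one (by positivity) N).trans ?_
      rw [one_pow]
      refine mul_le_mul_of_nonneg_right (pow_le_pow_right₀ (by norm_num) (by omega)) (by positivity)
    calc _ ≤ (1 + ‖v‖ ^ r + 2 ^ N * (1 + ‖v‖ ^ (2 * N : ℝ))) * Real.exp (-a * ‖v‖ ^ (2 * α)) := by
          gcongr
      _ = _ := by rw [Real.rpow_zero]; ring

lemma IsSymbol.integrable {a α r : ℝ} (ha : 0 < a) (hα : 0 < α) (hr : -2 < r) (hr0 : r ≤ 0)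
    {F : ℝ → Plane → ℝ} (hF : IsSymbol a α r F) {ε : ℝ} (hε : ε ∈ Ioc (0 : ℝ) 1) :
    Integrable (F ε) := by
  obtain ⟨G, hG, h⟩ := hF.exists_majorant ha hα hr hr0
  exact hG.mono' (hF.continuous hε.1).aestronglyMeasurable (h ε hε)

/-- The integral `∫ e^{2π i ⟨v, x⟩} F(v) dv` for a real function `F`. -/
def oscIntegral (F : Plane → ℝ) (x : Plane) : ℂ :=
  ∫ v : Plane, Complex.exp (↑(2 * Real.pi * inner ℝ v x) * Complex.I) * (F v : ℂ)

lemma norm_oscIntegral_integrand (F : Plane → ℝ) (x v : Plane) :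
    ‖Complex.exp (↑(2 * Real.pi * inner ℝ v x) * Complex.I) * (F v : ℂ)‖ = |F v| := by
  rw [norm_mul, Complex.norm_exp_ofReal_mul_I, one_mul, Complex.norm_real, Real.norm_eq_abs]

lemma integrable_oscIntegral {F : Plane → ℝ} (hF : Integrable F) (x : Plane) :
    Integrable fun v : Plane =>
      Complex.exp (↑(2 * Real.pi * inner ℝ v x) * Complex.I) * (F v : ℂ) := by
  refine hF.ofReal.bdd_mul (c := 1) ?_ (ae_of_all _ fun v => ?_)
  · exact Continuous.aestronglyMeasurable (by fun_prop)
  · rw [Complex.norm_exp_ofReal_mul_I]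

lemma norm_oscIntegral_le (F : Plane → ℝ) (x : Plane) :
    ‖oscIntegral F x‖ ≤ ∫ v, |F v| := by
  refine (norm_integral_le_integral_norm _).trans_eq ?_
  simp_rw [norm_oscIntegral_integrand]

/-- Integration by parts: a derivative on the symbol becomes multiplication by `-2πi x_j`. Only
integrability is needed to discard boundary terms. -/
lemma norm_oscIntegral_lineDeriv {F F' : Plane → ℝ} (j : Fin 2) (hF : Integrable F)
    (hF' : Integrable F') (h : ∀ v, HasLineDerivAt ℝ F (F' v) v (EuclideanSpace.single j 1))
    (x : Plane) :
    ‖oscIntegral F' x‖ = 2 * Real.pi * |x j| * ‖oscIntegral F x‖ := by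
  set e : Plane → ℂ := fun v => Complex.exp (↑(2 * Real.pi * inner ℝ v x) * Complex.I) with he
  set e' : Plane → ℂ := fun v => e v * (↑(2 * Real.pi * x j) * Complex.I) with he'
  have hd (v : Plane) : HasLineDerivAt ℝ e (e' v) v (EuclideanSpace.single j 1) := by
    unfold HasLineDerivAt
    have h1 : HasDerivAt (fun t : ℝ =>
        2 * Real.pi * inner ℝ (v + t • EuclideanSpace.single j (1 : ℝ)) x) (2 * Real.pi * x j) 0 := by
      have : (fun t : ℝ => 2 * Real.pi * inner ℝ (v + t • EuclideanSpace.single j (1 : ℝ)) x)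
          = fun t => t * (2 * Real.pi * x j) + 2 * Real.pi * inner ℝ v x := by
        ext t
        rw [inner_add_left, inner_smul_left, EuclideanSpace.inner_single_left]
        simp; ring
      rw [this]
      simpa using ((hasDerivAt_id (0 : ℝ)).mul_const (2 * Real.pi * x j)).add_const
        (2 * Real.pi * inner ℝ v x)
    have h2 := (h1.ofReal_comp.mul_const Complex.I).cexp
    simpa [he, he'] using h2
  have hdF (v : Plane) : HasLineDerivAt ℝ (fun v => (F v : ℂ)) (F' v : ℂ) v
      (EuclideanSpace.single j 1) := HasDerivAt.ofReal_comp (h v)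
  have i1 := integrable_oscIntegral hF x
  have i2 := integrable_oscIntegral hF' x
  have key := integral_bilinear_hasLineDerivAt_right_eq_neg_left_of_integrable (μ := volume)
    (f := e) (f' := e') (g := fun v => (F v : ℂ)) (g' := fun v => (F' v : ℂ))
    (B := ContinuousLinearMap.mul ℝ ℂ) (v := EuclideanSpace.single j 1)
    (by
      refine (i1.const_mul (↑(2 * Real.pi * x j) * Complex.I)).congr (ae_of_all _ fun v => ?_)
      simp only [he', he, ContinuousLinearMap.mul_apply']; ring)
    i2 i1 (fun v _ => hd v) (fun v _ => hdF v)
  have key2 : oscIntegral F' x = -((↑(2 * Real.pi * x j) * Complex.I) * oscIntegral F x) := by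
    unfold oscIntegral
    rw [← integral_const_mul]
    refine key.trans ?_
    congr 2
    ext v
    simp only [he', he, ContinuousLinearMap.mul_apply']; ring
  rw [key2, norm_neg, norm_mul, norm_mul, Complex.norm_I, Complex.norm_real, Real.norm_eq_abs,
    abs_mul, abs_of_pos Real.two_pi_pos]
  ring

/-- The function `v₀ⁿ v₁ᵐ exp (-a |v|^{2α})`. -/
def heatSymbol (a α : ℝ) (n m : ℕ) (v : Plane) : ℝ :=
  v 0 ^ n * v 1 ^ m * Real.exp (-a * ‖v‖ ^ (2 * α))

/-- The decay rate `(1 + |x|)⁻³`. -/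
def dec (x : Plane) : ℝ := ((1 + ‖x‖) ^ 3)⁻¹

lemma dec_pos (x : Plane) : 0 < dec x := by unfold dec; positivity

lemma dec_le_one (x : Plane) : dec x ≤ 1 := by
  unfold dec
  exact inv_le_one_of_one_le₀ (one_le_pow₀ (by linarith [norm_nonneg x]))

lemma continuous_dec : Continuous dec := by
  unfold dec
  exact Continuous.inv₀ (by fun_prop) fun x => by positivity

lemma integrable_dec : Integrable dec := by
  have := integrable_one_add_norm (E := Plane) (μ := volume) (r := 3) (by simp; norm_num)
  refine this.congr (ae_of_all _ fun x => ?_)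
  simp only [dec]
  rw [Real.rpow_neg (by positivity)]
  norm_cast

lemma symbolTerm_zero (a α : ℝ) (n m : ℕ) : symbolTerm a α n m 0 0 = heatSymbol a α n m := by
  ext v
  rw [symbolTerm, heatSymbol, regSq_eq_norm, add_zero, Real.rpow_zero, mul_one,
    Real.rpow_mul (norm_nonneg v), Real.rpow_two]

lemma continuous_heatSymbol {a α : ℝ} (hα : 0 < α) (n m : ℕ) :
    Continuous (heatSymbol a α n m) := by
  have : Continuous fun v : Plane => ‖v‖ ^ (2 * α) :=
    continuous_norm.rpow_const fun v => Or.inr (by positivity)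
  unfold heatSymbol
  fun_prop

lemma tendsto_symbolTerm {a α : ℝ} (hα : 0 < α) (n m : ℕ) (v : Plane) :
    Tendsto (fun ε => symbolTerm a α n m 0 ε v) (𝓝[>] 0) (𝓝 (heatSymbol a α n m v)) := by
  rw [← symbolTerm_zero]
  have : Continuous fun ε => symbolTerm a α n m 0 ε v := by
    simp only [symbolTerm, Real.rpow_zero]
    have : Continuous fun ε => regSq ε v ^ α :=
      Continuous.rpow_const (by unfold regSq; fun_prop) fun v => Or.inr hα.le
    fun_prop
  exact (this.tendsto 0).mono_left nhdsWithin_le_nhds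

lemma eventually_mem_Ioc : ∀ᶠ ε in 𝓝[>] (0 : ℝ), ε ∈ Ioc (0 : ℝ) 1 :=
  Ioc_mem_nhdsGT zero_lt_one

lemma integrable_heatSymbol {a α : ℝ} (ha : 0 < a) (hα : 0 < α) (n m : ℕ) :
    Integrable (heatSymbol a α n m) := by
  have hF : IsSymbol a α (-1) (symbolTerm a α n m 0) :=
    .term _ _ _ (Or.inr ⟨rfl, by linarith⟩)
  obtain ⟨G, hG, h⟩ := hF.exists_majorant ha hα (by norm_num) (by norm_num)
  refine hG.mono' (continuous_heatSymbol hα n m).aestronglyMeasurable ?_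
  -- The majorant holds off a null set depending on `ε`, so the limit is taken along a sequence.
  have h2 (k : ℕ) : 1 / ((k : ℝ) + 1) ∈ Ioc (0 : ℝ) 1 := ⟨by positivity, by
    rw [div_le_one (by positivity)]; linarith [k.cast_nonneg (α := ℝ)]⟩
  have h3 := ae_all_iff.2 fun k : ℕ => h _ (h2 k)
  filter_upwards [h3] with v hv
  have ht : Tendsto (fun k : ℕ => 1 / ((k : ℝ) + 1)) atTop (𝓝[>] 0) :=
    tendsto_nhdsWithin_iff.2 ⟨tendsto_one_div_add_atTop_nhds_zero_nat,
      Eventually.of_forall fun k => (h2 k).1⟩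
  exact le_of_tendsto ((tendsto_symbolTerm hα n m v).comp ht).abs (Eventually.of_forall hv)

lemma tendsto_oscIntegral_symbolTerm {a α : ℝ} (ha : 0 < a) (hα : 0 < α) (n m : ℕ) (x : Plane) :
    Tendsto (fun ε => oscIntegral (symbolTerm a α n m 0 ε) x) (𝓝[>] 0)
      (𝓝 (oscIntegral (heatSymbol a α n m) x)) := by
  have hF : IsSymbol a α (-1) (symbolTerm a α n m 0) :=
    .term _ _ _ (Or.inr ⟨rfl, by linarith⟩)
  obtain ⟨G, hG, h⟩ := hF.exists_majorant ha hα (by norm_num) (by norm_num)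
  unfold oscIntegral
  refine tendsto_integral_filter_of_dominated_convergence G ?_ ?_ hG ?_
  · filter_upwards [self_mem_nhdsWithin] with ε hε
    have := hF.continuous (ε := ε) hε
    exact Continuous.aestronglyMeasurable (by fun_prop)
  · filter_upwards [eventually_mem_Ioc] with ε hε
    filter_upwards [h ε hε] with v hv
    rwa [norm_oscIntegral_integrand]
  · refine ae_of_all _ fun v => Tendsto.const_mul _ ?_
    exact (Complex.continuous_ofReal.tendsto _).comp (tendsto_symbolTerm hα n m v)

/-- Three integrations by parts lower the order from `2 α` to `2 α - 3 > -2`, still integrable in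
the plane. The bound is uniform in `ε` and survives the limit `ε → 0`. -/
lemma exists_coord_decay {a α : ℝ} (ha : 0 < a) (hα : 1 / 2 < α) (n m : ℕ) (j : Fin 2) :
    ∃ C, ∀ x, |x j| ^ 3 * ‖oscIntegral (heatSymbol a α n m) x‖ ≤ C := by
  have hα0 : 0 < α := by linarith
  have hF : IsSymbol a α (2 * α) (symbolTerm a α n m 0) := .term _ _ _ (Or.inr ⟨rfl, le_rfl⟩)
  obtain ⟨F1, hF1, h1⟩ := hF.exists_lineDeriv hα0 j
  obtain ⟨F2, hF2, h2⟩ := hF1.exists_lineDeriv hα0 j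
  obtain ⟨F3, hF3, h3⟩ := hF2.exists_lineDeriv hα0 j
  -- The minimum with `-1` only serves large `α`, since a majorant requires a nonpositive order.
  set r := min (2 * α - 3) (-1) with hr
  have hr1 : -2 < r := lt_min (by linarith) (by norm_num)
  have hr2 : r ≤ 0 := (min_le_right _ _).trans (by norm_num)
  have hr3 : r ≤ 2 * α - 3 := min_le_left _ _
  obtain ⟨G, hG, h⟩ := (hF3.weaken (r' := r) (by linarith)).exists_majorant ha hα0 hr1 hr2
  refine ⟨((2 * Real.pi) ^ 3)⁻¹ * ∫ v, G v, fun x => ?_⟩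
  have ht := ((tendsto_oscIntegral_symbolTerm ha hα0 n m x).norm.const_mul (|x j| ^ 3))
  refine le_of_tendsto ht ?_
  filter_upwards [eventually_mem_Ioc] with ε hε
  have i0 := (hF.weaken (r' := r) (by linarith)).integrable ha hα0 hr1 hr2 hε
  have i1 := (hF1.weaken (r' := r) (by linarith)).integrable ha hα0 hr1 hr2 hε
  have i2 := (hF2.weaken (r' := r) (by linarith)).integrable ha hα0 hr1 hr2 hε
  have i3 := (hF3.weaken (r' := r) (by linarith)).integrable ha hα0 hr1 hr2 hε
  have e1 := norm_oscIntegral_lineDeriv j i0 i1 (h1 ε hε.1) x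
  have e2 := norm_oscIntegral_lineDeriv j i1 i2 (h2 ε hε.1) x
  have e3 := norm_oscIntegral_lineDeriv j i2 i3 (h3 ε hε.1) x
  have hb : ‖oscIntegral (F3 ε) x‖ ≤ ∫ v, G v :=
    (norm_oscIntegral_le _ _).trans (integral_mono_ae i3.abs hG (h ε hε))
  have hpi : (0 : ℝ) < (2 * Real.pi) ^ 3 := by positivity
  rw [inv_mul_eq_div, le_div_iff₀ hpi]
  refine le_trans (le_of_eq ?_) hb
  rw [e3, e2, e1]
  ring

theorem exists_decay_oscIntegral {a α : ℝ} (ha : 0 < a) (hα : 1 / 2 < α) (n m : ℕ) :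
    ∃ C, ∀ x, ‖oscIntegral (heatSymbol a α n m) x‖ ≤ C * dec x := by
  obtain ⟨C0, h0⟩ := exists_coord_decay ha hα n m 0
  obtain ⟨C1, h1⟩ := exists_coord_decay ha hα n m 1
  refine ⟨9 * ((∫ v, |heatSymbol a α n m v|) + C0 + C1), fun x => ?_⟩
  have hn := norm_oscIntegral_le (heatSymbol a α n m) x
  have h0 := h0 x
  have h1 := h1 x
  rw [dec, ← div_eq_mul_inv, le_div_iff₀ (by positivity)]
  have hx : ‖x‖ ≤ |x 0| + |x 1| := by
    rw [EuclideanSpace.norm_eq, Real.sqrt_le_left (by positivity)]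
    simp [Fin.sum_univ_two]
    nlinarith [abs_nonneg (x 0), abs_nonneg (x 1), sq_abs (x 0), sq_abs (x 1)]
  -- Power mean inequality for the three summands `1`, `|x 0|`, `|x 1|`, whence `9 = 3²`.
  have hc : (1 + ‖x‖) ^ 3 ≤ 9 * (1 + |x 0| ^ 3 + |x 1| ^ 3) := by
    have a0 := abs_nonneg (x 0)
    have a1 := abs_nonneg (x 1)
    generalize |x 0| = p at *
    generalize |x 1| = q at *
    refine (pow_le_pow_left₀ (by positivity) (by linarith : 1 + ‖x‖ ≤ 1 + p + q) 3).trans ?_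
    nlinarith [mul_nonneg (add_nonneg zero_le_one a0) (sq_nonneg (p - 1)),
      mul_nonneg (add_nonneg zero_le_one a1) (sq_nonneg (q - 1)),
      mul_nonneg (add_nonneg a0 a1) (sq_nonneg (p - q)), mul_nonneg a1 (sq_nonneg (p - 1)),
      mul_nonneg a0 (sq_nonneg (q - 1)), sq_nonneg (p - q)]
  calc _ ≤ ‖oscIntegral (heatSymbol a α n m) x‖ * (9 * (1 + |x 0| ^ 3 + |x 1| ^ 3)) := by gcongr
    _ ≤ _ := by linarith

/-! ### The heat kernel at unit time -/

lemma hasFDerivAt_oscIntegral {F : Plane → ℝ} (hF : Integrable F)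
    (hF' : Integrable fun v => ‖v‖ * |F v|) (x : Plane) :
    ∃ L : Plane →L[ℝ] ℂ, HasFDerivAt (oscIntegral F) L x ∧
      ∀ j, L (EuclideanSpace.single j 1)
        = 2 * Real.pi * Complex.I * oscIntegral (fun v => v j * F v) x := by
  set G : Plane → ℂ := fun v => (F v : ℂ) with hG
  have hGi : Integrable G := hF.ofReal
  have hGi' : Integrable fun v => ‖v‖ * ‖G v‖ := by simpa [hG] using hF'
  -- The reflection accounts for the sign `+2πi` in the derivative formula.
  have e : oscIntegral F = fun x => 𝓕 G (-x) := by
    ext x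
    rw [← Real.fourierInv_eq_fourier_neg, Real.fourierInv_eq']
    simp [oscIntegral, hG]
  have h := (Real.hasFDerivAt_fourier hGi hGi' (-x)).comp x (hasFDerivAt_id x).neg
  rw [e]
  refine ⟨_, h, fun j => ?_⟩
  have hint : Integrable (VectorFourier.fourierSMulRight (innerSL ℝ) G) := by
    refine (hGi'.const_mul (2 * Real.pi)).mono' hGi.1.fourierSMulRight (ae_of_all _ fun v => ?_)
    refine (VectorFourier.norm_fourierSMulRight_le _ _ _).trans ?_
    calc 2 * Real.pi * ‖innerSL ℝ (E := Plane)‖ * ‖v‖ * ‖G v‖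
        ≤ 2 * Real.pi * 1 * ‖v‖ * ‖G v‖ := by gcongr; exact norm_innerSL_le ℝ
      _ = _ := by ring
  rw [ContinuousLinearMap.comp_apply, Real.fourier_eq, ContinuousLinearMap.integral_apply]
  · rw [oscIntegral, ← integral_const_mul]
    refine integral_congr_ae (ae_of_all _ fun v => ?_)
    have hj : innerSL ℝ v (EuclideanSpace.single j (1 : ℝ)) = v j := by
      rw [innerSL_apply_apply]; simp [EuclideanSpace.inner_single_right]
    have hs : VectorFourier.fourierSMulRight (innerSL ℝ) G v (EuclideanSpace.single j 1)
        = -(2 * Real.pi * Complex.I) • v j • G v := by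
      rw [← hj]; rfl
    simp only [neg_apply, ContinuousLinearMap.id_apply, inner_neg_right,
      neg_neg, Circle.smul_def, smul_apply, Real.fourierChar_apply, map_neg, hs]
    simp [hG]
    ring
  · exact (Real.fourierIntegral_convergent_iff (-x)).2 hint

lemma integrable_norm_mul_heatSymbol {a α : ℝ} (ha : 0 < a) (hα : 0 < α) (n m : ℕ) :
    Integrable fun v => ‖v‖ * |heatSymbol a α n m v| := by
  have h := (integrable_heatSymbol ha hα (n + 1) m).abs.add
    (integrable_heatSymbol ha hα n (m + 1)).abs
  refine h.mono' (Continuous.aestronglyMeasurable ?_) (ae_of_all _ fun v => ?_)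
  · exact continuous_norm.mul (continuous_heatSymbol hα n m).abs
  · have hx : ‖v‖ ≤ |v 0| + |v 1| := by
      rw [EuclideanSpace.norm_eq, Real.sqrt_le_left (by positivity)]
      simp [Fin.sum_univ_two]
      nlinarith [abs_nonneg (v 0), abs_nonneg (v 1), sq_abs (v 0), sq_abs (v 1)]
    rw [Real.norm_eq_abs, abs_of_nonneg (by positivity)]
    refine (mul_le_mul_of_nonneg_right hx (abs_nonneg _)).trans_eq ?_
    simp only [heatSymbol, abs_mul, abs_pow, Pi.add_apply]
    ring

/-- The symbol of `∂_j`, up to the factor `2π i`, applied to a heat symbol. -/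
lemma coord_mul_heatSymbol (a α : ℝ) (n m : ℕ) (j : Fin 2) :
    ∃ n' m', (fun v : Plane => v j * heatSymbol a α n m v) = heatSymbol a α n' m' := by
  fin_cases j
  · exact ⟨n + 1, m, by ext v; simp [heatSymbol]; ring⟩
  · exact ⟨n, m + 1, by ext v; simp [heatSymbol]; ring⟩

/-- The functions `c • Re (z • ∫ e^{2π i⟨v, x⟩} v₀ⁿ v₁ᵐ exp (-a |v|^{2α}) dv)`. -/
def IsKernel (a α : ℝ) (f : Plane → ℝ) : Prop :=
  ∃ (z : ℂ) (n m : ℕ), f = fun x => (z * oscIntegral (heatSymbol a α n m) x).re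

lemma IsKernel.exists_decay {a α : ℝ} (ha : 0 < a) (hα : 1 / 2 < α) {f : Plane → ℝ}
    (hf : IsKernel a α f) : ∃ C, ∀ x, |f x| ≤ C * dec x := by
  obtain ⟨z, n, m, rfl⟩ := hf
  obtain ⟨C, h⟩ := exists_decay_oscIntegral ha hα n m
  refine ⟨‖z‖ * C, fun x => (Complex.abs_re_le_norm _).trans ?_⟩
  rw [norm_mul, mul_assoc]
  exact mul_le_mul_of_nonneg_left (h x) (norm_nonneg z)

lemma IsKernel.differentiable {a α : ℝ} (ha : 0 < a) (hα : 0 < α) {f : Plane → ℝ}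
    (hf : IsKernel a α f) : Differentiable ℝ f := by
  obtain ⟨z, n, m, rfl⟩ := hf
  intro x
  obtain ⟨L, hL, -⟩ := hasFDerivAt_oscIntegral (integrable_heatSymbol ha hα n m)
    (integrable_norm_mul_heatSymbol ha hα n m) x
  exact (Complex.reCLM.hasFDerivAt.comp x (hL.const_mul z)).differentiableAt

lemma IsKernel.partialDeriv {a α : ℝ} (ha : 0 < a) (hα : 0 < α) {f : Plane → ℝ}
    (hf : IsKernel a α f) (j : Fin 2) : IsKernel a α (partialDeriv j f) := by
  obtain ⟨z, n, m, rfl⟩ := hf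
  obtain ⟨n', m', e⟩ := coord_mul_heatSymbol a α n m j
  refine ⟨z * (2 * Real.pi * Complex.I), n', m', ?_⟩
  ext x
  obtain ⟨L, hL, hj⟩ := hasFDerivAt_oscIntegral (integrable_heatSymbol ha hα n m)
    (integrable_norm_mul_heatSymbol ha hα n m) x
  have h := (Complex.reCLM.hasFDerivAt.comp x (hL.const_mul z))
  have h2 := h.fderiv
  rw [SQG.partialDeriv, ← e, mul_assoc, ← hj j]
  change fderiv ℝ (Complex.reCLM ∘ fun y => z * oscIntegral (heatSymbol a α n m) y) x _ = _
  rw [h2]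
  simp

lemma norm_fderiv_le_partialDeriv (f : Plane → ℝ) (x : Plane) :
    ‖fderiv ℝ f x‖ ≤ |partialDeriv 0 f x| + |partialDeriv 1 f x| := by
  refine ContinuousLinearMap.opNorm_le_bound _ (by positivity) fun v => ?_
  have hv : v = v 0 • EuclideanSpace.single 0 (1 : ℝ) + v 1 • EuclideanSpace.single 1 (1 : ℝ) := by
    ext k; fin_cases k <;> simp
  have e : fderiv ℝ f x v = v 0 * partialDeriv 0 f x + v 1 * partialDeriv 1 f x := by
    conv_lhs => rw [hv]
    rw [map_add, map_smul, map_smul]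
    simp [partialDeriv]
  rw [e, Real.norm_eq_abs]
  have h0 := abs_coord_le_norm v 0
  have h1 := abs_coord_le_norm v 1
  calc _ ≤ |v 0| * |partialDeriv 0 f x| + |v 1| * |partialDeriv 1 f x| := by
        rw [← abs_mul, ← abs_mul]; exact abs_add_le _ _
    _ ≤ ‖v‖ * |partialDeriv 0 f x| + ‖v‖ * |partialDeriv 1 f x| := by gcongr
    _ = _ := by ring

lemma IsKernel.exists_fderiv_decay {a α : ℝ} (ha : 0 < a) (hα : 1 / 2 < α) {f : Plane → ℝ}
    (hf : IsKernel a α f) : ∃ C, ∀ x, ‖fderiv ℝ f x‖ ≤ C * dec x := by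
  have hα0 : 0 < α := by linarith
  obtain ⟨C0, h0⟩ := (hf.partialDeriv ha hα0 0).exists_decay ha hα
  obtain ⟨C1, h1⟩ := (hf.partialDeriv ha hα0 1).exists_decay ha hα
  refine ⟨C0 + C1, fun x => (norm_fderiv_le_partialDeriv f x).trans ?_⟩
  rw [add_mul]
  exact add_le_add (h0 x) (h1 x)

/-- The coefficient of the heat symbol in Mathlib's normalization of the Fourier transform. -/
def heatCoeff (ν α : ℝ) : ℝ := ν * (2 * Real.pi) ^ (2 * α)

lemma heatCoeff_pos {ν : ℝ} (hν : 0 < ν) (α : ℝ) : 0 < heatCoeff ν α := by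
  unfold heatCoeff; positivity

lemma heatKernel_eq (ν α t : ℝ) (x : Plane) :
    heatKernel ν α t x = (oscIntegral (fun v => Real.exp (-heatCoeff ν α * ‖v‖ ^ (2 * α) * t)) x).re := by
  rw [heatKernel, Real.fourierInv_eq', oscIntegral]
  congr 2
  ext v
  rw [smul_eq_mul, norm_smul, Real.mul_rpow (norm_nonneg _) (norm_nonneg _), heatCoeff,
    Real.norm_of_nonneg Real.two_pi_pos.le]
  congr 3
  ring

lemma heatSymbol_zero_zero (a α : ℝ) (v : Plane) :
    heatSymbol a α 0 0 v = Real.exp (-a * ‖v‖ ^ (2 * α)) := by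
  simp [heatSymbol]

lemma isKernel_heatKernel (ν α : ℝ) : IsKernel (heatCoeff ν α) α (heatKernel ν α 1) := by
  refine ⟨1, 0, 0, ?_⟩
  ext x
  rw [heatKernel_eq, one_mul]
  congr 2
  ext v
  rw [mul_one, heatSymbol_zero_zero]

lemma IsKernel.integrable {a α : ℝ} (ha : 0 < a) (hα : 1 / 2 < α) {f : Plane → ℝ}
    (hf : IsKernel a α f) : Integrable f := by
  obtain ⟨C, h⟩ := hf.exists_decay ha hα
  exact (integrable_dec.const_mul C).mono'
    (hf.differentiable ha (by linarith)).continuous.aestronglyMeasurable (ae_of_all _ h)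

/-- Fourier inversion at frequency zero, where the symbol equals one. The decay of the kernel
supplies the integrability that inversion requires. -/
lemma integral_heatKernel_one {ν α : ℝ} (hν : 0 < ν) (hα : 1 / 2 < α) :
    ∫ x, heatKernel ν α 1 x = 1 := by
  have ha := heatCoeff_pos hν α
  have hα0 : 0 < α := by linarith
  set a := heatCoeff ν α
  set m : Plane → ℂ := fun v => (heatSymbol a α 0 0 v : ℂ) with hm
  have hc : Continuous m := Complex.continuous_ofReal.comp (continuous_heatSymbol hα0 0 0)
  have hi : Integrable m := (integrable_heatSymbol ha hα0 0 0).ofReal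
  have e : oscIntegral (heatSymbol a α 0 0) = 𝓕⁻ m := by
    ext x
    rw [Real.fourierInv_eq']
    simp [oscIntegral, hm]
  obtain ⟨C, hC⟩ := exists_decay_oscIntegral ha hα 0 0
  have hcont : Continuous (oscIntegral (heatSymbol a α 0 0)) := by
    refine Differentiable.continuous (𝕜 := ℝ) fun x => ?_
    obtain ⟨L, hL, -⟩ := hasFDerivAt_oscIntegral (integrable_heatSymbol ha hα0 0 0)
      (integrable_norm_mul_heatSymbol ha hα0 0 0) x
    exact hL.differentiableAt
  have hint : Integrable (oscIntegral (heatSymbol a α 0 0)) :=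
    (integrable_dec.const_mul C).mono' hcont.aestronglyMeasurable (ae_of_all _ hC)
  have hint2 : Integrable (𝓕 m) := by
    have : 𝓕 m = fun x => (𝓕⁻ m) (-x) := by
      ext x; rw [Real.fourierInv_eq_fourier_neg, neg_neg]
    rw [this, ← e]
    exact hint.comp_neg
  have h1 := congrFun (hc.fourier_fourierInv_eq hi hint2) 0
  rw [Real.fourier_eq, ← e] at h1
  simp only [inner_zero_right, neg_zero, AddChar.map_zero_eq_one, one_smul] at h1
  have h2 : m 0 = 1 := by
    simp [hm, heatSymbol, Real.zero_rpow (by positivity : 2 * α ≠ 0)]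
  have h3 : heatKernel ν α 1 = fun x => (oscIntegral (heatSymbol a α 0 0) x).re := by
    ext x
    rw [heatKernel_eq]
    congr 2
    ext v
    rw [mul_one, heatSymbol_zero_zero]
  rw [h3]
  have h4 := integral_re hint
  simp only [RCLike.re_to_complex] at h4
  rw [h4, h1, h2, Complex.one_re]

/-! ### Scaling -/

/-- The dilation `δ² f(δ x)`, normalized in `L¹`. -/
def dil (δ : ℝ) (f : Plane → ℝ) (x : Plane) : ℝ := δ ^ 2 * f (δ • x)

lemma integral_comp_smul_plane {E : Type*} [NormedAddCommGroup E] [NormedSpace ℝ E]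
    {δ : ℝ} (hδ : 0 < δ) (f : Plane → E) :
    δ ^ 2 • ∫ x, f (δ • x) = ∫ x, f x := by
  rw [Measure.integral_comp_smul, finrank_euclideanSpace, Fintype.card_fin,
    abs_of_pos (by positivity), smul_smul, mul_inv_cancel₀ (by positivity), one_smul]

lemma integral_dil {δ : ℝ} (hδ : 0 < δ) (f : Plane → ℝ) : ∫ x, dil δ f x = ∫ x, f x := by
  simp only [dil]
  rw [integral_const_mul, ← smul_eq_mul, integral_comp_smul_plane hδ]

lemma abs_dil (δ : ℝ) (f : Plane → ℝ) (x : Plane) : |dil δ f x| = dil δ (fun y => |f y|) x := by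
  simp [dil, abs_mul]

lemma integrable_dil {δ : ℝ} (hδ : 0 < δ) {f : Plane → ℝ} (hf : Integrable f) :
    Integrable (dil δ f) :=
  (hf.comp_smul hδ.ne').const_mul _

/-- The length scale `t^{-1/(2α)}` of the inverse diffusion length. -/
def scale (α t : ℝ) : ℝ := t ^ (-(1 / (2 * α)))

lemma scale_pos (α : ℝ) {t : ℝ} (ht : 0 < t) : 0 < scale α t := Real.rpow_pos_of_pos ht _

lemma scale_rpow {α t : ℝ} (hα : 0 < α) (ht : 0 < t) : scale α t ^ (2 * α) * t = 1 := by
  rw [scale, ← Real.rpow_mul ht.le]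
  have : -(1 / (2 * α)) * (2 * α) = -1 := by field_simp
  rw [this, Real.rpow_neg_one, inv_mul_cancel₀ ht.ne']

/-- Substitution `v ↦ δ v` in the Fourier integral, with `δ` chosen so that `δ^{2α} t = 1`. -/
lemma heatKernel_eq_dil {ν α t : ℝ} (hα : 0 < α) (ht : 0 < t) :
    heatKernel ν α t = dil (scale α t) (heatKernel ν α 1) := by
  have hδ := scale_pos α ht
  ext x
  rw [dil, heatKernel_eq, heatKernel_eq, oscIntegral, ← integral_comp_smul_plane hδ]
  rw [Complex.real_smul, Complex.re_ofReal_mul]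
  congr 2
  rw [oscIntegral]
  congr 1
  ext v
  rw [inner_smul_left, inner_smul_right, norm_smul, Real.norm_of_nonneg hδ.le,
    Real.mul_rpow hδ.le (norm_nonneg _), mul_one]
  congr 3
  have := scale_rpow hα ht
  linear_combination (-heatCoeff ν α * ‖v‖ ^ (2 * α)) * this

lemma partialDeriv_dil (j : Fin 2) (δ : ℝ) (f : Plane → ℝ) (x : Plane) :
    partialDeriv j (dil δ f) x = δ * dil δ (partialDeriv j f) x := by
  unfold partialDeriv dil
  have : (fun x => δ ^ 2 * f (δ • x)) = (δ ^ 2) • fun x => f (δ • x) := by ext; simp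
  rw [this, fderiv_const_smul_field, Pi.smul_apply, fderiv_comp_smul]
  simp
  ring

lemma conv_eq_integral_sub (k f : Plane → ℝ) (x : Plane) : conv k f x = ∫ z, k z * f (x - z) := by
  rw [conv, ← integral_sub_left_eq_self _ volume x]
  simp

lemma K_smul {δ : ℝ} (hδ : 0 < δ) (z : Plane) (i : Fin 2) : δ ^ 2 * K (δ • z) i = K z i := by
  have h : K (δ • z) i = (2 * Real.pi * (δ * ‖z‖) ^ 3)⁻¹ * (δ * (!₂[-z 1, z 0] : Plane) i) := by
    simp only [K, norm_smul, Real.norm_of_nonneg hδ.le, PiLp.smul_apply, smul_eq_mul]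
    fin_cases i <;> simp
  rw [h, K, PiLp.smul_apply, smul_eq_mul]
  field_simp

/-- Homogeneity of `K` of degree `-2` cancels the Jacobian in the plane, so a dilation acts only on
the radii. The limit `(r, R) → (0, ∞)` is therefore dilation invariant. -/
lemma truncConv_dil {δ : ℝ} (hδ : 0 < δ) (r R : ℝ) (i : Fin 2) (f : Plane → ℝ) (x : Plane) :
    truncConv r R i (dil δ f) x = dil δ (truncConv (δ * r) (δ * R) i f) x := by
  rw [dil, truncConv, truncConv, conv_eq_integral_sub, conv_eq_integral_sub,
    ← integral_comp_smul_plane hδ (fun z => (annulus (δ * r) (δ * R)).indicator (fun z => K z i) z *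
      f (δ • x - z)), smul_eq_mul, ← integral_const_mul, ← integral_const_mul]
  congr 1
  ext z
  have hm : δ • z ∈ annulus (δ * r) (δ * R) ↔ z ∈ annulus r R := by
    simp only [annulus, mem_ofPred_eq, norm_smul, Real.norm_of_nonneg hδ.le]
    rw [mul_lt_mul_iff_right₀ hδ, mul_lt_mul_iff_right₀ hδ]
  by_cases hz : z ∈ annulus r R
  · rw [indicator_of_mem hz, indicator_of_mem (hm.2 hz), ← K_smul hδ, dil, smul_sub]
    ring
  · rw [indicator_of_notMem hz, indicator_of_notMem (fun h => hz (hm.1 h))]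
    simp

instance : pvFilter.NeBot := by unfold pvFilter; infer_instance

lemma tendsto_scale_pvFilter {δ : ℝ} (hδ : 0 < δ) :
    Tendsto (fun p : ℝ × ℝ => (δ * p.1, δ * p.2)) pvFilter pvFilter := by
  refine Tendsto.prodMk ?_ ?_
  · refine Tendsto.comp (g := fun r : ℝ => δ * r) ?_ tendsto_fst
    refine tendsto_nhdsWithin_iff.2 ⟨?_, ?_⟩
    · have : Tendsto (fun r : ℝ => δ * r) (𝓝 0) (𝓝 (δ * 0)) := (continuous_const_mul δ).tendsto 0
      rw [mul_zero] at this
      exact this.mono_left nhdsWithin_le_nhds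
    · filter_upwards [self_mem_nhdsWithin] with r hr
      exact mul_pos hδ hr
  · exact (tendsto_id.const_mul_atTop hδ).comp tendsto_snd

lemma truncConv_const_mul (r R : ℝ) (i : Fin 2) (c : ℝ) (f : Plane → ℝ) (x : Plane) :
    truncConv r R i (fun y => c * f y) x = c * truncConv r R i f x := by
  simp only [truncConv, conv]
  rw [← integral_const_mul]
  congr 1; ext y; ring

lemma pvConv_const_mul_dil {δ : ℝ} (hδ : 0 < δ) (i : Fin 2) (c : ℝ) {f P : Plane → ℝ}
    (h : ∀ x, Tendsto (fun p : ℝ × ℝ => truncConv p.1 p.2 i f x) pvFilter (𝓝 (P x))) :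
    pvConv i (fun x => c * dil δ f x) = fun x => c * dil δ P x := by
  ext x
  refine Tendsto.limUnder_eq ?_
  simp only [truncConv_const_mul, truncConv_dil hδ]
  exact (((h (δ • x)).comp (tendsto_scale_pvFilter hδ)).const_mul (δ ^ 2)).const_mul c

lemma partialDeriv_heatKernel {ν α t : ℝ} (hα : 0 < α) (ht : 0 < t) (j : Fin 2) :
    partialDeriv j (heatKernel ν α t)
      = fun x => scale α t * dil (scale α t) (partialDeriv j (heatKernel ν α 1)) x := by
  ext x
  rw [heatKernel_eq_dil hα ht, partialDeriv_dil]

/-! ### Truncations of the singular kernel -/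

/-- The kernel `K^i` restricted to `|z| ≥ r`. -/
def outerK (r : ℝ) (i : Fin 2) : Plane → ℝ := {z : Plane | r ≤ ‖z‖}.indicator fun z => K z i

lemma measurable_coord (i : Fin 2) : Measurable fun v : Plane => v i :=
  (by fun_prop : Continuous fun v : Plane => v i).measurable

lemma measurable_K (i : Fin 2) : Measurable fun z => K z i := by
  have : (fun z => K z i) = fun z : Plane =>
      (2 * Real.pi * ‖z‖ ^ 3)⁻¹ * (if i = 0 then -z 1 else z 0) := by
    ext z; fin_cases i <;> simp [K]
  rw [this]
  have h0 := measurable_coord 0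
  have h1 := measurable_coord 1
  split_ifs <;> fun_prop

lemma measurable_outerK (r : ℝ) (i : Fin 2) : Measurable (outerK r i) :=
  (measurable_K i).indicator (measurableSet_le measurable_const measurable_norm)

lemma abs_perp_le (z : Plane) (i : Fin 2) : |(!₂[-z 1, z 0] : Plane) i| ≤ ‖z‖ := by
  fin_cases i
  · simpa using abs_coord_le_norm z 1
  · simpa using abs_coord_le_norm z 0

lemma abs_K_le (z : Plane) (i : Fin 2) : |K z i| ≤ (‖z‖ ^ 2)⁻¹ := by
  rcases eq_or_ne z 0 with rfl | hz
  · fin_cases i <;> simp [K]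
  have hz : 0 < ‖z‖ := norm_pos_iff.2 hz
  rw [K, PiLp.smul_apply, smul_eq_mul, abs_mul, abs_of_pos (by positivity)]
  calc _ ≤ (2 * Real.pi * ‖z‖ ^ 3)⁻¹ * ‖z‖ := by gcongr; exact abs_perp_le z i
    _ ≤ (1 * ‖z‖ ^ 3)⁻¹ * ‖z‖ := by
        gcongr
        linarith [Real.pi_gt_three]
    _ = _ := by field_simp

lemma K_neg (z : Plane) (i : Fin 2) : K (-z) i = -K z i := by
  fin_cases i <;> simp [K]

lemma abs_outerK_le {r : ℝ} (hr : 0 < r) (i : Fin 2) (z : Plane) : |outerK r i z| ≤ (r ^ 2)⁻¹ := by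
  by_cases hz : r ≤ ‖z‖
  · rw [outerK, indicator_of_mem (by exact hz)]
    exact (abs_K_le z i).trans (by gcongr)
  · rw [outerK, indicator_of_notMem (by exact hz)]
    simpa using by positivity

/-- A Lipschitz bound reflecting `|∇K| ≲ |z|⁻³`; as `|h| ≤ |z| / 2`, the norms of `z` and `z + h`
are comparable. The numerator is linear in `z`, and the two denominators are compared by factoring a
difference of cubes. -/
lemma abs_K_add_sub_le (z h : Plane) (i : Fin 2) (hz : z ≠ 0) (hh : ‖h‖ ≤ ‖z‖ / 2) :
    |K (z + h) i - K z i| ≤ 32 * ‖h‖ / ‖z‖ ^ 3 := by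
  have hz : 0 < ‖z‖ := norm_pos_iff.2 hz
  set w := z + h with hw
  have h1 : |‖w‖ - ‖z‖| ≤ ‖h‖ := by
    refine (abs_norm_sub_norm_le w z).trans_eq ?_
    rw [hw, add_sub_cancel_left]
  have h1' := abs_le.1 h1
  have hw1 : ‖z‖ / 2 ≤ ‖w‖ := by linarith
  have hw2 : ‖w‖ ≤ 2 * ‖z‖ := by linarith
  have hw0 : 0 < ‖w‖ := by linarith
  set p : Plane → ℝ := fun v => (!₂[-v 1, v 0] : Plane) i with hp
  have hadd : p w = p z + p h := by
    simp only [hp, hw]; fin_cases i <;> simp; ring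
  have e : K w i - K z i
      = (2 * Real.pi * ‖z‖ ^ 3)⁻¹ * p h
        + (2 * Real.pi)⁻¹ * (((‖z‖ - ‖w‖) * (‖z‖ ^ 2 + ‖z‖ * ‖w‖ + ‖w‖ ^ 2)) * p w)
          / (‖z‖ ^ 3 * ‖w‖ ^ 3) := by
    have e1 : K w i = (2 * Real.pi * ‖w‖ ^ 3)⁻¹ * p w := by
      rw [K, PiLp.smul_apply, smul_eq_mul]
    have e2 : K z i = (2 * Real.pi * ‖z‖ ^ 3)⁻¹ * p z := by
      rw [K, PiLp.smul_apply, smul_eq_mul]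
    have e3 : p z = p w - p h := by rw [hadd]; ring
    rw [e1, e2, e3]
    field_simp
    ring
  have hpi : (2 * Real.pi)⁻¹ ≤ 1 := inv_le_one_of_one_le₀ (by linarith [Real.pi_gt_three])
  have b1 : |(2 * Real.pi * ‖z‖ ^ 3)⁻¹ * p h| ≤ ‖h‖ / ‖z‖ ^ 3 := by
    rw [abs_mul, abs_of_pos (by positivity), mul_inv, mul_assoc, div_eq_inv_mul]
    have := mul_le_mul_of_nonneg_left (abs_perp_le h i) (by positivity : 0 ≤ (‖z‖ ^ 3)⁻¹)
    calc _ ≤ 1 * ((‖z‖ ^ 3)⁻¹ * |p h|) := by gcongr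
      _ ≤ _ := by rw [one_mul]; exact this
  have b2 : |(2 * Real.pi)⁻¹ * (((‖z‖ - ‖w‖) * (‖z‖ ^ 2 + ‖z‖ * ‖w‖ + ‖w‖ ^ 2)) * p w)
          / (‖z‖ ^ 3 * ‖w‖ ^ 3)| ≤ 28 * ‖h‖ / ‖z‖ ^ 3 := by
    rw [abs_div, abs_mul, abs_mul, abs_mul, abs_of_pos (by positivity : 0 < (2 * Real.pi)⁻¹),
      abs_of_pos (by positivity : 0 < ‖z‖ ^ 2 + ‖z‖ * ‖w‖ + ‖w‖ ^ 2),
      abs_of_pos (by positivity : 0 < ‖z‖ ^ 3 * ‖w‖ ^ 3), abs_sub_comm]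
    -- From `‖z‖ ≤ 2 ‖w‖`, with `7 = 4 + 2 + 1`.
    have h7 : ‖z‖ ^ 2 + ‖z‖ * ‖w‖ + ‖w‖ ^ 2 ≤ 7 * ‖w‖ ^ 2 := by nlinarith
    calc _ ≤ 1 * (‖h‖ * (7 * ‖w‖ ^ 2) * ‖w‖) / (‖z‖ ^ 3 * ‖w‖ ^ 3) := by
          gcongr; exact abs_perp_le w i
      _ = 7 * ‖h‖ / ‖z‖ ^ 3 := by field_simp
      _ ≤ _ := by gcongr; norm_num
  rw [e]
  calc _ ≤ _ := abs_add_le _ _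
    _ ≤ _ := add_le_add b1 b2
    _ = 29 * ‖h‖ / ‖z‖ ^ 3 := by ring
    _ ≤ _ := by gcongr; norm_num

lemma integral_dec_nonneg : 0 ≤ ∫ z, dec z := integral_nonneg fun z => (dec_pos z).le

/-- The kernel `1_{|z| ≥ r} K` is of bounded variation, with norm of order `1 / r`. -/
lemma exists_lintegral_outerK_translate_le : ∃ C : ℝ, 0 ≤ C ∧ ∀ (i : Fin 2) (r : ℝ) (h : Plane),
    0 < r → ‖h‖ ≤ r / 2 →
      ∫⁻ z, ‖outerK r i (z + h) - outerK r i z‖ₑ ≤ ENNReal.ofReal (C * ‖h‖ / r) := by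
  -- The smooth part gives `256 = 32 · 8`, the `8` coming from `r + |z| ≤ 2 |z|`. The jump at `|z| =
  -- r` gives `4π`: it lives on the shell `S` of area `4π r |h|`, where the values are at most
  -- `r⁻²`.
  refine ⟨256 * (∫ z, dec z) + 4 * Real.pi, by have := integral_dec_nonneg; positivity,
    fun i r h hr hh => ?_⟩
  set S : Set Plane := Metric.closedBall 0 (r + ‖h‖) \ Metric.ball 0 (r - ‖h‖) with hS
  have hSm : MeasurableSet S := Metric.isClosed_closedBall.measurableSet.diff
    Metric.isOpen_ball.measurableSet
  have hdm : Measurable dec := continuous_dec.measurable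
  have hpt (z : Plane) : ‖outerK r i (z + h) - outerK r i z‖ₑ ≤
      ENNReal.ofReal (256 * ‖h‖ / r ^ 3 * dec (r⁻¹ • z))
        + S.indicator (fun _ => ENNReal.ofReal ((r ^ 2)⁻¹)) z := by
    have habs : |‖z + h‖ - ‖z‖| ≤ ‖h‖ := by
      refine (abs_norm_sub_norm_le _ _).trans_eq ?_
      rw [add_sub_cancel_left]
    have habs := abs_le.1 habs
    rw [Real.enorm_eq_ofReal_abs]
    by_cases h1 : r ≤ ‖z‖
    · by_cases h2 : r ≤ ‖z + h‖
      · refine le_add_right (ENNReal.ofReal_le_ofReal ?_)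
        rw [outerK, indicator_of_mem (a := z + h) (by exact h2), indicator_of_mem (a := z) (by exact h1)]
        refine (abs_K_add_sub_le z h i (norm_pos_iff.1 (by linarith)) (by linarith)).trans ?_
        have hz : 0 < ‖z‖ := by linarith
        have : 1 / ‖z‖ ^ 3 ≤ 8 / r ^ 3 * dec (r⁻¹ • z) := by
          rw [dec, norm_smul, Real.norm_of_nonneg (by positivity), ← div_eq_mul_inv, div_div,
            div_le_div_iff₀ (by positivity) (by positivity), one_mul, ← mul_pow]
          have : r * (1 + r⁻¹ * ‖z‖) = r + ‖z‖ := by field_simp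
          rw [this]
          calc (r + ‖z‖) ^ 3 ≤ (2 * ‖z‖) ^ 3 := by gcongr; linarith
            _ = 8 * ‖z‖ ^ 3 := by ring
        calc 32 * ‖h‖ / ‖z‖ ^ 3 = 32 * ‖h‖ * (1 / ‖z‖ ^ 3) := by ring
          _ ≤ 32 * ‖h‖ * (8 / r ^ 3 * dec (r⁻¹ • z)) := by gcongr
          _ = _ := by ring
      · refine le_add_left ?_
        have hm : z ∈ S := by
          simp only [hS, Set.mem_sdiff, mem_closedBall_zero_iff, mem_ball_zero_iff]
          constructor <;> linarith
        rw [indicator_of_mem hm]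
        refine ENNReal.ofReal_le_ofReal ?_
        rw [outerK, indicator_of_notMem (a := z + h) (by exact h2), zero_sub, abs_neg]
        exact abs_outerK_le hr i z
    · by_cases h2 : r ≤ ‖z + h‖
      · refine le_add_left ?_
        have hm : z ∈ S := by
          simp only [hS, Set.mem_sdiff, mem_closedBall_zero_iff, mem_ball_zero_iff]
          constructor <;> linarith
        rw [indicator_of_mem hm]
        refine ENNReal.ofReal_le_ofReal ?_
        rw [outerK, indicator_of_notMem (a := z) (by exact h1), sub_zero]
        exact abs_outerK_le hr i (z + h)
      · rw [outerK, indicator_of_notMem (a := z) (by exact h1),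
          indicator_of_notMem (a := z + h) (by exact h2)]
        simp
  refine (lintegral_mono hpt).trans ?_
  rw [lintegral_add_right _ (measurable_const.indicator hSm), lintegral_indicator_const hSm]
  have i1 : ∫⁻ z, ENNReal.ofReal (256 * ‖h‖ / r ^ 3 * dec (r⁻¹ • z))
      = ENNReal.ofReal (256 * ‖h‖ / r * ∫ z, dec z) := by
    have hri : 0 < r⁻¹ := by positivity
    rw [← ofReal_integral_eq_lintegral_ofReal]
    · congr 1
      rw [integral_const_mul, ← integral_comp_smul_plane hri dec, smul_eq_mul]
      field_simp
    · exact (integrable_dec.comp_smul hri.ne').const_mul _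
    · exact ae_of_all _ fun z => mul_nonneg (by positivity) (dec_pos _).le
  have i2 : volume S = ENNReal.ofReal (4 * Real.pi * r * ‖h‖) := by
    rw [hS, measure_sdiff (Metric.ball_subset_closedBall.trans
      (Metric.closedBall_subset_closedBall (by linarith [norm_nonneg h])))
      Metric.isOpen_ball.measurableSet.nullMeasurableSet measure_ball_lt_top.ne,
      EuclideanSpace.volume_closedBall_fin_two, EuclideanSpace.volume_ball_fin_two,
      ← ENNReal.ofReal_pow (by positivity), ← ENNReal.ofReal_pow (by linarith)]
    rw [← ENNReal.ofReal_mul (by positivity), ← ENNReal.ofReal_mul (by positivity),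
      ← ENNReal.ofReal_sub _ (by positivity)]
    congr 1; ring
  rw [i1, i2, ← ENNReal.ofReal_mul (by positivity), ← ENNReal.ofReal_add
    (by have := integral_dec_nonneg; positivity) (by positivity)]
  refine ENNReal.ofReal_le_ofReal (le_of_eq ?_)
  field_simp
  

/-! ### The principal value against the derivative of a kernel -/

lemma dec_add_le (x : Plane) {w : Plane} (hw : ‖w‖ ≤ 1) : dec (x + w) ≤ 8 * dec x := by
  have h : 1 + ‖x‖ ≤ 2 * (1 + ‖x + w‖) := by
    have : ‖x‖ ≤ ‖x + w‖ + ‖w‖ := by simpa using norm_sub_le (x + w) w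
    linarith [norm_nonneg (x + w)]
  rw [dec, dec, ← div_eq_mul_inv, inv_eq_one_div, div_le_div_iff₀ (by positivity) (by positivity)]
  calc 1 * (1 + ‖x‖) ^ 3 ≤ 1 * (2 * (1 + ‖x + w‖)) ^ 3 := by gcongr
    _ = _ := by ring

lemma abs_sub_le_of_fderiv_decay {f : Plane → ℝ} (hf : Differentiable ℝ f) {C : ℝ}
    (h : ∀ x, ‖fderiv ℝ f x‖ ≤ C * dec x) (x : Plane) {w : Plane} (hw : ‖w‖ ≤ 1) :
    |f (x + w) - f x| ≤ 8 * C * dec x * ‖w‖ := by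
  have hC : 0 ≤ C := by
    have := (norm_nonneg _).trans (h 0)
    exact nonneg_of_mul_nonneg_left this (dec_pos 0)
  have := (convex_closedBall x 1).norm_image_sub_le_of_norm_fderiv_le (f := f) (𝕜 := ℝ)
    (C := 8 * C * dec x) (x := x) (y := x + w) (fun y _ => hf y) (fun y hy => ?_)
    (by simp) (by simpa using hw)
  · simpa using this
  · have hy : ‖y - x‖ ≤ 1 := by simpa [dist_eq_norm] using hy
    have h1 := dec_add_le x hy
    rw [add_sub_cancel] at h1
    calc _ ≤ C * dec y := h y
      _ ≤ C * (8 * dec x) := by gcongr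
      _ = _ := by ring

lemma measurable_conv {k f : Plane → ℝ} (hk : Measurable k) (hf : Measurable f) :
    Measurable (conv k f) := by
  have : StronglyMeasurable (Function.uncurry fun x y : Plane => k (x - y) * f y) :=
    ((hk.comp (measurable_fst.sub measurable_snd)).mul
      (hf.comp measurable_snd)).stronglyMeasurable
  exact this.integral_prod_right.measurable

lemma integrable_conv_integrand {k f : Plane → ℝ} {M : ℝ} (hk : Measurable k)
    (hM : ∀ z, |k z| ≤ M) (hf : Integrable f) (x : Plane) :
    Integrable fun y => k (x - y) * f y :=
  hf.bdd_mul (c := M) (hk.comp (measurable_const.sub measurable_id)).aestronglyMeasurable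
    (ae_of_all _ fun _ => hM _)

lemma abs_conv_le {k f : Plane → ℝ} {M : ℝ} (hM : ∀ z, |k z| ≤ M) (hf : Integrable f)
    (x : Plane) : |conv k f x| ≤ M * ∫ y, |f y| := by
  rw [conv, ← integral_const_mul]
  refine (abs_integral_le_integral_abs).trans ?_
  refine integral_mono_of_nonneg (ae_of_all _ fun _ => abs_nonneg _) (hf.abs.const_mul M)
    (ae_of_all _ fun y => ?_)
  simp only [abs_mul]
  exact mul_le_mul_of_nonneg_right (hM _) (abs_nonneg _)

/-- The kernel `outerK r i` decays only like `|z|⁻²`, so Young's inequality is not available.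
Instead the derivative is moved onto `outerK r i`, whose translates differ in `L¹` by `O(|h| / r)`.
Because of the jump this is done with difference quotients and Fatou's lemma. -/
lemma exists_lintegral_conv_outerK_le {g : Plane → ℝ} (hg : Differentiable ℝ g)
    (hgi : Integrable g) {C : ℝ} (h : ∀ x, ‖fderiv ℝ g x‖ ≤ C * dec x) :
    ∃ B : ℝ, 0 ≤ B ∧ ∀ (i j : Fin 2) (r : ℝ), 0 < r →
      ∫⁻ x, ‖conv (outerK r i) (partialDeriv j g) x‖ₑ ≤ ENNReal.ofReal (B / r) := by
  obtain ⟨B, hB, hBr⟩ := exists_lintegral_outerK_translate_le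
  refine ⟨B * ∫ y, |g y|, by positivity, fun i j r hr => ?_⟩
  set e : Plane := EuclideanSpace.single j 1 with he
  have he1 : ‖e‖ = 1 := by simp [he]
  have hgm : Measurable g := hg.continuous.measurable
  have hLm := measurable_outerK r i
  -- Inverse step of the difference quotient. Being at least `1`, it keeps increments in the unit
  -- ball, where `dec` gives a uniform majorant.
  set c : ℕ → ℝ := fun n => n + 1 with hc
  have hc1 (n : ℕ) : 1 ≤ c n := by simp [hc]
  have hc0 (n : ℕ) : 0 < c n := zero_lt_one.trans_le (hc1 n)
  have hct : Tendsto c atTop atTop := tendsto_atTop_add_const_right _ _ tendsto_natCast_atTop_atTop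
  set D : ℕ → Plane → ℝ := fun n y => c n * (g (y + (c n)⁻¹ • e) - g y) with hD
  have hDm (n : ℕ) : Measurable (D n) :=
    measurable_const.mul ((hgm.comp (measurable_id.add_const _)).sub hgm)
  have hnorm (n : ℕ) : ‖(c n)⁻¹ • e‖ = (c n)⁻¹ := by
    rw [norm_smul, he1, mul_one, Real.norm_of_nonneg (inv_nonneg.2 (hc0 n).le)]
  have hDb (n : ℕ) (y : Plane) : |D n y| ≤ 8 * C * dec y := by
    have h1 := abs_sub_le_of_fderiv_decay hg h y (w := (c n)⁻¹ • e)
      (by rw [hnorm]; exact inv_le_one_of_one_le₀ (hc1 n))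
    rw [hnorm] at h1
    rw [hD, abs_mul, abs_of_pos (hc0 n)]
    calc _ ≤ c n * (8 * C * dec y * (c n)⁻¹) := by gcongr
      _ = _ := by have := (hc0 n).ne'; field_simp
  have hDt (y : Plane) : Tendsto (fun n => D n y) atTop (𝓝 (partialDeriv j g y)) :=
    ((hg y).hasFDerivAt.lim_real e).comp hct
  have ht (x : Plane) : Tendsto (fun n => conv (outerK r i) (D n) x) atTop
      (𝓝 (conv (outerK r i) (partialDeriv j g) x)) := by
    refine tendsto_integral_of_dominated_convergence (fun y => (r ^ 2)⁻¹ * (8 * C * dec y))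
      (fun n => ?_) ((integrable_dec.const_mul _).const_mul _) (fun n => ae_of_all _ fun y => ?_)
      (ae_of_all _ fun y => (hDt y).const_mul _)
    · exact ((hLm.comp (measurable_const.sub measurable_id)).mul (hDm n)).aestronglyMeasurable
    · rw [Real.norm_eq_abs, abs_mul]
      exact mul_le_mul (abs_outerK_le hr i _) (hDb n y) (abs_nonneg _) (by positivity)
  -- Summation by parts: translation invariance transfers the difference from `g` to `outerK r i`.
  have heq (n : ℕ) (x : Plane) : conv (outerK r i) (D n) x
      = c n * ∫ y, (outerK r i (x - y + (c n)⁻¹ • e) - outerK r i (x - y)) * g y := by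
    have i1 := integrable_conv_integrand hLm (abs_outerK_le hr i) hgi
    have i3 (x : Plane) : Integrable fun y => outerK r i (x - y) * g (y + (c n)⁻¹ • e) :=
      integrable_conv_integrand hLm (abs_outerK_le hr i) (hgi.comp_add_right ((c n)⁻¹ • e)) x
    have e1 : ∫ y, outerK r i (x - y) * g (y + (c n)⁻¹ • e)
        = ∫ y, outerK r i (x - y + (c n)⁻¹ • e) * g y := by
      rw [← integral_add_right_eq_self (fun y => outerK r i (x - y + (c n)⁻¹ • e) * g y)
        ((c n)⁻¹ • e)]
      simp only [sub_add_eq_sub_sub, sub_add_cancel]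
    have i2 : Integrable fun y => outerK r i (x - y + (c n)⁻¹ • e) * g y := by
      have := i1 (x + (c n)⁻¹ • e)
      refine this.congr (ae_of_all _ fun y => ?_)
      simp only [add_sub_right_comm]
    simp only [sub_mul]
    rw [integral_sub i2 (i1 x), ← e1, ← integral_sub (i3 x) (i1 x), ← integral_const_mul, conv]
    congr 1; ext y
    simp only [hD]; ring
  have hbd : ∀ᶠ n in atTop, ∫⁻ x, ‖conv (outerK r i) (D n) x‖ₑ
      ≤ ENNReal.ofReal ((B * ∫ y, |g y|) / r) := by
    filter_upwards [hct.eventually_ge_atTop (2 / r)] with n hn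
    have hsmall : ‖(c n)⁻¹ • e‖ ≤ r / 2 := by
      rw [hnorm, inv_le_comm₀ (hc0 n) (by positivity), inv_div]; exact hn
    have hω := hBr i r _ hr hsmall
    rw [hnorm] at hω
    have hΔ : Measurable fun z => ‖outerK r i (z + (c n)⁻¹ • e) - outerK r i z‖ₑ :=
      ((hLm.comp (measurable_id.add_const _)).sub hLm).enorm
    calc ∫⁻ x, ‖conv (outerK r i) (D n) x‖ₑ
        ≤ ∫⁻ x, ENNReal.ofReal (c n) * ∫⁻ y,
            ‖outerK r i (x - y + (c n)⁻¹ • e) - outerK r i (x - y)‖ₑ * ‖g y‖ₑ := by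
          refine lintegral_mono fun x => ?_
          rw [heq, enorm_mul, Real.enorm_of_nonneg (hc0 n).le]
          gcongr
          refine (enorm_integral_le_lintegral_enorm _).trans_eq ?_
          simp only [enorm_mul]
      _ = ENNReal.ofReal (c n) * ∫⁻ y, ∫⁻ x,
            ‖outerK r i (x - y + (c n)⁻¹ • e) - outerK r i (x - y)‖ₑ * ‖g y‖ₑ := by
          rw [lintegral_const_mul' _ _ ENNReal.ofReal_ne_top, lintegral_lintegral_swap]
          exact ((hΔ.comp (measurable_fst.sub measurable_snd)).mul
            (hgm.comp measurable_snd).enorm).aemeasurable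
      _ = ENNReal.ofReal (c n) * ((∫⁻ z, ‖outerK r i (z + (c n)⁻¹ • e) - outerK r i z‖ₑ)
            * ∫⁻ y, ‖g y‖ₑ) := by
          rw [← lintegral_const_mul _ hgm.enorm]
          congr 2; ext y
          rw [lintegral_mul_const' _ _ enorm_ne_top]
          congr 1
          exact lintegral_sub_right_eq_self
            (fun z => ‖outerK r i (z + (c n)⁻¹ • e) - outerK r i z‖ₑ) y
      _ ≤ ENNReal.ofReal (c n) * (ENNReal.ofReal (B * (c n)⁻¹ / r)
            * ENNReal.ofReal (∫ y, |g y|)) := by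
          gcongr
          rw [← ofReal_integral_norm_eq_lintegral_enorm hgi]
          rfl
      _ = _ := by
          have := (hc0 n).ne'
          have := hc0 n
          rw [← ENNReal.ofReal_mul (by positivity), ← ENNReal.ofReal_mul (by positivity)]
          congr 1
          field_simp
  calc ∫⁻ x, ‖conv (outerK r i) (partialDeriv j g) x‖ₑ
      = ∫⁻ x, liminf (fun n => ‖conv (outerK r i) (D n) x‖ₑ) atTop :=
        lintegral_congr fun x => (ht x).enorm.liminf_eq.symm
    _ ≤ liminf (fun n => ∫⁻ x, ‖conv (outerK r i) (D n) x‖ₑ) atTop :=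
        lintegral_liminf_le fun n => (measurable_conv hLm (hDm n)).enorm
    _ ≤ _ := (liminf_le_liminf hbd).trans_eq (liminf_const _)

/-- The kernel `K^i` restricted to `|z| < r`. -/
def innerK (r : ℝ) (i : Fin 2) : Plane → ℝ := (Metric.ball 0 r).indicator fun z => K z i

lemma measurable_innerK (r : ℝ) (i : Fin 2) : Measurable (innerK r i) :=
  (measurable_K i).indicator Metric.isOpen_ball.measurableSet

lemma innerK_add_outerK (r : ℝ) (i : Fin 2) (z : Plane) :
    innerK r i z + outerK r i z = K z i := by
  by_cases hz : r ≤ ‖z‖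
  · simp [innerK, outerK, indicator, hz, not_lt.2 hz]
  · simp [innerK, outerK, indicator, hz, not_le.1 hz]

lemma integrable_ball_inv_norm {r : ℝ} (hr : 0 < r) :
    Integrable ((Metric.ball (0 : Plane) r).indicator fun z => ‖z‖⁻¹) ∧
      ∫ z, (Metric.ball (0 : Plane) r).indicator (fun z => ‖z‖⁻¹) z = 2 * Real.pi * r := by
  have e : (Metric.ball (0 : Plane) r).indicator (fun z => ‖z‖⁻¹)
      = fun z => (Iio r).indicator (fun y : ℝ => y⁻¹) ‖z‖ := by
    ext z
    simp only [indicator, mem_ball_zero_iff, mem_Iio]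
  have e2 : EqOn (fun y : ℝ => y ^ (Module.finrank ℝ Plane - 1) • (Iio r).indicator (fun y => y⁻¹) y)
      ((Iio r).indicator 1) (Ioi 0) := by
    intro y hy
    have hy : 0 < y := hy
    by_cases h : y < r
    · simp [indicator_of_mem (show y ∈ Iio r from h), hy.ne']
    · simp [indicator_of_notMem (show y ∉ Iio r from h)]
  have hs : (Ioi (0 : ℝ)) ∩ Iio r = Ioo 0 r := Ioi_inter_Iio
  rw [e]
  constructor
  · rw [integrable_fun_norm_addHaar, integrableOn_congr_fun e2 measurableSet_Ioi]
    rw [IntegrableOn, integrable_indicator_iff measurableSet_Iio, IntegrableOn,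
      Measure.restrict_restrict measurableSet_Iio, inter_comm, hs]
    exact integrable_const (1 : ℝ)
  · rw [integral_fun_norm_addHaar, setIntegral_congr_fun measurableSet_Ioi e2,
      setIntegral_indicator measurableSet_Iio, hs]
    simp [hr.le, Measure.real, EuclideanSpace.volume_ball_fin_two, Real.pi_pos.le]
    ring

/-- The principal value convolution `p.v. K^i * κ`, with the cancellation at the origin made
explicit. -/
def singConv (i : Fin 2) (κ : Plane → ℝ) (x : Plane) : ℝ :=
  conv (outerK 1 i) κ x + ∫ z, innerK 1 i z * (κ (x - z) - κ x)

section

variable {κ : Plane → ℝ} (hκ : Differentiable ℝ κ) (hi : Integrable κ) {C : ℝ}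
  (h : ∀ x, ‖fderiv ℝ κ x‖ ≤ C * dec x) (i : Fin 2)
include hκ h

lemma abs_innerK_mul_sub_le {r : ℝ} (hr1 : r ≤ 1) (x z : Plane) :
    |innerK r i z * (κ (x - z) - κ x)|
      ≤ 8 * C * dec x * (Metric.ball (0 : Plane) r).indicator (fun z => ‖z‖⁻¹) z := by
  by_cases hz : z ∈ Metric.ball (0 : Plane) r
  · have hz' : ‖z‖ < r := by simpa using hz
    rw [innerK, indicator_of_mem hz, indicator_of_mem hz, abs_mul]
    have h1 := abs_sub_le_of_fderiv_decay hκ h x (w := -z) (by rw [norm_neg]; linarith)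
    rw [← sub_eq_add_neg, norm_neg] at h1
    rcases eq_or_ne z 0 with rfl | hz0
    · simp
    have hz0 : 0 < ‖z‖ := norm_pos_iff.2 hz0
    calc _ ≤ (‖z‖ ^ 2)⁻¹ * (8 * C * dec x * ‖z‖) := by gcongr; exact abs_K_le z i
      _ = _ := by field_simp
  · rw [innerK, indicator_of_notMem hz, indicator_of_notMem hz]
    simp

lemma integrable_innerK_mul_sub {r : ℝ} (hr : 0 < r) (hr1 : r ≤ 1) (x : Plane) :
    Integrable fun z => innerK r i z * (κ (x - z) - κ x) := by
  refine ((integrable_ball_inv_norm hr).1.const_mul (8 * C * dec x)).mono' ?_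
    (ae_of_all _ fun z => abs_innerK_mul_sub_le hκ h i hr1 x z)
  have := hκ.continuous.measurable
  exact ((measurable_innerK r i).mul ((this.comp (measurable_const.sub measurable_id)).sub_const
    _)).aestronglyMeasurable

include hi in
-- By oddness `K` has mean zero on `r ≤ |z| < 1`, so `κ x` may be subtracted there for free. What
-- remains is an integral over `|z| < r` with integrand `O(|z|⁻¹)`, of size `8 C · 2π r`.
lemma abs_singConv_sub_le {r : ℝ} (hr : 0 < r) (hr1 : r ≤ 1) (x : Plane) :
    |singConv i κ x - conv (outerK r i) κ x| ≤ 16 * Real.pi * C * r * dec x := by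
  have key : singConv i κ x - conv (outerK r i) κ x
      = ∫ z, innerK r i z * (κ (x - z) - κ x) := by
    have j1 : Integrable fun z => outerK 1 i z * κ (x - z) := by
      have := hi.comp_sub_left x
      exact this.bdd_mul (measurable_outerK 1 i).aestronglyMeasurable
        (ae_of_all _ (abs_outerK_le one_pos i))
    have j2 : Integrable fun z => outerK r i z * κ (x - z) := by
      have := hi.comp_sub_left x
      exact this.bdd_mul (measurable_outerK r i).aestronglyMeasurable
        (ae_of_all _ (abs_outerK_le hr i))
    have k1 := integrable_innerK_mul_sub hκ h i one_pos le_rfl x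
    have k2 := integrable_innerK_mul_sub hκ h i hr hr1 x
    -- The reflection `z ↦ -z` gives this equality without integrability.
    have hodd : ∫ z, (outerK r i z - outerK 1 i z) = 0 := by
      have e := integral_neg_eq_self (fun z => outerK r i z - outerK 1 i z) volume
      have e2 (s : ℝ) (z : Plane) : outerK s i (-z) = -outerK s i z := by
        simp only [outerK, indicator, mem_ofPred_eq, norm_neg, K_neg]
        split_ifs <;> simp
      simp only [e2] at e
      have e3 : ∫ z, (-outerK r i z - -outerK 1 i z) = -∫ z, (outerK r i z - outerK 1 i z) := by
        rw [← integral_neg]; congr 1; ext z; ring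
      rw [e3] at e
      linarith
    have e4 : ∫ z, (outerK r i z - outerK 1 i z) * κ x = 0 := by
      rw [integral_mul_const, hodd, zero_mul]
    rw [singConv, conv_eq_integral_sub, conv_eq_integral_sub, ← integral_add j1 k1,
      ← integral_sub (by exact j1.add k1) j2, ← sub_zero (∫ z, innerK r i z * (κ (x - z) - κ x)), ← e4,
      ← integral_sub k2 ?_]
    · congr 1; ext z
      have a1 := innerK_add_outerK r i z
      have a2 := innerK_add_outerK 1 i z
      linear_combination (κ (x - z) - κ x) * (a2 - a1)
    -- Integrability of the subtracted mean is read off from that of the four other terms.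
    · have : Integrable fun z => (outerK 1 i z * κ (x - z) - outerK r i z * κ (x - z))
          + innerK 1 i z * (κ (x - z) - κ x) - innerK r i z * (κ (x - z) - κ x) :=
        ((j1.sub j2).add k1).sub k2
      refine this.neg.congr (ae_of_all _ fun z => ?_)
      have a1 := innerK_add_outerK r i z
      have a2 := innerK_add_outerK 1 i z
      simp only [Pi.neg_apply]
      linear_combination (κ (x - z) - κ x) * (a1 - a2)
  rw [key]
  refine abs_integral_le_integral_abs.trans ?_
  calc _ ≤ ∫ z, 8 * C * dec x * (Metric.ball (0 : Plane) r).indicator (fun z => ‖z‖⁻¹) z :=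
        integral_mono_of_nonneg (ae_of_all _ fun _ => abs_nonneg _)
          ((integrable_ball_inv_norm hr).1.const_mul _)
          (ae_of_all _ fun z => abs_innerK_mul_sub_le hκ h i hr1 x z)
    _ = _ := by rw [integral_const_mul, (integrable_ball_inv_norm hr).2]; ring

end

lemma truncConv_eq_sub {κ : Plane → ℝ} (hi : Integrable κ) {r R : ℝ} (hr : 0 < r) (hR : r < R)
    (i : Fin 2) (x : Plane) :
    truncConv r R i κ x = conv (outerK r i) κ x - conv (outerK R i) κ x := by
  -- The annulus is open at its inner radius whereas `outerK r i` includes the sphere, a null set.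
  have hae : ∀ᵐ z : Plane, ‖z‖ ≠ r := by
    have := Measure.addHaar_sphere (volume : Measure Plane) 0 r
    rw [ae_iff]
    refine measure_mono_null (fun z hz => ?_) this
    simpa using hz
  have hj (s : ℝ) (hs : 0 < s) : Integrable fun z => outerK s i z * κ (x - z) :=
    (hi.comp_sub_left x).bdd_mul (measurable_outerK s i).aestronglyMeasurable
      (ae_of_all _ (abs_outerK_le hs i))
  rw [truncConv, conv_eq_integral_sub, conv_eq_integral_sub, conv_eq_integral_sub,
    ← integral_sub (hj r hr) (hj R (hr.trans hR))]
  refine integral_congr_ae ?_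
  filter_upwards [hae] with z hz
  rw [← sub_mul]
  congr 1
  simp only [outerK, annulus, indicator, mem_ofPred_eq]
  rcases lt_trichotomy ‖z‖ r with h1 | h1 | h1
  · simp [h1.not_ge, h1.not_gt, (h1.trans hR).not_ge]
  · exact absurd h1 hz
  · by_cases h2 : ‖z‖ < R
    · simp [h1, h1.le, h2, h2.not_ge]
    · simp [h1.le, h2, not_lt.1 h2]

lemma integrable_conv_outerK {g : Plane → ℝ} (hg : Differentiable ℝ g) (hgi : Integrable g)
    {C : ℝ} (h : ∀ x, ‖fderiv ℝ g x‖ ≤ C * dec x) :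
    ∃ B : ℝ, 0 ≤ B ∧ ∀ (i j : Fin 2) (r : ℝ), 0 < r → Measurable (partialDeriv j g) →
      Integrable (conv (outerK r i) (partialDeriv j g)) ∧
        ∫ x, |conv (outerK r i) (partialDeriv j g) x| ≤ B / r := by
  obtain ⟨B, hB, hb⟩ := exists_lintegral_conv_outerK_le hg hgi h
  refine ⟨B, hB, fun i j r hr hm => ?_⟩
  have hms := (measurable_conv (measurable_outerK r i) hm).aestronglyMeasurable (μ := volume)
  have hi : Integrable (conv (outerK r i) (partialDeriv j g)) :=
    ⟨hms, (hb i j r hr).trans_lt ENNReal.ofReal_lt_top⟩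
  refine ⟨hi, ?_⟩
  have := ofReal_integral_norm_eq_lintegral_enorm hi
  have h2 := this.trans_le (hb i j r hr)
  exact (ENNReal.ofReal_le_ofReal_iff (by positivity)).1 h2

/-- The truncated convolutions of `K` with a derivative of a kernel converge at every point and
in `L¹`. -/
theorem exists_singular_limit {a α : ℝ} (ha : 0 < a) (hα : 1 / 2 < α) {g : Plane → ℝ}
    (hg : IsKernel a α g) (i j : Fin 2) :
    ∃ P : Plane → ℝ, Measurable P ∧ Integrable P ∧
      (∀ x, Tendsto (fun p : ℝ × ℝ => truncConv p.1 p.2 i (partialDeriv j g) x) pvFilter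
        (𝓝 (P x))) ∧
      ∃ C : ℝ, 0 ≤ C ∧ ∀ r R : ℝ, 0 < r → r < R →
        Integrable (truncConv r R i (partialDeriv j g)) ∧
        ∫ x, |truncConv r R i (partialDeriv j g) x - P x| ≤ C * (min r 1 + R⁻¹) := by
  have hα0 : 0 < α := by linarith
  have hk := hg.partialDeriv ha hα0 j
  set κ := SQG.partialDeriv j g
  have hκi := hk.integrable ha hα
  have hκd := hk.differentiable ha hα0
  have hκm : Measurable κ := hκd.continuous.measurable
  obtain ⟨C, hC⟩ := hk.exists_fderiv_decay ha hα
  obtain ⟨C', hC'⟩ := hg.exists_fderiv_decay ha hα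
  obtain ⟨B, hB, hb⟩ := integrable_conv_outerK (hg.differentiable ha hα0) (hg.integrable ha hα) hC'
  have hb' (r : ℝ) (hr : 0 < r) := hb i j r hr hκm
  have hC0 : 0 ≤ C := nonneg_of_mul_nonneg_left ((norm_nonneg _).trans (hC 0)) (dec_pos 0)
  have hsub (r : ℝ) (hr : 0 < r) (hr1 : r ≤ 1) (x : Plane) :=
    abs_singConv_sub_le hκd hκi hC i hr hr1 x
  set P := singConv i κ with hP
  have hptR (R : ℝ) (hR : 0 < R) (x : Plane) :
      |conv (outerK R i) κ x| ≤ (R ^ 2)⁻¹ * ∫ y, |κ y| := abs_conv_le (abs_outerK_le hR i) hκi x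
  have hlim (x : Plane) : Tendsto (fun p : ℝ × ℝ => truncConv p.1 p.2 i κ x) pvFilter (𝓝 (P x)) := by
    have t1 : Tendsto (fun r : ℝ => conv (outerK r i) κ x) (𝓝[>] 0) (𝓝 (P x)) := by
      rw [tendsto_iff_norm_sub_tendsto_zero]
      have : Tendsto (fun r : ℝ => 16 * Real.pi * C * r * dec x) (𝓝[>] 0) (𝓝 0) := by
        have : Continuous fun r : ℝ => 16 * Real.pi * C * r * dec x := by fun_prop
        simpa using (this.tendsto 0).mono_left nhdsWithin_le_nhds
      refine squeeze_zero' (Eventually.of_forall fun _ => norm_nonneg _) ?_ this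
      filter_upwards [eventually_mem_Ioc] with r hr
      rw [norm_sub_rev]
      exact hsub r hr.1 hr.2 x
    have t2 : Tendsto (fun R : ℝ => conv (outerK R i) κ x) atTop (𝓝 0) := by
      have : Tendsto (fun R : ℝ => (R ^ 2)⁻¹ * ∫ y, |κ y|) atTop (𝓝 0) := by
        simpa using ((tendsto_pow_atTop (α := ℝ) two_ne_zero).inv_tendsto_atTop).mul_const
          (∫ y, |κ y|)
      refine squeeze_zero_norm' ?_ this
      filter_upwards [eventually_gt_atTop 0] with R hR
      exact hptR R hR x
    have t3 := (t1.comp (tendsto_fst (g := (atTop : Filter ℝ)))).sub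
      (t2.comp (tendsto_snd (f := 𝓝[>] (0 : ℝ))))
    rw [sub_zero] at t3
    refine t3.congr' ?_
    have e1 : ∀ᶠ p : ℝ × ℝ in pvFilter, p.1 ∈ Ioc (0 : ℝ) 1 := tendsto_fst.eventually eventually_mem_Ioc
    have e2 : ∀ᶠ p : ℝ × ℝ in pvFilter, 1 < p.2 := tendsto_snd.eventually (eventually_gt_atTop 1)
    filter_upwards [e1, e2] with p h1 h2
    exact (truncConv_eq_sub hκi h1.1 (h1.2.trans_lt h2) i x).symm
  have hPm : Measurable P := by
    have hseq : Tendsto (fun n : ℕ => (1 / ((n : ℝ) + 1), (n : ℝ) + 1)) atTop pvFilter := by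
      refine Tendsto.prodMk (tendsto_nhdsWithin_iff.2 ⟨tendsto_one_div_add_atTop_nhds_zero_nat,
        Eventually.of_forall fun k => ?_⟩)
        (tendsto_atTop_add_const_right _ _ tendsto_natCast_atTop_atTop)
      simp only [mem_Ioi]; positivity
    refine measurable_of_tendsto_metrizable (f := fun (n : ℕ) x =>
      truncConv (1 / ((n : ℝ) + 1)) ((n : ℝ) + 1) i κ x) (fun n => ?_)
      (tendsto_pi_nhds.2 fun x => (hlim x).comp hseq)
    refine measurable_conv ((measurable_K i).indicator ?_) hκm
    exact (measurableSet_lt measurable_const measurable_norm).inter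
      (measurableSet_lt measurable_norm measurable_const)
  -- Near the singularity the correction is `O(dec)`; the far part `conv (outerK 1 i) κ` is in `L¹`
  -- because `κ` is itself a derivative.
  have hPi : Integrable P := by
    have h1 : Integrable fun x => P x - conv (outerK 1 i) κ x := by
      refine (integrable_dec.const_mul (16 * Real.pi * C * 1)).mono' ?_
        (ae_of_all _ fun x => hsub 1 one_pos le_rfl x)
      exact (hPm.sub (measurable_conv (measurable_outerK 1 i) hκm)).aestronglyMeasurable
    exact (h1.add (hb' 1 one_pos).1).congr (ae_of_all _ fun x => sub_add_cancel _ _)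
  refine ⟨P, hPm, hPi, hlim, B + (∫ x, |P x|) + 16 * Real.pi * C * ∫ x, dec x,
    by have := integral_dec_nonneg; positivity, fun r R hr hR => ?_⟩
  have hR0 := hr.trans hR
  have e : truncConv r R i κ = fun x => conv (outerK r i) κ x - conv (outerK R i) κ x :=
    funext fun x => truncConv_eq_sub hκi hr hR i x
  have ir := (hb' r hr).1
  have iR := (hb' R hR0).1
  refine ⟨e ▸ ir.sub iR, ?_⟩
  have hd := integral_dec_nonneg
  -- For `r ≤ 1` the pointwise estimate is integrated. For `r ≥ 1` the two `L¹` norms are bounded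
  -- separately; this range matters because rescaling in time produces arbitrarily large radii.
  have main : ∫ x, |conv (outerK r i) κ x - P x|
      ≤ (B + (∫ x, |P x|) + 16 * Real.pi * C * ∫ x, dec x) * min r 1 := by
    rcases le_total r 1 with hr1 | hr1
    · rw [min_eq_left hr1]
      calc _ ≤ ∫ x, 16 * Real.pi * C * r * dec x := by
            refine integral_mono_of_nonneg (ae_of_all _ fun _ => abs_nonneg _)
              (integrable_dec.const_mul _) (ae_of_all _ fun x => ?_)
            simp only
            rw [abs_sub_comm]
            exact hsub r hr hr1 x
        _ = (16 * Real.pi * C * ∫ x, dec x) * r := by rw [integral_const_mul]; ring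
        _ ≤ _ := by
            gcongr
            have : 0 ≤ ∫ x, |P x| := by positivity
            linarith
    · rw [min_eq_right hr1, mul_one]
      calc _ ≤ ∫ x, (|conv (outerK r i) κ x| + |P x|) :=
            integral_mono (ir.sub hPi).abs (ir.abs.add hPi.abs) fun x => abs_sub _ _
        _ = (∫ x, |conv (outerK r i) κ x|) + ∫ x, |P x| := integral_add ir.abs hPi.abs
        _ ≤ B + ∫ x, |P x| := by
            gcongr
            refine (hb' r hr).2.trans ?_
            exact div_le_self hB hr1
        _ ≤ _ := by
            have : 0 ≤ 16 * Real.pi * C * ∫ x, dec x := by positivity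
            linarith
  calc ∫ x, |truncConv r R i κ x - P x|
      ≤ ∫ x, (|conv (outerK r i) κ x - P x| + |conv (outerK R i) κ x|) := by
        rw [e]
        refine integral_mono ((ir.sub iR).sub hPi).abs ((ir.sub hPi).abs.add iR.abs) fun x => ?_
        have : conv (outerK r i) κ x - conv (outerK R i) κ x - P x
          = (conv (outerK r i) κ x - P x) - conv (outerK R i) κ x := by ring
        simp only [this]
        exact abs_sub _ _
    _ = (∫ x, |conv (outerK r i) κ x - P x|) + ∫ x, |conv (outerK R i) κ x| :=
        integral_add (ir.sub hPi).abs iR.abs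
    _ ≤ (B + (∫ x, |P x|) + 16 * Real.pi * C * ∫ x, dec x) * min r 1 + B / R :=
        add_le_add main (hb' R hR0).2
    _ ≤ _ := by
        rw [mul_add, div_eq_mul_inv]
        gcongr
        have h1 : 0 ≤ 16 * Real.pi * C * ∫ x, dec x := by positivity
        have h2 : 0 ≤ ∫ x, |P x| := by positivity
        linarith

/-! ### Convergence at Lebesgue points -/

/-- The least `k` with `‖w‖ ≤ 2 ^ k` works: `‖w‖ > 2 ^ (k - 1)` when `k > 0`, and the factor `8 =
2³` pays for the missing power of two. -/
lemma dec_le_dyadic (w : Plane) : ∃ k : ℕ, ‖w‖ ≤ 2 ^ k ∧ dec w ≤ 8 * (1 / 8) ^ k := by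
  obtain ⟨k, hk, hmin⟩ : ∃ k : ℕ, ‖w‖ ≤ 2 ^ k ∧ ∀ m < k, ¬ ‖w‖ ≤ 2 ^ m := by
    have hex : ∃ k : ℕ, ‖w‖ ≤ 2 ^ k :=
      (pow_unbounded_of_one_lt ‖w‖ (one_lt_two (α := ℝ))).imp fun _ h => h.le
    exact ⟨Nat.find hex, Nat.find_spec hex, fun m hm => Nat.find_min hex hm⟩
  refine ⟨k, hk, ?_⟩
  rcases k with _ | k
  · simpa using (dec_le_one w).trans (by norm_num)
  · have h1 := not_le.1 (hmin k (Nat.lt_succ_self k))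
    have h2 : dec w ≤ ((2 ^ k) ^ 3)⁻¹ := by
      unfold dec
      gcongr
      linarith
    refine h2.trans_eq ?_
    have h8 : ((2 : ℝ) ^ k) ^ 3 = 8 ^ k := by
      rw [← pow_mul, mul_comm, pow_mul]; norm_num
    rw [h8, pow_succ, one_div, inv_pow]
    ring

lemma volume_real_closedBall (x : Plane) {r : ℝ} (hr : 0 ≤ r) :
    volume.real (Metric.closedBall x r) = Real.pi * r ^ 2 := by
  rw [Measure.real, EuclideanSpace.volume_closedBall_fin_two, ENNReal.toReal_mul, ENNReal.toReal_pow,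
    ENNReal.toReal_ofReal hr, ENNReal.toReal_ofReal Real.pi_pos.le, mul_comm]

lemma abs_average_abs_sub_le {f : Plane → ℝ} {M : ℝ} (hfM : ∀ x, |f x| ≤ M) (x : Plane) {r : ℝ}
    (hr : 0 < r) : |(⨍ y in Metric.closedBall x r, |f y - f x|)| ≤ 2 * M := by
  have hfs (y : Plane) : |f y - f x| ≤ 2 * M := by
    have := abs_sub (f y) (f x); linarith [hfM x, hfM y]
  have hv0 : 0 < volume.real (Metric.closedBall x r) := by
    rw [volume_real_closedBall x hr.le]; positivity
  rw [setAverage_eq, smul_eq_mul, abs_mul, abs_of_pos (inv_pos.2 hv0), inv_mul_le_iff₀ hv0]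
  have := norm_setIntegral_le_of_norm_le_const (μ := volume) (s := Metric.closedBall x r)
    (f := fun y => |f y - f x|) (C := 2 * M) measure_closedBall_lt_top
    (fun y _ => by simpa using hfs y)
  rw [mul_comm]
  exact this

/-- Unit mass allows `f x` to be subtracted under the integral. The kernel is then dominated by
indicators of dyadic balls: decay `8⁻ᵏ` against area `4ᵏ` leaves the summable weight `2⁻ᵏ`. -/
lemma abs_conv_dil_sub_le {g f : Plane → ℝ} {C M : ℝ} (hg : Measurable g)
    (hgC : ∀ x, |g x| ≤ C * dec x) (h1 : ∫ x, g x = 1) (hf : Measurable f) (hfM : ∀ x, |f x| ≤ M)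
    {δ : ℝ} (hδ : 0 < δ) (x : Plane) :
    |conv (dil δ g) f x - f x| ≤ ∑' k : ℕ, C * (8 * Real.pi * (1 / 2) ^ k *
      ⨍ y in Metric.closedBall x (2 ^ k / δ), |f y - f x|) := by
  have hC : 0 ≤ C := nonneg_of_mul_nonneg_left ((abs_nonneg _).trans (hgC 0)) (dec_pos 0)
  have hM : 0 ≤ M := (abs_nonneg _).trans (hfM 0)
  have hgi : Integrable g := (integrable_dec.const_mul C).mono' hg.aestronglyMeasurable
    (ae_of_all _ hgC)
  have hdi := (integrable_dil hδ hgi).comp_sub_left x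
  have i1 : Integrable fun y => dil δ g (x - y) * f y :=
    hdi.mul_bdd (c := M) hf.aestronglyMeasurable (ae_of_all _ hfM)
  have hfs (y : Plane) : |f y - f x| ≤ 2 * M := by
    have := abs_sub (f y) (f x); linarith [hfM x, hfM y]
  have e1 : conv (dil δ g) f x - f x = ∫ y, dil δ g (x - y) * (f y - f x) := by
    have : f x = ∫ y, dil δ g (x - y) * f x := by
      rw [integral_mul_const, integral_sub_left_eq_self (dil δ g) volume x, integral_dil hδ, h1,
        one_mul]
    conv_lhs => rw [this]
    rw [conv, ← integral_sub i1 (hdi.mul_const _)]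
    congr 1; ext y; ring
  set F : ℕ → Plane → ℝ := fun k y => C * (8 * (1 / 8) ^ k * δ ^ 2 *
    (Metric.closedBall x (2 ^ k / δ)).indicator (fun y => |f y - f x|) y) with hF
  have hFnn (k : ℕ) (y : Plane) : 0 ≤ F k y := by
    have : 0 ≤ (Metric.closedBall x (2 ^ k / δ)).indicator (fun y => |f y - f x|) y :=
      indicator_nonneg (fun _ _ => abs_nonneg _) y
    simp only [hF]; positivity
  have hloc (k : ℕ) : IntegrableOn (fun y => |f y - f x|) (Metric.closedBall x (2 ^ k / δ)) := by
    refine Measure.integrableOn_of_bounded (M := 2 * M) measure_closedBall_lt_top.ne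
      (hf.sub_const _).abs.aestronglyMeasurable (ae_of_all _ fun y => ?_)
    simpa using hfs y
  have hFi (k : ℕ) : Integrable (F k) :=
    (((hloc k).integrable_indicator Metric.isClosed_closedBall.measurableSet).const_mul _).const_mul _
  have hFint (k : ℕ) : ∫ y, F k y = C * (8 * Real.pi * (1 / 2) ^ k *
      ⨍ y in Metric.closedBall x (2 ^ k / δ), |f y - f x|) := by
    have hv := volume_real_closedBall x (r := 2 ^ k / δ) (by positivity)
    simp only [hF]
    rw [integral_const_mul, integral_const_mul,
      integral_indicator Metric.isClosed_closedBall.measurableSet, setAverage_eq, hv, smul_eq_mul]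
    have h8 : ((1 / 8 : ℝ)) ^ k * (2 ^ k) ^ 2 = (1 / 2) ^ k := by
      rw [← pow_mul, mul_comm k 2, pow_mul, ← mul_pow]; norm_num
    have : (1 / 2 : ℝ) ^ k ≠ 0 := by positivity
    rw [← h8]
    field_simp
  have hsum : Summable fun k => ∫ y, F k y := by
    simp only [hFint]
    refine Summable.mul_left _ ?_
    refine Summable.of_nonneg_of_le (fun k => ?_) (fun k => ?_)
      ((summable_geometric_two.mul_left (8 * Real.pi)).mul_right (2 * M))
    · have : 0 ≤ ⨍ y in Metric.closedBall x (2 ^ k / δ), |f y - f x| :=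
        integral_nonneg fun _ => abs_nonneg _
      positivity
    · gcongr
      exact (le_abs_self _).trans (abs_average_abs_sub_le hfM x (by positivity))
  have hpt (y : Plane) : ‖dil δ g (x - y) * (f y - f x)‖ₑ ≤ ∑' k, ENNReal.ofReal (F k y) := by
    obtain ⟨k, hk, hd⟩ := dec_le_dyadic (δ • (x - y))
    refine le_trans ?_ (ENNReal.le_tsum k)
    rw [Real.enorm_eq_ofReal_abs]
    refine ENNReal.ofReal_le_ofReal ?_
    have hm : y ∈ Metric.closedBall x (2 ^ k / δ) := by
      rw [Metric.mem_closedBall, dist_comm, dist_eq_norm, le_div_iff₀ hδ, mul_comm]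
      rwa [norm_smul, Real.norm_of_nonneg hδ.le] at hk
    simp only [hF]
    rw [indicator_of_mem hm, abs_mul, dil, abs_mul, abs_of_pos (by positivity)]
    calc _ ≤ δ ^ 2 * (C * (8 * (1 / 8) ^ k)) * |f y - f x| := by
          gcongr
          exact (hgC _).trans (by gcongr)
      _ = _ := by ring
  have hnn (k : ℕ) : 0 ≤ ∫ y, F k y := integral_nonneg (hFnn k)
  simp only [← hFint]
  rw [← ENNReal.ofReal_le_ofReal_iff (tsum_nonneg hnn), ENNReal.ofReal_tsum_of_nonneg hnn hsum,
    e1, ← Real.enorm_eq_ofReal_abs]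
  calc _ ≤ ∫⁻ y, ‖dil δ g (x - y) * (f y - f x)‖ₑ := enorm_integral_le_lintegral_enorm _
    _ ≤ ∫⁻ y, ∑' k, ENNReal.ofReal (F k y) := lintegral_mono hpt
    _ = ∑' k, ∫⁻ y, ENNReal.ofReal (F k y) :=
        lintegral_tsum fun k => (hFi k).1.aemeasurable.ennreal_ofReal
    _ = _ := by
        congr 1; ext k
        rw [ofReal_integral_eq_lintegral_ofReal (hFi k) (ae_of_all _ (hFnn k))]

/-- At a Lebesgue point every dyadic average tends to zero, and the weights `2⁻ᵏ` dominate the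
series. -/
theorem ae_tendsto_conv_dil {g f : Plane → ℝ} {C M : ℝ} (hg : Measurable g)
    (hgC : ∀ x, |g x| ≤ C * dec x) (h1 : ∫ x, g x = 1) (hf : Measurable f)
    (hfM : ∀ x, |f x| ≤ M) :
    ∀ᵐ x, Tendsto (fun δ => conv (dil δ g) f x) atTop (𝓝 (f x)) := by
  have hC : 0 ≤ C := nonneg_of_mul_nonneg_left ((abs_nonneg _).trans (hgC 0)) (dec_pos 0)
  have hM : 0 ≤ M := (abs_nonneg _).trans (hfM 0)
  have hloc : LocallyIntegrable f volume := by
    refine fun x => ⟨Metric.closedBall x 1, Metric.closedBall_mem_nhds x one_pos, ?_⟩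
    exact Measure.integrableOn_of_bounded measure_closedBall_lt_top.ne hf.aestronglyMeasurable
      (ae_of_all _ hfM)
  filter_upwards [IsUnifLocDoublingMeasure.ae_tendsto_average_norm_sub volume hloc 1] with x hx
  rw [tendsto_iff_norm_sub_tendsto_zero]
  have hA (k : ℕ) : Tendsto (fun δ : ℝ => ⨍ y in Metric.closedBall x (2 ^ k / δ), |f y - f x|) atTop
      (𝓝 0) := by
    refine hx (fun _ => x) (fun δ => 2 ^ k / δ) (tendsto_nhdsWithin_iff.2 ⟨?_, ?_⟩) ?_
    · exact tendsto_const_nhds.div_atTop tendsto_id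
    · filter_upwards [eventually_gt_atTop 0] with δ hδ
      simp only [mem_Ioi]; positivity
    · filter_upwards [eventually_gt_atTop 0] with δ hδ
      rw [one_mul]
      exact Metric.mem_closedBall_self (by positivity)
  have hlim : Tendsto (fun δ : ℝ => ∑' k : ℕ, C * (8 * Real.pi * (1 / 2) ^ k *
      ⨍ y in Metric.closedBall x (2 ^ k / δ), |f y - f x|)) atTop (𝓝 (∑' _ : ℕ, (0 : ℝ))) := by
    refine tendsto_tsum_of_dominated_convergence
      (bound := fun k => C * (8 * Real.pi * (1 / 2) ^ k * (2 * M)))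
      (((summable_geometric_two.mul_left (8 * Real.pi)).mul_right (2 * M)).mul_left C)
      (fun k => by simpa using ((hA k).const_mul (8 * Real.pi * (1 / 2) ^ k)).const_mul C) ?_
    filter_upwards [eventually_gt_atTop 0] with δ hδ k
    have hav := abs_average_abs_sub_le hfM x (r := 2 ^ k / δ) (by positivity)
    rw [norm_mul, norm_mul, Real.norm_of_nonneg hC, Real.norm_of_nonneg (by positivity),
      Real.norm_eq_abs]
    gcongr
  rw [tsum_zero] at hlim
  refine squeeze_zero' (Eventually.of_forall fun _ => norm_nonneg _) ?_ hlim
  filter_upwards [eventually_gt_atTop 0] with δ hδ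
  exact abs_conv_dil_sub_le hg hgC h1 hf hfM hδ x

lemma tendsto_scale_atTop {α : ℝ} (hα : 0 < α) : Tendsto (scale α) (𝓝[>] 0) atTop :=
  tendsto_rpow_neg_nhdsGT_zero (by simp; positivity)

theorem ae_tendsto_conv_heatKernel {ν α : ℝ} (hν : 0 < ν) (hα : 1 / 2 < α) {f : Plane → ℝ} {M : ℝ}
    (hf : Measurable f) (hfM : ∀ x, |f x| ≤ M) :
    ∀ᵐ x, Tendsto (fun t => conv (heatKernel ν α t) f x) (𝓝[>] 0) (𝓝 (f x)) := by
  have ha := heatCoeff_pos hν α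
  have hα0 : 0 < α := by linarith
  have hk := isKernel_heatKernel ν α
  obtain ⟨C, hC⟩ := hk.exists_decay ha hα
  filter_upwards [ae_tendsto_conv_dil (hk.differentiable ha hα0).continuous.measurable hC
    (integral_heatKernel_one hν hα) hf hfM] with x hx
  refine (hx.comp (tendsto_scale_atTop hα0)).congr' ?_
  filter_upwards [self_mem_nhdsWithin] with t ht
  simp only [Function.comp_apply, heatKernel_eq_dil hα0 ht]

/-! ### Convolution in space-time -/

/-- Space-time. -/
abbrev SpaceTime := ℝ × Plane

instance : (volume : Measure SpaceTime).IsAddHaarMeasure := by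
  rw [Measure.volume_eq_prod]; infer_instance

instance : (volume : Measure SpaceTime).InnerRegularCompactLTTop := inferInstance

instance : VAddInvariantMeasure SpaceTime SpaceTime (volume : Measure SpaceTime) := inferInstance

/-- Convolution in space-time. -/
def stConv (k F : SpaceTime → ℝ) (p : SpaceTime) : ℝ := ∫ q, k (p - q) * F q

/-- Continuity of translations in `L¹`, taken from the continuous additive action on `Lp` and
rewritten for a function in place of its class. -/
lemma tendsto_integral_abs_translate_sub {k : SpaceTime → ℝ} (hk : Integrable k) :
    Tendsto (fun h => ∫ z, |k (h + z) - k z|) (𝓝 0) (𝓝 0) := by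
  have hm : MemLp k 1 volume := memLp_one_iff_integrable.2 hk
  have : Fact ((1 : ℝ≥0∞) ≠ ∞) := ⟨ENNReal.one_ne_top⟩
  set f := hm.toLp k
  have hc : Continuous fun h : SpaceTime =>
      (DomAddAct.mk h +ᵥ f : Lp ℝ 1 (volume : Measure SpaceTime)) :=
    (DomAddAct.continuous_mk (M := SpaceTime)).vadd continuous_const
  have h0 := (hc.sub (continuous_const (y := f))).norm.tendsto 0
  have e0 : DomAddAct.mk (0 : SpaceTime) +ᵥ f = f := zero_vadd _ f
  simp only [Pi.sub_apply] at h0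
  rw [e0, sub_self, norm_zero] at h0
  refine h0.congr fun h => ?_
  have e1 : DomAddAct.mk h +ᵥ f = (hm.comp_measurePreserving
    (measurePreserving_vadd h volume)).toLp (k <| h +ᵥ ·) := rfl
  rw [e1, ← MemLp.toLp_sub, L1.norm_eq_integral_norm]
  refine integral_congr_ae ?_
  filter_upwards [MemLp.coeFn_toLp (((hm.comp_measurePreserving
    (measurePreserving_vadd h volume))).sub hm)] with z hz
  refine (congrArg norm hz).trans ?_
  simp [Real.norm_eq_abs]

section

variable {k F G : SpaceTime → ℝ} {M : ℝ}

lemma integrable_stConv (hk : Integrable k) (hF : AEStronglyMeasurable F volume)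
    (hM : ∀ᵐ q, |F q| ≤ M) (p : SpaceTime) : Integrable fun q => k (p - q) * F q :=
  (hk.comp_sub_left p).mul_bdd (c := M) hF hM

lemma abs_stConv_le (hk : Integrable k) (hM : ∀ᵐ q, |F q| ≤ M) (p : SpaceTime) :
    |stConv k F p| ≤ (∫ z, |k z|) * M := by
  have e : (∫ z, |k z|) * M = ∫ q, |k (p - q)| * M := by
    rw [integral_mul_const, integral_sub_left_eq_self (fun z => |k z|) volume p]
  rw [e]
  refine abs_integral_le_integral_abs.trans ?_
  refine integral_mono_of_nonneg (ae_of_all _ fun _ => abs_nonneg _)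
    ((hk.comp_sub_left p).abs.mul_const M) ?_
  filter_upwards [hM] with q hq
  rw [abs_mul]
  exact mul_le_mul_of_nonneg_left hq (abs_nonneg _)

lemma stConv_sub (hk : Integrable k) (hF : AEStronglyMeasurable F volume)
    (hG : AEStronglyMeasurable G volume) (hFM : ∀ᵐ q, |F q| ≤ M) (hGM : ∀ᵐ q, |G q| ≤ M)
    (p : SpaceTime) : stConv k F p - stConv k G p = stConv k (fun q => F q - G q) p := by
  rw [stConv, stConv, ← integral_sub (integrable_stConv hk hF hFM p)
    (integrable_stConv hk hG hGM p), stConv]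
  congr 1; ext q; ring

lemma stConv_congr (h : F =ᵐ[volume] G) (p : SpaceTime) : stConv k F p = stConv k G p := by
  refine integral_congr_ae ?_
  filter_upwards [h] with q hq
  rw [hq]

/-- The modulus of continuity is the `L¹` modulus of translation of `k` times `M`; no regularity of
`F` enters. -/
lemma uniformContinuous_stConv (hk : Integrable k) (hF : AEStronglyMeasurable F volume)
    (hM : ∀ᵐ q, |F q| ≤ M) : UniformContinuous (stConv k F) := by
  have hM0 : 0 ≤ M := by
    obtain ⟨q, hq⟩ := hM.exists
    exact (abs_nonneg _).trans hq
  rw [Metric.uniformContinuous_iff]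
  intro ε hε
  have ht := (tendsto_integral_abs_translate_sub hk).mul_const M
  rw [zero_mul] at ht
  obtain ⟨δ, hδ, h⟩ := Metric.eventually_nhds_iff.1 (ht.eventually_lt_const hε)
  refine ⟨δ, hδ, fun p p' hp => lt_of_le_of_lt ?_ (h (y := p - p') (by
    rwa [dist_eq_norm, sub_zero, ← dist_eq_norm]))⟩
  have i1 := hk.comp_sub_left p
  have i2 := hk.comp_sub_left p'
  have e : ∫ z, |k (p - p' + z) - k z| = ∫ q, |k (p - q) - k (p' - q)| := by
    rw [← integral_sub_left_eq_self (fun z => |k (p - p' + z) - k z|) volume p']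
    simp only [sub_add_sub_cancel]
  rw [Real.dist_eq, stConv, stConv, ← integral_sub (integrable_stConv hk hF hM p)
    (integrable_stConv hk hF hM p'), e, ← integral_mul_const]
  refine abs_integral_le_integral_abs.trans ?_
  refine integral_mono_of_nonneg (ae_of_all _ fun _ => abs_nonneg _)
    ((i1.sub i2).abs.mul_const M) ?_
  filter_upwards [hM] with q hq
  simp only [← sub_mul, abs_mul]
  exact mul_le_mul_of_nonneg_left hq (abs_nonneg _)

end

/-! ### The fixed point problem -/

/-- The nonlinearity `(θ, u) ↦ θ u`. -/
def quad (z : Fin 3 → ℝ) (j : Fin 2) : ℝ := z 0 * z j.succ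

lemma abs_quad_le {z : Fin 3 → ℝ} {B : ℝ} (h : ∀ i, |z i| ≤ B) (j : Fin 2) :
    |quad z j| ≤ B * B := by
  rw [quad, abs_mul]
  exact mul_le_mul (h _) (h _) (abs_nonneg _) ((abs_nonneg _).trans (h 0))

lemma abs_quad_sub_le {z w : Fin 3 → ℝ} {B d : ℝ} (hz : ∀ i, |z i| ≤ B) (hw : ∀ i, |w i| ≤ B)
    (hd : ∀ i, |z i - w i| ≤ d) (j : Fin 2) : |quad z j - quad w j| ≤ 2 * B * d := by
  have hB : 0 ≤ B := (abs_nonneg _).trans (hz 0)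
  have e : quad z j - quad w j = (z 0 - w 0) * z j.succ + w 0 * (z j.succ - w j.succ) := by
    simp only [quad]; ring
  rw [e]
  refine (abs_add_le _ _).trans ?_
  rw [abs_mul, abs_mul]
  have h1 := mul_le_mul (hd 0) (hz j.succ) (abs_nonneg _) ((abs_nonneg _).trans (hd 0))
  have h2 := mul_le_mul (hw 0) (hd j.succ) (abs_nonneg _) hB
  linarith

/-- The bilinear Duhamel operator, with the source restricted to `S`. -/
def duhamel (k : Fin 3 → Fin 2 → SpaceTime → ℝ) (S : Set SpaceTime)
    (z : SpaceTime → Fin 3 → ℝ) (p : SpaceTime) (i : Fin 3) : ℝ :=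
  ∑ j, stConv (k i j) (S.indicator fun q => quad (z q) j) p

section

variable {k : Fin 3 → Fin 2 → SpaceTime → ℝ} {S : Set SpaceTime} {z w : SpaceTime → Fin 3 → ℝ}
  {B : ℝ}

lemma ae_abs_indicator_le {φ : SpaceTime → ℝ} {c : ℝ} (hc : 0 ≤ c)
    (h : ∀ᵐ q, q ∈ S → |φ q| ≤ c) : ∀ᵐ q, |S.indicator φ q| ≤ c := by
  filter_upwards [h] with q hq
  by_cases hS : q ∈ S
  · rw [indicator_of_mem hS]; exact hq hS
  · rw [indicator_of_notMem hS, abs_zero]; exact hc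

lemma abs_duhamel_le (hk : ∀ i j, Integrable (k i j)) (hB : 0 ≤ B)
    (hz : ∀ᵐ q, q ∈ S → ∀ i, |z q i| ≤ B) (p : SpaceTime) (i : Fin 3) :
    |duhamel k S z p i| ≤ (∑ j, ∫ q, |k i j q|) * (B * B) := by
  rw [duhamel, Finset.sum_mul]
  refine (Finset.abs_sum_le_sum_abs _ _).trans (Finset.sum_le_sum fun j _ => ?_)
  refine abs_stConv_le (hk i j) (ae_abs_indicator_le (mul_nonneg hB hB) ?_) p
  filter_upwards [hz] with q hq hS using abs_quad_le (hq hS) j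

lemma uniformContinuous_duhamel (hk : ∀ i j, Integrable (k i j)) (hB : 0 ≤ B)
    (hz : ∀ᵐ q, q ∈ S → ∀ i, |z q i| ≤ B)
    (hm : ∀ j, AEStronglyMeasurable (S.indicator fun q => quad (z q) j) volume) (i : Fin 3) :
    UniformContinuous fun p => duhamel k S z p i := by
  simp only [duhamel, Fin.sum_univ_two]
  have h (j : Fin 2) : UniformContinuous (stConv (k i j) (S.indicator fun q => quad (z q) j)) := by
    refine uniformContinuous_stConv (hk i j) (hm j) (ae_abs_indicator_le (mul_nonneg hB hB) ?_)
    filter_upwards [hz] with q hq hS using abs_quad_le (hq hS) j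
  exact (h 0).add (h 1)

lemma aestronglyMeasurable_quad (hS : MeasurableSet S) (hz : ∀ i, Measurable fun q => z q i)
    (j : Fin 2) : AEStronglyMeasurable (S.indicator fun q => quad (z q) j) volume :=
  (((hz 0).mul (hz j.succ)).indicator hS).aestronglyMeasurable

lemma abs_duhamel_sub_le (hk : ∀ i j, Integrable (k i j)) (hS : MeasurableSet S)
    (hzm : ∀ i, Measurable fun q => z q i) (hwm : ∀ i, Measurable fun q => w q i)
    (hz : ∀ q ∈ S, ∀ i, |z q i| ≤ B) (hw : ∀ q ∈ S, ∀ i, |w q i| ≤ B) (hB : 0 ≤ B)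
    {d : ℝ} (hd0 : 0 ≤ d) (hd : ∀ q ∈ S, ∀ i, |z q i - w q i| ≤ d) (p : SpaceTime) (i : Fin 3) :
    |duhamel k S z p i - duhamel k S w p i| ≤ (∑ j, ∫ q, |k i j q|) * (2 * B * d) := by
  rw [duhamel, duhamel, Finset.sum_mul, ← Finset.sum_sub_distrib]
  refine (Finset.abs_sum_le_sum_abs _ _).trans (Finset.sum_le_sum fun j _ => ?_)
  rw [stConv_sub (hk i j) (aestronglyMeasurable_quad hS hzm j) (aestronglyMeasurable_quad hS hwm j)
    (ae_abs_indicator_le (mul_nonneg hB hB) (ae_of_all _ fun q hq => abs_quad_le (hz q hq) j))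
    (ae_abs_indicator_le (mul_nonneg hB hB) (ae_of_all _ fun q hq => abs_quad_le (hw q hq) j))]
  refine abs_stConv_le (hk i j) (ae_of_all _ fun q => ?_) p
  by_cases hq : q ∈ S
  · rw [indicator_of_mem hq, indicator_of_mem hq]
    exact abs_quad_sub_le (hz q hq) (hw q hq) (hd q hq) j
  · rw [indicator_of_notMem hq, indicator_of_notMem hq, sub_zero, abs_zero]
    positivity

open BoundedContinuousFunction in
/-- Existence of a fixed point for small kernels. -/
theorem exists_duhamel_fixedPoint (hk : ∀ i j, Integrable (k i j)) (hS : MeasurableSet S)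
    {h : SpaceTime → Fin 3 → ℝ} (hhm : ∀ i, Measurable fun q => h q i) {M : ℝ}
    (hM : 0 ≤ M) (hhM : ∀ q i, |h q i| ≤ M)
    (hsmall : ∀ i, (∑ j, ∫ q, |k i j q|) * (4 * (M + 1) ^ 2) ≤ 1) :
    ∃ v : SpaceTime → Fin 3 → ℝ, (∀ i, Continuous fun p => v p i) ∧ (∀ p i, |v p i| ≤ 1) ∧
      ∀ p i, v p i = duhamel k S (fun q i => h q i - v q i) p i := by
  have hsub {v : SpaceTime → Fin 3 → ℝ} {B : ℝ} (hv : ∀ p i, |v p i| ≤ B) (q : SpaceTime)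
      (i : Fin 3) : |h q i - v q i| ≤ M + B := (abs_sub _ _).trans (add_le_add (hhM q i) (hv q i))
  have hbn (v : SpaceTime →ᵇ (Fin 3 → ℝ)) (p : SpaceTime) (i : Fin 3) : |v p i| ≤ ‖v‖ :=
    (norm_le_pi_norm (v p) i).trans (v.norm_coe_le_norm p)
  have hvm (v : SpaceTime →ᵇ (Fin 3 → ℝ)) (i : Fin 3) : Measurable fun q => h q i - v q i :=
    (hhm i).sub ((continuous_apply i).comp v.continuous).measurable
  have hη (i : Fin 3) : 0 ≤ ∑ j, ∫ q, |k i j q| :=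
    Finset.sum_nonneg fun j _ => integral_nonneg fun _ => abs_nonneg _
  -- The unknown is the Duhamel term and not the state: it is continuous, whereas `h` is only
  -- assumed measurable. The complete space of bounded continuous functions is thus available.
  set Φ : (SpaceTime →ᵇ (Fin 3 → ℝ)) → (SpaceTime →ᵇ (Fin 3 → ℝ)) := fun v =>
    ofNormedAddCommGroup (duhamel k S (fun q i => h q i - v q i))
      (continuous_pi fun i => (uniformContinuous_duhamel hk (by positivity)
        (ae_of_all _ fun q _ => hsub (hbn v) q)
        (aestronglyMeasurable_quad hS (hvm v)) i).continuous)
      ((∑ i, ∑ j, ∫ q, |k i j q|) * ((M + ‖v‖) * (M + ‖v‖)))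
      (fun p => by
        refine (pi_norm_le_iff_of_nonneg (mul_nonneg (Finset.sum_nonneg fun i _ => hη i)
          (by positivity))).2 fun i => ?_
        refine (abs_duhamel_le hk (by positivity) (ae_of_all _ fun q _ => hsub (hbn v) q) p i).trans ?_
        gcongr
        exact Finset.single_le_sum (f := fun i => ∑ j, ∫ q, |k i j q|) (fun i _ => hη i)
          (Finset.mem_univ i)) with hΦ
  have hΦa (v : SpaceTime →ᵇ (Fin 3 → ℝ)) (p : SpaceTime) (i : Fin 3) :
      Φ v p i = duhamel k S (fun q i => h q i - v q i) p i := rfl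
  have hball {v : SpaceTime →ᵇ (Fin 3 → ℝ)} (hv : v ∈ Metric.closedBall 0 1) (p : SpaceTime)
      (i : Fin 3) : |v p i| ≤ 1 := (hbn v p i).trans (by simpa using hv)
  have hmaps : MapsTo Φ (Metric.closedBall 0 1) (Metric.closedBall 0 1) := by
    intro v hv
    rw [mem_closedBall_zero_iff, norm_le zero_le_one]
    intro p
    refine (pi_norm_le_iff_of_nonneg zero_le_one).2 fun i => ?_
    rw [hΦa, Real.norm_eq_abs]
    refine (abs_duhamel_le hk (B := M + 1) (by positivity)
      (ae_of_all _ fun q _ => hsub (hball hv) q) p i).trans (le_trans ?_ (hsmall i))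
    exact mul_le_mul_of_nonneg_left (by nlinarith) (hη i)
  -- The quadratic term has Lipschitz constant `2 (M + 1)` on the ball. By `M + 1 ≤ (M + 1)²`, the
  -- smallness hypothesis turns the product with the kernel norm into at most `1 / 2`.
  have hcon : ContractingWith (1 / 2 : NNReal) (hmaps.restrict Φ _ _) := by
    refine ⟨by norm_num, LipschitzWith.of_dist_le_mul fun v w => ?_⟩
    rw [Subtype.dist_eq, Subtype.dist_eq, MapsTo.val_restrict_apply, MapsTo.val_restrict_apply,
      BoundedContinuousFunction.dist_le (by positivity)]
    intro p
    refine (dist_pi_le_iff (by positivity)).2 fun i => ?_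
    rw [hΦa, hΦa, Real.dist_eq]
    have := hη i
    refine (abs_duhamel_sub_le hk hS (hvm v) (hvm w) (B := M + 1) (d := dist v.1 w.1)
      (fun q _ => hsub (hball v.2) q) (fun q _ => hsub (hball w.2) q) (by positivity) dist_nonneg
      (fun q _ i => ?_) p i).trans ?_
    · rw [sub_sub_sub_cancel_left, abs_sub_comm, ← Real.dist_eq]
      exact (dist_le_pi_dist (v.1 q) (w.1 q) i).trans (BoundedContinuousFunction.dist_coe_le_dist q)
    · have h1 := hsmall i
      have hM1 : M + 1 ≤ (M + 1) ^ 2 := by nlinarith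
      have h2 : (∑ j, ∫ q, |k i j q|) * (4 * (M + 1)) ≤ 1 := le_trans (by gcongr) h1
      have hd : 0 ≤ dist v.1 w.1 := dist_nonneg
      calc _ = (∑ j, ∫ q, |k i j q|) * (4 * (M + 1)) * (1 / 2 * dist v.1 w.1) := by ring
        _ ≤ 1 * (1 / 2 * dist v.1 w.1) := by gcongr
        _ = _ := by simp
  obtain ⟨v, hv, hfix, -⟩ := hcon.exists_fixedPoint' Metric.isClosed_closedBall.isComplete hmaps
    (x := 0) (Metric.mem_closedBall_self zero_le_one) (edist_ne_top _ _)
  refine ⟨v, fun i => (continuous_apply i).comp v.continuous, hball hv, fun p i => ?_⟩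
  rw [← hΦa, hfix]

/-- Uniqueness of bounded fixed points for kernels supported in positive times. -/
theorem duhamel_fixedPoint_unique (hk : ∀ i j, Integrable (k i j)) (hS : MeasurableSet S)
    (hpos : ∀ i j p, p.1 ≤ 0 → k i j p = 0)
    {h v w : SpaceTime → Fin 3 → ℝ} (hhm : ∀ i, Measurable fun q => h q i)
    (hvm : ∀ i, Measurable fun q => v q i) (hwm : ∀ i, Measurable fun q => w q i)
    (hh : ∀ q i, |h q i| ≤ B) (hv : ∀ q i, |v q i| ≤ B)
    (hw : ∀ q i, |w q i| ≤ B) (hSt : ∀ q ∈ S, 0 ≤ q.1)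
    (ev : ∀ p i, v p i = duhamel k S (fun q i => h q i - v q i) p i)
    (ew : ∀ p i, w p i = duhamel k S (fun q i => h q i - w q i) p i) :
    ∀ p ∈ S, ∀ i, v p i = w p i := by
  have hB : 0 ≤ B := (abs_nonneg _).trans (hv 0 0)
  have hwt (l : ℝ) (hl : 0 ≤ l) (i j) : Integrable fun q : SpaceTime => Real.exp (-l * q.1) * k i j q := by
    refine (hk i j).mono (AEStronglyMeasurable.mul (Continuous.aestronglyMeasurable (by fun_prop))
      (hk i j).1) (ae_of_all _ fun q => ?_)
    rcases le_or_gt q.1 0 with hq | hq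
    · rw [hpos i j q hq, mul_zero]
    · rw [norm_mul, Real.norm_of_nonneg (Real.exp_pos _).le]
      exact mul_le_of_le_one_left (norm_nonneg _) (Real.exp_le_one_iff.2 (by nlinarith))
  -- The kernels live in positive times, where `e^{-lt} → 0`; hence the weighted norms tend to zero
  -- although the unweighted ones need not be small.
  have hlim (i j) : Tendsto (fun l : ℝ => ∫ q : SpaceTime, |Real.exp (-l * q.1) * k i j q|) atTop
      (𝓝 0) := by
    have : (0 : ℝ) = ∫ _ : SpaceTime, (0 : ℝ) := by simp
    rw [this]
    refine tendsto_integral_filter_of_dominated_convergence (fun q => |k i j q|) ?_ ?_ (hk i j).abs ?_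
    · filter_upwards [eventually_ge_atTop 0] with l hl
      exact (hwt l hl i j).abs.1
    · filter_upwards [eventually_ge_atTop 0] with l hl
      refine ae_of_all _ fun q => ?_
      rcases le_or_gt q.1 0 with hq | hq
      · rw [hpos i j q hq]; simp
      · rw [norm_abs_eq_norm, norm_mul, Real.norm_of_nonneg (Real.exp_pos _).le]
        exact mul_le_of_le_one_left (norm_nonneg _) (Real.exp_le_one_iff.2 (by nlinarith))
    · refine ae_of_all _ fun q => ?_
      rcases le_or_gt q.1 0 with hq | hq
      · rw [hpos i j q hq]; simp
      · have h1 : Tendsto (fun l : ℝ => Real.exp (-l * q.1)) atTop (𝓝 0) := by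
          refine Real.tendsto_exp_atBot.comp ?_
          exact (tendsto_neg_atTop_atBot).atBot_mul_const hq
        simpa using (h1.mul_const (k i j q)).abs
  obtain ⟨l, hl0, hl⟩ : ∃ l : ℝ, 0 ≤ l ∧ ∀ i,
      (∑ j, ∫ q : SpaceTime, |Real.exp (-l * q.1) * k i j q|) * (4 * B) ≤ 1 / 2 := by
    have h1 (i) : Tendsto (fun l : ℝ => (∑ j, ∫ q : SpaceTime, |Real.exp (-l * q.1) * k i j q|)
        * (4 * B)) atTop (𝓝 0) := by
      simpa using (tendsto_finsetSum Finset.univ fun j _ => hlim i j).mul_const (4 * B)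
    have h2 : ∀ᶠ l : ℝ in atTop, ∀ i, (∑ j, ∫ q : SpaceTime, |Real.exp (-l * q.1) * k i j q|)
        * (4 * B) ≤ 1 / 2 :=
      eventually_all.2 fun i => (h1 i).eventually_le_const (by norm_num)
    exact ((eventually_ge_atTop 0).and h2).exists
  have hbv (q) (i) : |h q i - v q i| ≤ 2 * B := by
    have := (abs_sub (h q i) (v q i)); linarith [hh q i, hv q i]
  have hbw (q) (i) : |h q i - w q i| ≤ 2 * B := by
    have := (abs_sub (h q i) (w q i)); linarith [hh q i, hw q i]
  -- In the norm weighted by `e^{-lt}` the difference is halved. The weight passes through the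
  -- convolution by `e^{l q₁} = e^{-l (p - q)₁} e^{l p₁}`, and `4 B = 2 · 2 B` is the Lipschitz
  -- constant of the nonlinearity.
  have step (N : ℝ) (hN0 : 0 ≤ N)
      (hN : ∀ p ∈ S, ∀ i, |v p i - w p i| ≤ N * Real.exp (l * p.1)) :
      ∀ p ∈ S, ∀ i, |v p i - w p i| ≤ (N / 2) * Real.exp (l * p.1) := by
    intro p hp i
    have hvm' (i) : Measurable fun q => h q i - v q i := (hhm i).sub (hvm i)
    have hwm' (i) : Measurable fun q => h q i - w q i := (hhm i).sub (hwm i)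
    have hb0 : (0 : ℝ) ≤ 2 * B * (2 * B) := by positivity
    have hterm (j) : |stConv (k i j) (S.indicator fun q => quad (fun i => h q i - v q i) j) p
        - stConv (k i j) (S.indicator fun q => quad (fun i => h q i - w q i) j) p|
        ≤ (∫ q : SpaceTime, |Real.exp (-l * q.1) * k i j q|) * (4 * B * N * Real.exp (l * p.1)) := by
      rw [stConv_sub (hk i j) (aestronglyMeasurable_quad hS hvm' j)
        (aestronglyMeasurable_quad hS hwm' j)
        (ae_abs_indicator_le hb0 (ae_of_all _ fun q _ => abs_quad_le (hbv q) j))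
        (ae_abs_indicator_le hb0 (ae_of_all _ fun q _ => abs_quad_le (hbw q) j)), stConv]
      rw [← integral_mul_const, ← integral_sub_left_eq_self (fun q : SpaceTime =>
        |Real.exp (-l * q.1) * k i j q| * (4 * B * N * Real.exp (l * p.1))) volume p]
      refine abs_integral_le_integral_abs.trans ?_
      refine integral_mono_of_nonneg (ae_of_all _ fun _ => abs_nonneg _)
        (((hwt l hl0 i j).comp_sub_left p).abs.mul_const _) (ae_of_all _ fun q => ?_)
      simp only [abs_mul, abs_of_pos (Real.exp_pos _)]
      by_cases hq : q ∈ S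
      · rw [indicator_of_mem hq, indicator_of_mem hq]
        have h1 := abs_quad_sub_le (hbv q) (hbw q) (d := N * Real.exp (l * q.1)) (fun i => by
          rw [sub_sub_sub_cancel_left, abs_sub_comm]; exact hN q hq i) j
        calc _ ≤ |k i j (p - q)| * (2 * (2 * B) * (N * Real.exp (l * q.1))) := by gcongr
          _ = |k i j (p - q)| * (4 * B * N) *
              (Real.exp (-l * (p - q).1) * Real.exp (l * p.1)) := by
              rw [← Real.exp_add]
              have : -l * (p - q).1 + l * p.1 = l * q.1 := by rw [Prod.fst_sub]; ring
              rw [this]; ring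
          _ = _ := by ring
      · rw [indicator_of_notMem hq, indicator_of_notMem hq, sub_zero, abs_zero, mul_zero]
        positivity
    rw [ev p i, ew p i, duhamel, duhamel, ← Finset.sum_sub_distrib]
    calc _ ≤ ∑ j, (∫ q : SpaceTime, |Real.exp (-l * q.1) * k i j q|)
          * (4 * B * N * Real.exp (l * p.1)) :=
          (Finset.abs_sum_le_sum_abs _ _).trans (Finset.sum_le_sum fun j _ => hterm j)
      _ = (∑ j, ∫ q : SpaceTime, |Real.exp (-l * q.1) * k i j q|) * (4 * B)
          * (N * Real.exp (l * p.1)) := by rw [← Finset.sum_mul]; ring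
      _ ≤ 1 / 2 * (N * Real.exp (l * p.1)) := by gcongr; exact hl i
      _ = _ := by ring
  -- The start uses that times in `S` are nonnegative, so the weight is at least one.
  have iter (n : ℕ) : ∀ p ∈ S, ∀ i, |v p i - w p i| ≤ (2 * B * (1 / 2) ^ n) * Real.exp (l * p.1) := by
    induction n with
    | zero =>
      intro p hp i
      have h1 := abs_sub (v p i) (w p i)
      have h2 : 1 ≤ Real.exp (l * p.1) := Real.one_le_exp (mul_nonneg hl0 (hSt p hp))
      rw [pow_zero, mul_one]
      nlinarith [hv p i, hw p i]
    | succ n ih =>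
      intro p hp i
      refine (step _ (by positivity) ih p hp i).trans_eq ?_
      rw [pow_succ]; ring
  intro p hp i
  have ht : Tendsto (fun n : ℕ => (2 * B * (1 / 2 : ℝ) ^ n) * Real.exp (l * p.1)) atTop (𝓝 0) := by
    simpa using ((tendsto_pow_atTop_nhds_zero_of_lt_one (r := (1 / 2 : ℝ)) (by norm_num)
      (by norm_num)).const_mul (2 * B)).mul_const (Real.exp (l * p.1))
  have := ge_of_tendsto' ht fun n => iter n p hp i
  exact sub_eq_zero.1 (abs_eq_zero.1 (le_antisymm this (abs_nonneg _)))

end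

/-! ### Self-similar Duhamel kernels -/

/-- The kernel `t^{-1/(2α)} · t^{-1/α} κ(t^{-1/(2α)} x)`, of `L¹` norm `t^{-1/(2α)} ‖κ‖₁`. -/
def duhamelKernel (α : ℝ) (κ : Plane → ℝ) (t : ℝ) (x : Plane) : ℝ :=
  scale α t * dil (scale α t) κ x

/-- The kernel `duhamelKernel`, restricted to times in `(0, T)`, as a function on space-time. -/
def stKernel (α T : ℝ) (κ : Plane → ℝ) : SpaceTime → ℝ :=
  (Ioo 0 T ×ˢ univ).indicator fun p => duhamelKernel α κ p.1 p.2

lemma integrable_duhamelKernel {α t : ℝ} (ht : 0 < t) {κ : Plane → ℝ} (hκ : Integrable κ) :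
    Integrable (duhamelKernel α κ t) :=
  (integrable_dil (scale_pos α ht) hκ).const_mul _

lemma integral_abs_duhamelKernel {α t : ℝ} (ht : 0 < t) (κ : Plane → ℝ) :
    ∫ x, |duhamelKernel α κ t x| = scale α t * ∫ x, |κ x| := by
  simp only [duhamelKernel, abs_mul, abs_of_pos (scale_pos α ht), abs_dil]
  rw [integral_const_mul, integral_dil (scale_pos α ht)]

lemma measurable_scale (α : ℝ) : Measurable (scale α) := by
  unfold scale; fun_prop

lemma measurable_stKernel (α T : ℝ) {κ : Plane → ℝ} (hκ : Measurable κ) :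
    Measurable (stKernel α T κ) := by
  have h1 : Measurable fun p : SpaceTime => scale α p.1 := (measurable_scale α).comp measurable_fst
  refine Measurable.indicator ?_ (measurableSet_Ioo.prod MeasurableSet.univ)
  exact h1.mul ((h1.pow_const 2).mul (hκ.comp (h1.smul measurable_snd)))

lemma stKernel_of_mem {α T : ℝ} {κ : Plane → ℝ} {p : SpaceTime} (h : p.1 ∈ Ioo 0 T) :
    stKernel α T κ p = duhamelKernel α κ p.1 p.2 :=
  indicator_of_mem (by simpa using h) _

lemma stKernel_of_notMem {α T : ℝ} {κ : Plane → ℝ} {p : SpaceTime} (h : p.1 ∉ Ioo 0 T) :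
    stKernel α T κ p = 0 :=
  indicator_of_notMem (fun h' => h h'.1) _

/-- This is the condition for `t^{-1/(2α)}` to be integrable at `t = 0`. -/
lemma exponent_lt_one {α : ℝ} (hα : 1 / 2 < α) : 1 / (2 * α) < 1 := by
  rw [div_lt_one (by linarith)]; linarith

lemma intervalIntegrable_scale {α : ℝ} (hα : 1 / 2 < α) (T : ℝ) :
    IntervalIntegrable (scale α) volume 0 T :=
  intervalIntegral.intervalIntegrable_rpow' (by linarith [exponent_lt_one hα])

lemma integral_abs_stKernel_section {α T : ℝ} (κ : Plane → ℝ) (t : ℝ) :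
    ∫ x, |stKernel α T κ (t, x)| = (Ioo 0 T).indicator (fun t => scale α t * ∫ x, |κ x|) t := by
  by_cases ht : t ∈ Ioo 0 T
  · rw [indicator_of_mem ht, ← integral_abs_duhamelKernel ht.1]
    congr 1; ext x
    rw [stKernel_of_mem (p := (t, x)) ht]
  · rw [indicator_of_notMem ht]
    have : ∀ x, stKernel α T κ (t, x) = 0 := fun x => stKernel_of_notMem ht
    simp [this]

lemma integrable_stKernel {α T : ℝ} (hα : 1 / 2 < α) (hT : 0 ≤ T) {κ : Plane → ℝ}
    (hκ : Measurable κ) (hκi : Integrable κ) : Integrable (stKernel α T κ) := by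
  rw [Measure.volume_eq_prod, integrable_prod_iff (measurable_stKernel α T hκ).aestronglyMeasurable]
  constructor
  · refine ae_of_all _ fun t => ?_
    by_cases ht : t ∈ Ioo 0 T
    · refine (integrable_duhamelKernel (α := α) ht.1 hκi).congr (ae_of_all _ fun x => ?_)
      exact (stKernel_of_mem (p := (t, x)) ht).symm
    · have : (fun x => stKernel α T κ (t, x)) = fun _ => 0 := funext fun x => stKernel_of_notMem ht
      rw [this]
      exact integrable_zero _ _ _
  · simp only [Real.norm_eq_abs, integral_abs_stKernel_section]
    rw [integrable_indicator_iff measurableSet_Ioo]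
    have := (intervalIntegrable_iff_integrableOn_Ioo_of_le hT).1 (intervalIntegrable_scale hα T)
    exact Integrable.mul_const this _

lemma integral_abs_stKernel {α T : ℝ} (hα : 1 / 2 < α) (hT : 0 ≤ T) {κ : Plane → ℝ}
    (hκ : Measurable κ) (hκi : Integrable κ) :
    ∫ p, |stKernel α T κ p|
      = T ^ (1 - 1 / (2 * α)) / (1 - 1 / (2 * α)) * ∫ x, |κ x| := by
  have hγ := exponent_lt_one hα
  rw [Measure.volume_eq_prod, integral_prod _ (integrable_stKernel hα hT hκ hκi).abs]
  simp only [integral_abs_stKernel_section]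
  rw [integral_indicator measurableSet_Ioo, integral_mul_const]
  congr 1
  rw [← integral_Ioc_eq_integral_Ioo, ← intervalIntegral.integral_of_le hT]
  simp only [scale]
  rw [integral_rpow (Or.inl (by linarith)), neg_add_eq_sub, Real.zero_rpow (by linarith), sub_zero]

lemma tendsto_integral_abs_stKernel {α : ℝ} (hα : 1 / 2 < α) {κ : Plane → ℝ}
    (hκ : Measurable κ) (hκi : Integrable κ) :
    Tendsto (fun T => ∫ p, |stKernel α T κ p|) (𝓝[>] 0) (𝓝 0) := by
  have hγ := exponent_lt_one hα
  have h0 : Tendsto (fun T : ℝ => T ^ (1 - 1 / (2 * α)) / (1 - 1 / (2 * α)) * ∫ x, |κ x|) (𝓝[>] 0)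
      (𝓝 0) := by
    have hc : Continuous fun T : ℝ => T ^ (1 - 1 / (2 * α)) / (1 - 1 / (2 * α)) * ∫ x, |κ x| :=
      ((Real.continuous_rpow_const (by linarith)).div_const _).mul_const _
    have := hc.tendsto 0
    rw [Real.zero_rpow (by linarith), zero_div, zero_mul] at this
    exact this.mono_left nhdsWithin_le_nhds
  refine h0.congr' ?_
  filter_upwards [self_mem_nhdsWithin] with T hT
  exact (integral_abs_stKernel hα (le_of_lt hT) hκ hκi).symm

/-- The space-time convolution with `stKernel` is a Duhamel integral. -/
theorem stConv_stKernel_eq {α T : ℝ} (hα : 1 / 2 < α) {κ : Plane → ℝ} (hκ : Measurable κ)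
    (hκi : Integrable κ) {F : SpaceTime → ℝ} {M : ℝ}
    (hF : AEStronglyMeasurable ((Icc 0 T ×ˢ univ).indicator F) volume)
    (hM : ∀ᵐ q, |(Icc 0 T ×ˢ univ).indicator F q| ≤ M) {t : ℝ} (ht : t ∈ Icc 0 T) (x : Plane) :
    IntervalIntegrable (fun s => conv (duhamelKernel α κ (t - s)) (fun y => F (s, y)) x) volume 0 t ∧
      stConv (stKernel α T κ) ((Icc 0 T ×ˢ univ).indicator F) (t, x)
        = ∫ s in (0 : ℝ)..t, conv (duhamelKernel α κ (t - s)) (fun y => F (s, y)) x := by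
  have hT : 0 ≤ T := ht.1.trans ht.2
  have hint := integrable_stConv (integrable_stKernel hα hT hκ hκi) hF hM (t, x)
  rw [Measure.volume_eq_prod] at hint
  -- Times `s < 0` are removed by the slab and times `s > t` by the support of the kernel, leaving
  -- the Duhamel range up to two null times.
  have hsec : (fun s => ∫ y, stKernel α T κ ((t, x) - (s, y))
        * (Icc 0 T ×ˢ univ).indicator F (s, y)) =ᵐ[volume]
      (Ioc 0 t).indicator fun s => conv (duhamelKernel α κ (t - s)) (fun y => F (s, y)) x := by
    have h0 : ∀ᵐ s : ℝ, s ≠ 0 := by simp [ae_iff]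
    have h1 : ∀ᵐ s : ℝ, s ≠ t := by simp [ae_iff]
    filter_upwards [h0, h1] with s hs0 hst
    by_cases hs : s ∈ Ioc 0 t
    · rw [indicator_of_mem hs, conv]
      have hs' : s < t := lt_of_le_of_ne hs.2 hst
      congr 1; ext y
      rw [stKernel_of_mem (p := (t, x) - (s, y)) ⟨by simpa using hs', by
        simp only [Prod.fst_sub]; linarith [hs.1, ht.2]⟩,
        indicator_of_mem (show (s, y) ∈ Icc 0 T ×ˢ univ from ⟨⟨hs.1.le, hs.2.trans ht.2⟩, trivial⟩)]
      rfl
    · rw [indicator_of_notMem hs]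
      refine integral_eq_zero_of_ae (ae_of_all _ fun y => ?_)
      simp only [Pi.zero_apply]
      rcases lt_or_ge s 0 with h | h
      · rw [indicator_of_notMem (show (s, y) ∉ Icc 0 T ×ˢ univ from fun h' => h.not_ge h'.1.1),
          mul_zero]
      · have : t < s := by
          by_contra! h'
          exact hs ⟨lt_of_le_of_ne h (Ne.symm hs0), h'⟩
        rw [stKernel_of_notMem (p := (t, x) - (s, y)) (fun h' => by
          have := h'.1
          simp only [Prod.fst_sub] at this
          linarith), zero_mul]
  constructor
  · rw [intervalIntegrable_iff_integrableOn_Ioc_of_le ht.1, ← integrable_indicator_iff measurableSet_Ioc]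
    exact hint.integral_prod_left.congr hsec
  · rw [stConv, Measure.volume_eq_prod, integral_prod _ hint, integral_congr_ae hsec,
      integral_indicator measurableSet_Ioc, intervalIntegral.integral_of_le ht.1]

/-! ### The linear flow -/

/-- The solution `G_α(t) f` of the linear equation, for positive times. -/
def heatFlow (ν α : ℝ) (f : Plane → ℝ) : SpaceTime → ℝ :=
  {p : SpaceTime | 0 < p.1}.indicator fun p => conv (heatKernel ν α p.1) f p.2

lemma heatFlow_of_pos (ν α : ℝ) (f : Plane → ℝ) {t : ℝ} (ht : 0 < t) (x : Plane) :
    heatFlow ν α f (t, x) = conv (heatKernel ν α t) f x :=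
  indicator_of_mem (show (t, x) ∈ {p : SpaceTime | 0 < p.1} from ht) _

lemma abs_conv_le_of_bdd {k f : Plane → ℝ} {M : ℝ} (hk : Integrable k) (hM : ∀ x, |f x| ≤ M)
    (x : Plane) : |conv k f x| ≤ (∫ y, |k y|) * M := by
  have e : (∫ z, |k z|) * M = ∫ y, |k (x - y)| * M := by
    rw [integral_mul_const, integral_sub_left_eq_self (fun z => |k z|) volume x]
  rw [e]
  refine abs_integral_le_integral_abs.trans ?_
  refine integral_mono_of_nonneg (ae_of_all _ fun _ => abs_nonneg _)
    ((hk.comp_sub_left x).abs.mul_const M) (ae_of_all _ fun y => ?_)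
  simp only [abs_mul]
  exact mul_le_mul_of_nonneg_left (hM y) (abs_nonneg _)

lemma conv_sub_left {k l f : Plane → ℝ} {M : ℝ} (hk : Integrable k) (hl : Integrable l)
    (hf : Measurable f) (hM : ∀ x, |f x| ≤ M) (x : Plane) :
    conv k f x - conv l f x = conv (fun y => k y - l y) f x := by
  have i (k : Plane → ℝ) (hk : Integrable k) : Integrable fun y => k (x - y) * f y :=
    (hk.comp_sub_left x).mul_bdd (c := M) hf.aestronglyMeasurable (ae_of_all _ hM)
  rw [conv, conv, conv, ← integral_sub (i k hk) (i l hl)]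
  congr 1; ext y; ring

section

variable {ν α : ℝ} (hν : 0 < ν) (hα : 1 / 2 < α)
include hν hα

lemma integrable_heatKernel_one : Integrable (heatKernel ν α 1) :=
  (isKernel_heatKernel ν α).integrable (heatCoeff_pos hν α) hα

lemma measurable_heatKernel_one : Measurable (heatKernel ν α 1) :=
  ((isKernel_heatKernel ν α).differentiable (heatCoeff_pos hν α) (by linarith)).continuous.measurable

lemma integrable_heatKernel {t : ℝ} (ht : 0 < t) : Integrable (heatKernel ν α t) := by
  rw [heatKernel_eq_dil (by linarith) ht]
  exact integrable_dil (scale_pos α ht) (integrable_heatKernel_one hν hα)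

omit hν in
lemma integral_abs_heatKernel {t : ℝ} (ht : 0 < t) :
    ∫ x, |heatKernel ν α t x| = ∫ x, |heatKernel ν α 1 x| := by
  rw [heatKernel_eq_dil (by linarith) ht]
  simp only [abs_dil]
  rw [integral_dil (scale_pos α ht)]

lemma abs_heatFlow_le {f : Plane → ℝ} {M : ℝ} (hM : ∀ x, |f x| ≤ M) (p : SpaceTime) :
    |heatFlow ν α f p| ≤ (∫ x, |heatKernel ν α 1 x|) * M := by
  have hM0 : 0 ≤ M := (abs_nonneg _).trans (hM 0)
  obtain ⟨t, x⟩ := p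
  rcases lt_or_ge 0 t with ht | ht
  · rw [heatFlow_of_pos _ _ _ ht, ← integral_abs_heatKernel hα ht]
    exact abs_conv_le_of_bdd (integrable_heatKernel hν hα ht) hM x
  · rw [heatFlow, indicator_of_notMem (by simpa using ht), abs_zero]
    positivity

lemma measurable_heatFlow {f : Plane → ℝ} (hf : Measurable f) : Measurable (heatFlow ν α f) := by
  have hg := measurable_heatKernel_one hν hα
  have hS : MeasurableSet {p : SpaceTime | 0 < p.1} := measurableSet_lt measurable_const measurable_fst
  -- The dilation form shows joint measurability in time and space, which is not visible in the
  -- Fourier definition.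
  have e : heatFlow ν α f = {p : SpaceTime | 0 < p.1}.indicator fun p =>
      ∫ y, dil (scale α p.1) (heatKernel ν α 1) (p.2 - y) * f y := by
    refine indicator_congr fun p hp => ?_
    rw [heatKernel_eq_dil (by linarith) hp, conv]
  rw [e]
  refine Measurable.indicator ?_ hS
  have h1 : Measurable fun q : SpaceTime × Plane => scale α q.1.1 :=
    (measurable_scale α).comp (measurable_fst.comp measurable_fst)
  have h2 : Measurable fun q : SpaceTime × Plane => q.1.2 - q.2 :=
    (measurable_snd.comp measurable_fst).sub measurable_snd
  have : StronglyMeasurable (Function.uncurry fun (p : SpaceTime) (y : Plane) =>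
      dil (scale α p.1) (heatKernel ν α 1) (p.2 - y) * f y) :=
    (((h1.pow_const 2).mul (hg.comp (h1.smul h2))).mul (hf.comp measurable_snd)).stronglyMeasurable
  exact this.integral_prod_right.measurable

lemma tendsto_integral_abs_heatKernel_sub {t : ℝ} (ht : 0 < t) :
    Tendsto (fun s => ∫ x, |heatKernel ν α s x - heatKernel ν α t x|) (𝓝 t) (𝓝 0) := by
  have hα0 : 0 < α := by linarith
  have ha := heatCoeff_pos hν α
  have hk := isKernel_heatKernel ν α
  have hgc := (hk.differentiable ha hα0).continuous
  obtain ⟨C, hC⟩ := hk.exists_decay ha hα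
  have hC0 : 0 ≤ C := nonneg_of_mul_nonneg_left ((abs_nonneg _).trans (hC 0)) (dec_pos 0)
  set g := heatKernel ν α 1
  have hst : Tendsto (scale α) (𝓝 t) (𝓝 (scale α t)) :=
    (Real.continuousAt_rpow_const t _ (Or.inl ht.ne')).tendsto
  have hδ := scale_pos α ht
  set δ := scale α t with hδd
  have key : Tendsto (fun s => ∫ x, |dil (scale α s) g x - dil δ g x|) (𝓝 t)
      (𝓝 (∫ _ : Plane, (0 : ℝ))) := by
    -- For `s` near `t` the scale lies between `δ / 2` and `2 δ`, and `dec` decreases along rays,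
    -- which yields a majorant independent of `s`.
    refine tendsto_integral_filter_of_dominated_convergence
      (fun x => (2 * δ) ^ 2 * (C * dec ((δ / 2) • x)) + |dil δ g x|) ?_ ?_ ?_ ?_
    · refine Eventually.of_forall fun s => ?_
      have h1 (d : ℝ) : Continuous (dil d g) := by unfold dil; fun_prop
      exact ((h1 _).sub (h1 _)).abs.aestronglyMeasurable
    · filter_upwards [hst.eventually_lt_const (by linarith : δ < 2 * δ),
        hst.eventually_const_lt (by linarith : δ / 2 < δ)] with s h1 h2
      refine ae_of_all _ fun x => ?_
      rw [norm_abs_eq_norm]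
      refine (abs_sub _ _).trans ?_
      gcongr
      have hs : 0 < scale α s := by linarith
      rw [dil, abs_mul, abs_of_pos (by positivity)]
      have hd : dec (scale α s • x) ≤ dec ((δ / 2) • x) := by
        unfold dec
        rw [norm_smul, norm_smul, Real.norm_of_nonneg hs.le, Real.norm_of_nonneg (by positivity)]
        gcongr
      have := (hC (scale α s • x)).trans (mul_le_mul_of_nonneg_left hd hC0)
      gcongr
    · refine (((integrable_dec.comp_smul (by positivity)).const_mul C).const_mul _).add ?_
      exact (integrable_dil hδ (integrable_heatKernel_one hν hα)).abs
    · refine ae_of_all _ fun x => ?_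
      have h1 : ContinuousAt (fun d : ℝ => dil d g x) δ := by unfold dil; fun_prop
      have h2 := (h1.tendsto.comp hst).sub_const (dil δ g x)
      rw [sub_self] at h2
      simpa using h2.abs
  rw [integral_zero] at key
  refine key.congr' ?_
  filter_upwards [lt_mem_nhds ht] with s hs
  rw [heatKernel_eq_dil hα0 hs, heatKernel_eq_dil hα0 ht]

lemma eventually_abs_heatFlow_sub_le {f : Plane → ℝ} {M : ℝ} (hf : Measurable f)
    (hM : ∀ x, |f x| ≤ M) {t : ℝ} (ht : 0 < t) {ε : ℝ} (hε : 0 < ε) :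
    ∀ᶠ s in 𝓝 t, ∀ x, |heatFlow ν α f (s, x) - heatFlow ν α f (t, x)| ≤ ε := by
  have h := (tendsto_integral_abs_heatKernel_sub hν hα ht).mul_const M
  rw [zero_mul] at h
  filter_upwards [h.eventually_le_const hε, lt_mem_nhds ht] with s hs hs0 x
  rw [heatFlow_of_pos _ _ _ ht, heatFlow_of_pos _ _ _ hs0,
    conv_sub_left (integrable_heatKernel hν hα hs0) (integrable_heatKernel hν hα ht) hf hM]
  exact (abs_conv_le_of_bdd ((integrable_heatKernel hν hα hs0).sub
    (integrable_heatKernel hν hα ht)) hM x).trans hs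

end

/-! ### The kernels of the mild formulation -/

/-- The kernels `∂_j g_α(1)` and `p.v. K^i * ∂_j g_α(1)`. -/
def profile (ν α : ℝ) : Fin 3 → Fin 2 → Plane → ℝ :=
  Fin.cons (fun j => partialDeriv j (heatKernel ν α 1))
    fun i j => pvConv i (partialDeriv j (heatKernel ν α 1))

section

variable {ν α : ℝ} (hν : 0 < ν) (hα : 1 / 2 < α)
include hν hα

lemma pvConv_profile (i j : Fin 2) :
    Measurable (profile ν α i.succ j) ∧ Integrable (profile ν α i.succ j) ∧
      (∀ x, Tendsto (fun p : ℝ × ℝ => truncConv p.1 p.2 i (profile ν α 0 j) x) pvFilter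
        (𝓝 (profile ν α i.succ j x))) ∧
      ∃ C : ℝ, 0 ≤ C ∧ ∀ r R : ℝ, 0 < r → r < R →
        Integrable (truncConv r R i (profile ν α 0 j)) ∧
        ∫ x, |truncConv r R i (profile ν α 0 j) x - profile ν α i.succ j x|
          ≤ C * (min r 1 + R⁻¹) := by
  obtain ⟨P, hm, hi, ht, hC⟩ := exists_singular_limit (heatCoeff_pos hν α) hα
    (isKernel_heatKernel ν α) i j
  have e : profile ν α i.succ j = P := funext fun x => (ht x).limUnder_eq
  rw [e]
  exact ⟨hm, hi, ht, hC⟩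

lemma profile_zero (j : Fin 2) :
    Measurable (profile ν α 0 j) ∧ Integrable (profile ν α 0 j) := by
  have ha := heatCoeff_pos hν α
  have hk := (isKernel_heatKernel ν α).partialDeriv ha (by linarith) j
  exact ⟨(hk.differentiable ha (by linarith)).continuous.measurable, hk.integrable ha hα⟩

lemma measurable_profile (i : Fin 3) (j : Fin 2) : Measurable (profile ν α i j) := by
  refine Fin.cases (profile_zero hν hα j).1 (fun i => (pvConv_profile hν hα i j).1) i

lemma integrable_profile (i : Fin 3) (j : Fin 2) : Integrable (profile ν α i j) := by
  refine Fin.cases (profile_zero hν hα j).2 (fun i => (pvConv_profile hν hα i j).2.1) i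

omit hν in
lemma partialDeriv_heatKernel_eq {t : ℝ} (ht : 0 < t) (j : Fin 2) :
    partialDeriv j (heatKernel ν α t) = duhamelKernel α (profile ν α 0 j) t :=
  partialDeriv_heatKernel (by linarith) ht j

lemma pvConv_partialDeriv_heatKernel_eq {t : ℝ} (ht : 0 < t) (i j : Fin 2) :
    pvConv i (partialDeriv j (heatKernel ν α t)) = duhamelKernel α (profile ν α i.succ j) t := by
  rw [partialDeriv_heatKernel_eq hα ht]
  exact pvConv_const_mul_dil (scale_pos α ht) i _ (pvConv_profile hν hα i j).2.2.1

end

/-- The time slab `[0, T] × ℝ²`. -/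
def slab (T : ℝ) : Set SpaceTime := Icc 0 T ×ˢ univ

lemma measurableSet_slab (T : ℝ) : MeasurableSet (slab T) := measurableSet_Icc.prod MeasurableSet.univ

lemma slab_measure (T : ℝ) :
    (volume.restrict (Icc 0 T)).prod (volume : Measure Plane)
      = (volume : Measure SpaceTime).restrict (slab T) := by
  rw [Measure.volume_eq_prod, slab, ← Measure.prod_restrict, Measure.restrict_univ]

/-- The space-time kernels of the mild formulation on `[0, T]`. -/
def stProfile (ν α T : ℝ) (i : Fin 3) (j : Fin 2) : SpaceTime → ℝ := stKernel α T (profile ν α i j)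

/-- The source `θ u_j`, extended by zero outside `[0, T]`, is measurable and essentially bounded. -/
structure IsSource (T : ℝ) (z : SpaceTime → Fin 3 → ℝ) (B : ℝ) : Prop where
  nonneg : 0 ≤ B
  bound : ∀ᵐ q, q ∈ slab T → ∀ i, |z q i| ≤ B
  meas : ∀ j, AEStronglyMeasurable ((slab T).indicator fun q => quad (z q) j) volume

lemma IsSource.ae_abs_le {T B : ℝ} {z : SpaceTime → Fin 3 → ℝ} (hz : IsSource T z B) (j : Fin 2) :
    ∀ᵐ q, |(slab T).indicator (fun q => quad (z q) j) q| ≤ B * B := by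
  refine ae_abs_indicator_le (mul_nonneg hz.nonneg hz.nonneg) ?_
  filter_upwards [hz.bound] with q hq hS using abs_quad_le (hq hS) j

section

variable {ν α : ℝ} (hν : 0 < ν) (hα : 1 / 2 < α)
include hν hα

lemma duhamel_eq_integral {T B : ℝ} {z : SpaceTime → Fin 3 → ℝ} (hz : IsSource T z B) {t : ℝ}
    (ht : t ∈ Icc 0 T) (x : Plane) (i : Fin 3) :
    duhamel (stProfile ν α T) (slab T) z (t, x) i = ∫ s in (0 : ℝ)..t, ∑ j,
      conv (duhamelKernel α (profile ν α i j) (t - s)) (fun y => z (s, y) 0 * z (s, y) j.succ) x := by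
  have h (j : Fin 2) : IntervalIntegrable (fun s => conv (duhamelKernel α (profile ν α i j) (t - s))
        (fun y => z (s, y) 0 * z (s, y) j.succ) x) volume 0 t ∧
      stConv (stProfile ν α T i j) ((slab T).indicator fun q => quad (z q) j) (t, x)
        = ∫ s in (0 : ℝ)..t, conv (duhamelKernel α (profile ν α i j) (t - s))
          (fun y => z (s, y) 0 * z (s, y) j.succ) x := stConv_stKernel_eq hα (measurable_profile hν hα i j)
    (integrable_profile hν hα i j) (hz.meas j) (hz.ae_abs_le j) ht x
  rw [intervalIntegral.integral_finsetSum fun j _ => (h j).1, duhamel]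
  exact Finset.sum_congr rfl fun j _ => (h j).2

lemma duhamel_zero_eq {T B : ℝ} {z : SpaceTime → Fin 3 → ℝ} (hz : IsSource T z B) {t : ℝ}
    (ht : t ∈ Icc 0 T) (x : Plane) :
    duhamel (stProfile ν α T) (slab T) z (t, x) 0 = ∫ s in (0 : ℝ)..t, ∑ j,
      conv (partialDeriv j (heatKernel ν α (t - s))) (fun y => z (s, y) 0 * z (s, y) j.succ) x := by
  rw [duhamel_eq_integral hν hα hz ht]
  refine intervalIntegral.integral_congr_ae ?_
  -- The self-similar form of the kernel needs positive time `t - s`, so the endpoint is discarded.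
  have h1 : ∀ᵐ s : ℝ, s ≠ t := by simp [ae_iff]
  filter_upwards [h1] with s hs hs'
  rw [uIoc_of_le ht.1] at hs'
  refine Finset.sum_congr rfl fun j _ => ?_
  rw [partialDeriv_heatKernel_eq hα (sub_pos.2 (lt_of_le_of_ne hs'.2 hs))]

lemma duhamel_succ_eq {T B : ℝ} {z : SpaceTime → Fin 3 → ℝ} (hz : IsSource T z B) {t : ℝ}
    (ht : t ∈ Icc 0 T) (x : Plane) (i : Fin 2) :
    duhamel (stProfile ν α T) (slab T) z (t, x) i.succ = ∫ s in (0 : ℝ)..t, ∑ j,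
      conv (pvConv i (partialDeriv j (heatKernel ν α (t - s))))
        (fun y => z (s, y) 0 * z (s, y) j.succ) x := by
  rw [duhamel_eq_integral hν hα hz ht]
  refine intervalIntegral.integral_congr_ae ?_
  have h1 : ∀ᵐ s : ℝ, s ≠ t := by simp [ae_iff]
  filter_upwards [h1] with s hs hs'
  rw [uIoc_of_le ht.1] at hs'
  refine Finset.sum_congr rfl fun j _ => ?_
  rw [pvConv_partialDeriv_heatKernel_eq hν hα (sub_pos.2 (lt_of_le_of_ne hs'.2 hs))]

lemma duhamel_initial {T B : ℝ} {z : SpaceTime → Fin 3 → ℝ} (hz : IsSource T z B) (hT : 0 ≤ T)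
    (x : Plane) (i : Fin 3) : duhamel (stProfile ν α T) (slab T) z (0, x) i = 0 := by
  rw [duhamel_eq_integral hν hα hz ⟨le_rfl, hT⟩, intervalIntegral.integral_same]

lemma integrable_stProfile {T : ℝ} (hT : 0 ≤ T) (i : Fin 3) (j : Fin 2) :
    Integrable (stProfile ν α T i j) :=
  integrable_stKernel hα hT (measurable_profile hν hα i j) (integrable_profile hν hα i j)

lemma exists_small_time (M : ℝ) : ∃ T : ℝ, 0 < T ∧
    ∀ i, (∑ j, ∫ q, |stProfile ν α T i j q|) * M ≤ 1 := by
  have h (i : Fin 3) : Tendsto (fun T => (∑ j, ∫ q, |stProfile ν α T i j q|) * M) (𝓝[>] 0) (𝓝 0) := by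
    have := (tendsto_finsetSum Finset.univ fun j _ => tendsto_integral_abs_stKernel hα
      (measurable_profile hν hα i j) (integrable_profile hν hα i j)).mul_const M
    rw [Finset.sum_const_zero, zero_mul] at this
    exact this
  have h2 : ∀ᶠ T in 𝓝[>] (0 : ℝ), ∀ i, (∑ j, ∫ q, |stProfile ν α T i j q|) * M ≤ 1 :=
    eventually_all.2 fun i => (h i).eventually_le_const one_pos
  obtain ⟨T, hT, h3⟩ := (eventually_mem_nhdsWithin.and h2).exists
  exact ⟨T, hT, h3⟩

end

/-! ### Mild solutions as fixed points -/

/-- The pair `(θ, u)` as a single vector valued function on space-time. -/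
def stateOf (θ : ℝ → Plane → ℝ) (u : ℝ → Plane → Plane) (p : SpaceTime) : Fin 3 → ℝ :=
  Fin.cons (θ p.1 p.2) fun i => u p.1 p.2 i

lemma ae_norm_le_of_memLp_top {X F : Type*} [MeasurableSpace X] {μ : Measure X}
    [NormedAddCommGroup F] {f : X → F} (hf : MemLp f ∞ μ) :
    ∀ᵐ x ∂μ, ‖f x‖ ≤ (eLpNorm f ∞ μ).toReal := by
  filter_upwards [ae_le_eLpNormEssSup (f := f) (μ := μ)] with x hx
  rw [← eLpNorm_exponent_top, ← ofReal_norm] at hx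
  exact (ENNReal.ofReal_le_iff_le_toReal hf.2.ne).1 hx

/-- A measurable representative is clamped at its essential bound, so that later estimates hold at
every point. -/
lemma exists_bounded_representative {f : Plane → ℝ} (hf : MemLp f ∞ volume) :
    ∃ (g : Plane → ℝ) (M : ℝ), Measurable g ∧ (∀ x, |g x| ≤ M) ∧ g =ᵐ[volume] f := by
  set M := (eLpNorm f ∞ volume).toReal
  have hM : ∀ᵐ x, |f x| ≤ M := ae_norm_le_of_memLp_top hf
  set f' := hf.1.mk f
  have hf' : Measurable f' := hf.1.stronglyMeasurable_mk.measurable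
  refine ⟨fun x => max (-M) (min M (f' x)), M, measurable_const.max (measurable_const.min hf'),
    fun x => ?_, ?_⟩
  · have : 0 ≤ M := ENNReal.toReal_nonneg
    rw [abs_le]
    exact ⟨le_max_left _ _, max_le (by linarith) (min_le_left _ _)⟩
  · filter_upwards [hM, hf.1.ae_eq_mk] with x hx he
    have hx := abs_le.1 hx
    simp only [f', ← he]
    rw [min_eq_right hx.2, max_eq_right hx.1]

lemma conv_congr_right {k f g : Plane → ℝ} (h : f =ᵐ[volume] g) (x : Plane) :
    conv k f x = conv k g x := by
  refine integral_congr_ae ?_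
  filter_upwards [h] with y hy
  rw [hy]

section

variable {T : ℝ} {θ : ℝ → Plane → ℝ} {u : ℝ → Plane → Plane}
  (hθ : MemLp (fun p : ℝ × Plane => θ p.1 p.2) ∞ ((volume.restrict (Icc 0 T)).prod volume))
  (hu : MemLp (fun p : ℝ × Plane => u p.1 p.2) ∞ ((volume.restrict (Icc 0 T)).prod volume))
include hθ hu

lemma aestronglyMeasurable_stateOf (i : Fin 3) :
    AEStronglyMeasurable (fun q => stateOf θ u q i) ((volume : Measure SpaceTime).restrict (slab T)) := by
  rw [← slab_measure]
  refine Fin.cases hθ.1 (fun i => ?_) i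
  exact (by fun_prop : Continuous fun v : Plane => v i).comp_aestronglyMeasurable hu.1

lemma exists_isSource_stateOf : ∃ B, IsSource T (stateOf θ u) B := by
  have h1 := ae_norm_le_of_memLp_top hθ
  have h2 := ae_norm_le_of_memLp_top hu
  rw [slab_measure, ae_restrict_iff' (measurableSet_slab T)] at h1 h2
  obtain ⟨a, ha0, ha⟩ : ∃ a : ℝ, 0 ≤ a ∧ ∀ᵐ q : SpaceTime, q ∈ slab T → ‖θ q.1 q.2‖ ≤ a :=
    ⟨_, ENNReal.toReal_nonneg, h1⟩
  obtain ⟨b, hb0, hb⟩ : ∃ b : ℝ, 0 ≤ b ∧ ∀ᵐ q : SpaceTime, q ∈ slab T → ‖u q.1 q.2‖ ≤ b :=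
    ⟨_, ENNReal.toReal_nonneg, h2⟩
  refine ⟨a + b, add_nonneg ha0 hb0, ?_, fun j => ?_⟩
  · filter_upwards [ha, hb] with q h1 h2 hq i
    refine Fin.cases ?_ (fun i => ?_) i
    · exact (h1 hq).trans (le_add_of_nonneg_right hb0)
    · exact ((abs_coord_le_norm _ i).trans (h2 hq)).trans (le_add_of_nonneg_left ha0)
  · rw [aestronglyMeasurable_indicator_iff (measurableSet_slab T)]
    exact (aestronglyMeasurable_stateOf hθ hu 0).mul (aestronglyMeasurable_stateOf hθ hu j.succ)

end

section

variable {ν α : ℝ} (hν : 0 < ν) (hα : 1 / 2 < α)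
include hν hα

/-- A mild solution is, up to the linear flow, a fixed point of the Duhamel operator. -/
lemma IsMildSolution.state_eq {T : ℝ} {θ₀ : Plane → ℝ} {u₀ : Plane → Plane}
    {θ : ℝ → Plane → ℝ} {u : ℝ → Plane → Plane} (h : IsMildSolution ν α T θ₀ u₀ θ u)
    {w : Fin 3 → Plane → ℝ} (hw0 : w 0 =ᵐ[volume] θ₀)
    (hw : ∀ i : Fin 2, w i.succ =ᵐ[volume] fun x => u₀ x i) {t : ℝ} (ht : t ∈ Ioc 0 T) :
    ∀ᵐ x, ∀ i, stateOf θ u (t, x) i = heatFlow ν α (w i) (t, x)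
      - duhamel (stProfile ν α T) (slab T) (stateOf θ u) (t, x) i := by
  obtain ⟨B, hB⟩ := exists_isSource_stateOf h.memLp_theta h.memLp_u
  have ht' : t ∈ Icc 0 T := ⟨ht.1.le, ht.2⟩
  filter_upwards [h.theta_eq t ht, h.u_eq t ht] with x h1 h2 i
  rw [heatFlow_of_pos _ _ _ ht.1]
  refine Fin.cases ?_ (fun i => ?_) i
  · rw [duhamel_zero_eq hν hα hB ht', conv_congr_right hw0]
    exact h1
  · rw [duhamel_succ_eq hν hα hB ht', conv_congr_right (hw i)]
    exact h2 i

omit hν hα in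
/-- States that agree almost everywhere at each time have the same Duhamel terms. -/
lemma duhamel_congr_of_slices {T : ℝ} {z y : SpaceTime → Fin 3 → ℝ}
    (hz : ∀ i, AEStronglyMeasurable (fun q => z q i) ((volume : Measure SpaceTime).restrict (slab T)))
    (hy : ∀ i, Measurable fun q => y q i)
    (h : ∀ t ∈ Ioc 0 T, ∀ᵐ x, ∀ i, z (t, x) i = y (t, x) i) (p : SpaceTime) (i : Fin 3) :
    duhamel (stProfile ν α T) (slab T) z p i = duhamel (stProfile ν α T) (slab T) y p i := by
  have hae : ∀ i, ∀ᵐ q ∂((volume : Measure SpaceTime).restrict (slab T)), z q i = y q i := by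
    intro i
    -- Equality on almost every slice gives equality almost everywhere in space-time only on a
    -- measurable set, so `z` is first replaced by a measurable function.
    obtain ⟨z', hz', e⟩ : ∃ z' : SpaceTime → ℝ, Measurable z' ∧
        (fun q => z q i) =ᵐ[(volume : Measure SpaceTime).restrict (slab T)] z' :=
      ⟨_, (hz i).stronglyMeasurable_mk.measurable, (hz i).ae_eq_mk⟩
    rw [← slab_measure] at e ⊢
    have e2 := Measure.ae_ae_of_ae_prod e
    have e3 : ∀ᵐ q ∂(volume.restrict (Icc 0 T)).prod (volume : Measure Plane), z' q = y q i := by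
      rw [Measure.ae_prod_iff_ae_ae (measurableSet_eq_fun hz' (hy i))]
      have hne : ∀ᵐ s ∂(volume : Measure ℝ).restrict (Icc 0 T), s ≠ 0 :=
        ae_restrict_of_ae (by simp [ae_iff])
      filter_upwards [e2, ae_restrict_mem measurableSet_Icc, hne] with s hs hs1 hs0
      filter_upwards [hs, h s ⟨lt_of_le_of_ne hs1.1 (Ne.symm hs0), hs1.2⟩] with x hx hx'
      exact hx.symm.trans (hx' i)
    filter_upwards [e, e3] with q h1 h2 using h1.trans h2
  refine Finset.sum_congr rfl fun j _ => stConv_congr ?_ p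
  have h0 := (ae_restrict_iff' (measurableSet_slab T)).1 (hae 0)
  have h1 := (ae_restrict_iff' (measurableSet_slab T)).1 (hae j.succ)
  filter_upwards [h0, h1] with q h0 h1
  by_cases hq : q ∈ slab T
  · rw [indicator_of_mem hq, indicator_of_mem hq, quad, quad, h0 hq, h1 hq]
  · rw [indicator_of_notMem hq, indicator_of_notMem hq]

/-- Uniqueness of mild solutions, compared with a fixed point of the Duhamel operator. -/
theorem IsMildSolution.ae_eq {T : ℝ} (hT : 0 ≤ T) {θ₀ : Plane → ℝ} {u₀ : Plane → Plane}
    {θ : ℝ → Plane → ℝ} {u : ℝ → Plane → Plane} (h : IsMildSolution ν α T θ₀ u₀ θ u)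
    {w : Fin 3 → Plane → ℝ} (hw0 : w 0 =ᵐ[volume] θ₀)
    (hw : ∀ i : Fin 2, w i.succ =ᵐ[volume] fun x => u₀ x i) (hwm : ∀ i, Measurable (w i))
    {M : ℝ} (hwM : ∀ i x, |w i x| ≤ M) {v : SpaceTime → Fin 3 → ℝ}
    (hvm : ∀ i, Measurable fun q => v q i) (hv1 : ∀ p i, |v p i| ≤ 1)
    (ev : ∀ p i, v p i = duhamel (stProfile ν α T) (slab T)
      (fun q i => heatFlow ν α (w i) q - v q i) p i) {t : ℝ} (ht : t ∈ Ioc 0 T) :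
    ∀ᵐ x, ∀ i, stateOf θ u (t, x) i = heatFlow ν α (w i) (t, x) - v (t, x) i := by
  obtain ⟨B, hB⟩ := exists_isSource_stateOf h.memLp_theta h.memLp_u
  have hki (i j) := integrable_stProfile (T := T) hν hα hT i j
  -- The Duhamel term of the given solution is continuous and satisfies the same equation as `v` at
  -- every point. The comparison thus takes place between functions defined everywhere.
  set v' : SpaceTime → Fin 3 → ℝ := duhamel (stProfile ν α T) (slab T) (stateOf θ u) with hv'
  have hv'm (i : Fin 3) : Measurable fun q => v' q i :=
    (uniformContinuous_duhamel hki hB.nonneg hB.bound hB.meas i).continuous.measurable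
  have hsl (t : ℝ) (ht : t ∈ Ioc 0 T) := h.state_eq hν hα hw0 hw ht
  have hhm (i : Fin 3) := measurable_heatFlow hν hα (hwm i)
  have ev' (p) (i) : v' p i = duhamel (stProfile ν α T) (slab T)
      (fun q i => heatFlow ν α (w i) q - v' q i) p i :=
    duhamel_congr_of_slices (aestronglyMeasurable_stateOf h.memLp_theta h.memLp_u)
      (fun i => (hhm i).sub (hv'm i)) hsl p i
  set c := ∑ i, ∑ j, ∫ q, |stProfile ν α T i j q|
  have hη (i : Fin 3) : 0 ≤ ∑ j, ∫ q, |stProfile ν α T i j q| :=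
    Finset.sum_nonneg fun j _ => integral_nonneg fun _ => abs_nonneg _
  have hc (i : Fin 3) : ∑ j, ∫ q, |stProfile ν α T i j q| ≤ c :=
    Finset.single_le_sum (f := fun i => ∑ j, ∫ q, |stProfile ν α T i j q|) (fun i _ => hη i)
      (Finset.mem_univ i)
  have hc0 : 0 ≤ c := (hη 0).trans (hc 0)
  have hM0 : 0 ≤ M := (abs_nonneg _).trans (hwM 0 0)
  set H := (∫ x, |heatKernel ν α 1 x|) * M
  have hH : 0 ≤ H := by positivity
  -- The common bound adds those of the linear flow (`H`), of `v` (`1`) and of `v'` (`c * (B * B)`).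
  have hu := duhamel_fixedPoint_unique (B := H + 1 + c * (B * B)) hki (measurableSet_slab T)
    (fun i j p hp => stKernel_of_notMem fun h' => hp.not_gt h'.1)
    hhm hvm hv'm (fun q i => ?_) (fun q i => ?_) (fun q i => ?_) (fun q hq => hq.1.1) ev ev'
  · filter_upwards [hsl t ht] with x hx i
    rw [hx i, hu (t, x) ⟨⟨ht.1.le, ht.2⟩, trivial⟩ i]
  · have := abs_heatFlow_le hν hα (hwM i) q
    have : 0 ≤ c * (B * B) := by have := hB.nonneg; positivity
    linarith
  · have := hv1 q i
    have : 0 ≤ c * (B * B) := by have := hB.nonneg; positivity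
    linarith
  · have h1 := abs_duhamel_le hki hB.nonneg hB.bound q i
    have h2 : (∑ j, ∫ q, |stProfile ν α T i j q|) * (B * B) ≤ c * (B * B) := by
      have := hB.nonneg; have := hc i; gcongr
    linarith

end

/-! ### Propagation of the principal value -/

instance : pvFilter.IsCountablyGenerated := by
  unfold pvFilter; infer_instance

lemma measurableSet_annulus (r R : ℝ) : MeasurableSet (annulus r R) :=
  (measurableSet_lt measurable_const measurable_norm).inter
    (measurableSet_lt measurable_norm measurable_const)

lemma measurable_annulus_K (r R : ℝ) (i : Fin 2) :
    Measurable ((annulus r R).indicator fun z => K z i) :=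
  (measurable_K i).indicator (measurableSet_annulus r R)

lemma integrable_annulus_K {r : ℝ} (hr : 0 < r) (R : ℝ) (i : Fin 2) :
    Integrable ((annulus r R).indicator fun z => K z i) := by
  rw [integrable_indicator_iff (measurableSet_annulus r R)]
  have hfin : volume (annulus r R) < ∞ := by
    refine (measure_mono fun z hz => ?_).trans_lt
      (measure_ball_lt_top (μ := (volume : Measure Plane)) (x := 0) (r := R))
    simpa using hz.2
  refine Measure.integrableOn_of_bounded (M := (r ^ 2)⁻¹) hfin.ne
    (measurable_K i).aestronglyMeasurable ?_
  filter_upwards [ae_restrict_mem (measurableSet_annulus r R)] with z hz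
  refine (abs_K_le z i).trans ?_
  have : r < ‖z‖ := hz.1
  gcongr

/-! ### Fubini identities for convolutions -/

section

variable {a b f : Plane → ℝ} {M : ℝ}

lemma integrable_conv_of_bdd (ha : Integrable a) (hf : Measurable f) (hM : ∀ x, |f x| ≤ M)
    (x : Plane) : Integrable fun y => a (x - y) * f y :=
  (ha.comp_sub_left x).mul_bdd (c := M) hf.aestronglyMeasurable (ae_of_all _ hM)

lemma conv_sub_right {g : Plane → ℝ} (ha : Integrable a) (hf : Measurable f) (hM : ∀ x, |f x| ≤ M)
    {N : ℝ} (hg : Measurable g) (hN : ∀ x, |g x| ≤ N) (x : Plane) :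
    conv a (fun y => f y - g y) x = conv a f x - conv a g x := by
  rw [conv, conv, conv, ← integral_sub (integrable_conv_of_bdd ha hf hM x)
    (integrable_conv_of_bdd ha hg hN x)]
  congr 1; ext y; ring

lemma conv_conv_comm (ha : Integrable a) (hb : Integrable b) (hf : Measurable f)
    (hM : ∀ x, |f x| ≤ M) (x : Plane) : conv a (conv b f) x = conv b (conv a f) x := by
  have hint : Integrable (Function.uncurry fun z w => a z * b w * f (x - z - w))
      ((volume : Measure Plane).prod volume) := by
    refine (ha.mul_prod hb).mul_bdd (c := M) ?_ (ae_of_all _ fun _ => hM _)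
    exact (hf.comp ((measurable_const.sub measurable_fst).sub measurable_snd)).aestronglyMeasurable
  have h := integral_integral_swap hint
  simp only [conv_eq_integral_sub, ← integral_const_mul]
  calc _ = ∫ z, ∫ w, a z * b w * f (x - z - w) := by
        congr 1; ext z; congr 1; ext w; ring
    _ = _ := by
        rw [h]
        congr 1; ext w; congr 1; ext z; rw [sub_right_comm]; ring

/-- Convolution in the space variable. -/
def spaceConv (a : Plane → ℝ) (k : SpaceTime → ℝ) (p : SpaceTime) : ℝ :=
  conv a (fun y => k (p.1, y)) p.2

variable {k F : SpaceTime → ℝ}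

lemma integrable_spaceConv_integrand (ham : Measurable a) (ha : Integrable a) (hkm : Measurable k)
    (hk : Integrable k) (p : SpaceTime) :
    Integrable (Function.uncurry fun (z : Plane) (q : SpaceTime) => a z * k (p - (0, z) - q))
      (volume.prod volume) := by
  rw [integrable_prod_iff]
  · refine ⟨ae_of_all _ fun z => (hk.comp_sub_left (p - (0, z))).const_mul (a z), ?_⟩
    simp only [Function.uncurry, norm_mul, integral_const_mul]
    simp_rw [integral_sub_left_eq_self (fun q => ‖k q‖) volume]
    exact ha.norm.mul_const _
  · refine Measurable.aestronglyMeasurable ?_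
    refine (ham.comp measurable_fst).mul (hkm.comp ?_)
    exact (measurable_const.sub (measurable_const.prodMk measurable_fst)).sub measurable_snd

lemma spaceConv_eq (a : Plane → ℝ) (k : SpaceTime → ℝ) (p : SpaceTime) :
    spaceConv a k p = ∫ z, a z * k (p - (0, z)) := by
  rw [spaceConv, conv_eq_integral_sub]
  congr 1; ext z
  congr 2
  ext <;> simp

lemma integrable_spaceConv (ham : Measurable a) (ha : Integrable a) (hkm : Measurable k)
    (hk : Integrable k) : Integrable (spaceConv a k) := by
  have h := (integrable_spaceConv_integrand ham ha hkm hk 0).integral_prod_right.comp_neg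
  refine h.congr (ae_of_all _ fun p => ?_)
  rw [spaceConv_eq]
  simp only [Function.uncurry]
  congr 1; ext z
  congr 2
  abel

/-- Fubini: a spatial convolution of the output can be absorbed into the space-time kernel, where
`L¹` convergence is available. -/
lemma conv_stConv (ham : Measurable a) (ha : Integrable a) (hkm : Measurable k)
    (hk : Integrable k) (hF : AEStronglyMeasurable F volume) (hM : ∀ᵐ q, |F q| ≤ M) (t : ℝ)
    (x : Plane) :
    conv a (fun y => stConv k F (t, y)) x = stConv (spaceConv a k) F (t, x) := by
  have hint : Integrable (Function.uncurry fun (z : Plane) (q : SpaceTime) =>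
      a z * k ((t, x) - (0, z) - q) * F q) (volume.prod volume) := by
    refine (integrable_spaceConv_integrand ham ha hkm hk (t, x)).mul_bdd (c := M) ?_ ?_
    · exact hF.comp_snd
    · exact (Measure.quasiMeasurePreserving_snd (μ := (volume : Measure Plane))
        (ν := (volume : Measure SpaceTime))).ae hM
  have h := integral_integral_swap hint
  rw [conv_eq_integral_sub, stConv]
  calc _ = ∫ z, ∫ q, a z * k ((t, x) - (0, z) - q) * F q := by
        congr 1; ext z
        rw [stConv, ← integral_const_mul]
        congr 1; ext q
        rw [mul_assoc]
        congr 4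
        ext <;> simp
    _ = _ := by
        rw [h]
        congr 1; ext q
        rw [integral_mul_const, spaceConv_eq]
        congr 2; ext z
        rw [sub_right_comm]

end

section

variable {ν α : ℝ} (hν : 0 < ν) (hα : 1 / 2 < α)
include hν hα

lemma measurable_stProfile (T : ℝ) (i : Fin 3) (j : Fin 2) : Measurable (stProfile ν α T i j) :=
  measurable_stKernel α T (measurable_profile hν hα i j)

omit hν hα in
lemma truncConv_duhamelKernel {t : ℝ} (ht : 0 < t) (r R : ℝ) (i : Fin 2) (κ : Plane → ℝ)
    (x : Plane) : truncConv r R i (duhamelKernel α κ t) x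
      = duhamelKernel α (truncConv (scale α t * r) (scale α t * R) i κ) t x := by
  have : duhamelKernel α κ t = fun x => scale α t * dil (scale α t) κ x := rfl
  rw [this, truncConv_const_mul, truncConv_dil (scale_pos α ht)]
  rfl

/-- Scaling reduces each time `t` to the estimate at time one with radii multiplied by `scale α t`.
The slices tend to zero in `L¹`, and dominated convergence in time concludes. -/
lemma tendsto_integral_abs_spaceConv_sub {T : ℝ} (hT : 0 ≤ T) (i j : Fin 2) :
    Tendsto (fun p : ℝ × ℝ => ∫ q, |spaceConv ((annulus p.1 p.2).indicator fun z => K z i)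
      (stProfile ν α T 0 j) q - stProfile ν α T i.succ j q|) pvFilter (𝓝 0) := by
  obtain ⟨-, -, -, C, hC0, hC⟩ := pvConv_profile hν hα i j
  have hscale : IntegrableOn (scale α) (Ioo 0 T) :=
    (intervalIntegrable_iff_integrableOn_Ioo_of_le hT).1 (intervalIntegrable_scale hα T)
  have hdom : IntegrableOn (fun t => C * (scale α t + 1)) (Ioo 0 T) :=
    (hscale.add (integrable_const 1)).const_mul C
  have hr : ∀ᶠ p : ℝ × ℝ in pvFilter, 0 < p.1 := tendsto_fst.eventually self_mem_nhdsWithin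
  have hr1 : ∀ᶠ p : ℝ × ℝ in pvFilter, p.1 < 1 := by
    have : ∀ᶠ r : ℝ in 𝓝[>] 0, r < 1 := mem_nhdsWithin_of_mem_nhds (gt_mem_nhds one_pos)
    exact tendsto_fst.eventually this
  have hR : ∀ᶠ p : ℝ × ℝ in pvFilter, 1 ≤ p.2 := tendsto_snd.eventually (eventually_ge_atTop 1)
  -- For `p.2 ≥ 1` this is at most `C (scale α t + 1)`: the prefactor cancels the inverse scale in
  -- the outer error, and the rest is integrable in time.
  set E : ℝ × ℝ → ℝ → ℝ := fun p t =>
    scale α t * (C * (min (scale α t * p.1) 1 + (scale α t * p.2)⁻¹))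
  have hEm (p : ℝ × ℝ) : Measurable (E p) := by
    have := measurable_scale α
    fun_prop
  have hEle (p : ℝ × ℝ) (hp : 1 ≤ p.2) (h0 : 0 < p.1) (t : ℝ) (ht : 0 < t) :
      ‖E p t‖ ≤ C * (scale α t + 1) := by
    have hs := scale_pos α ht
    have hp2 : 0 < p.2 := by linarith
    rw [Real.norm_of_nonneg (by positivity)]
    calc E p t ≤ scale α t * (C * (1 + (scale α t * 1)⁻¹)) := by
          simp only [E]; gcongr; exact min_le_right _ _
      _ = _ := by field_simp
  have hlim : Tendsto (fun p => ∫ t in Ioo 0 T, E p t) pvFilter (𝓝 (∫ _ in Ioo 0 T, (0 : ℝ))) := by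
    refine tendsto_integral_filter_of_dominated_convergence _
      (Eventually.of_forall fun p => (hEm p).aestronglyMeasurable) ?_ hdom ?_
    · filter_upwards [hr, hR] with p h0 h1
      filter_upwards [ae_restrict_mem measurableSet_Ioo] with t ht using hEle p h1 h0 t ht.1
    · filter_upwards [ae_restrict_mem measurableSet_Ioo] with t ht
      have h1 : Tendsto (fun p : ℝ × ℝ => p.1) pvFilter (𝓝 0) :=
        tendsto_fst.mono_right nhdsWithin_le_nhds
      have h2 : Tendsto (fun p : ℝ × ℝ => (scale α t * p.2)⁻¹) pvFilter (𝓝 0) :=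
        ((tendsto_snd (f := 𝓝[>] (0 : ℝ)) (g := (atTop : Filter ℝ))).const_mul_atTop
          (scale_pos α ht.1)).inv_tendsto_atTop
      have h3 := (((h1.const_mul (scale α t)).min (tendsto_const_nhds (x := (1 : ℝ)))).add
        h2).const_mul C |>.const_mul (scale α t)
      simpa [E] using h3
  rw [integral_zero] at hlim
  refine squeeze_zero' (Eventually.of_forall fun p => integral_nonneg fun _ => abs_nonneg _) ?_ hlim
  filter_upwards [hr, hr1, hR] with p h0 h01 h1
  have hint : Integrable fun q => spaceConv ((annulus p.1 p.2).indicator fun z => K z i)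
      (stProfile ν α T 0 j) q - stProfile ν α T i.succ j q :=
    (integrable_spaceConv (measurable_annulus_K _ _ i) (integrable_annulus_K h0 _ i)
      (measurable_stProfile hν hα T 0 j)
      (integrable_stProfile hν hα hT 0 j)).sub (integrable_stProfile hν hα hT i.succ j)
  rw [Measure.volume_eq_prod] at hint ⊢
  rw [integral_prod _ hint.abs, ← integral_indicator measurableSet_Ioo]
  refine integral_mono_of_nonneg (ae_of_all _ fun _ => integral_nonneg fun _ => abs_nonneg _) ?_
    (ae_of_all _ fun t => ?_)
  · rw [integrable_indicator_iff measurableSet_Ioo]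
    refine hdom.mono' (hEm p).aestronglyMeasurable ?_
    filter_upwards [ae_restrict_mem measurableSet_Ioo] with t ht using hEle p h1 h0 t ht.1
  · by_cases ht : t ∈ Ioo 0 T
    · have hs := scale_pos α ht.1
      have e1 : ∀ x, stProfile ν α T i.succ j (t, x) = duhamelKernel α (profile ν α i.succ j) t x :=
        fun x => stKernel_of_mem ht
      have e0 : (fun y => stProfile ν α T 0 j (t, y)) = duhamelKernel α (profile ν α 0 j) t :=
        funext fun x => stKernel_of_mem ht
      have e2 : ∀ x, spaceConv ((annulus p.1 p.2).indicator fun z => K z i)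
          (stProfile ν α T 0 j) (t, x) = duhamelKernel α
            (truncConv (scale α t * p.1) (scale α t * p.2) i (profile ν α 0 j)) t x := by
        intro x
        rw [← truncConv_duhamelKernel ht.1, spaceConv, e0]
        rfl
      rw [indicator_of_mem ht]
      simp only [e1, e2]
      have e3 : ∀ x, |duhamelKernel α
            (truncConv (scale α t * p.1) (scale α t * p.2) i (profile ν α 0 j)) t x
          - duhamelKernel α (profile ν α i.succ j) t x|
          = |duhamelKernel α (fun y => truncConv (scale α t * p.1) (scale α t * p.2) i
            (profile ν α 0 j) y - profile ν α i.succ j y) t x| := by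
        intro x
        simp only [duhamelKernel, dil]
        congr 1; ring
      simp only [e3]
      rw [integral_abs_duhamelKernel ht.1]
      have := (hC (scale α t * p.1) (scale α t * p.2) (by positivity) (by gcongr; linarith)).2
      simp only [E]
      gcongr
    · have e0 : ∀ x, stProfile ν α T 0 j (t, x) = 0 := fun x => stKernel_of_notMem ht
      have e1 : ∀ x, stProfile ν α T i.succ j (t, x) = 0 := fun x => stKernel_of_notMem ht
      rw [indicator_of_notMem ht]
      simp [spaceConv, e0, e1, conv]

/-- The principal value of a Duhamel term is the Duhamel term with the singular kernel. -/
theorem tendsto_truncConv_stConv {T : ℝ} (hT : 0 ≤ T) {F : SpaceTime → ℝ} {M : ℝ}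
    (hF : AEStronglyMeasurable F volume) (hM : ∀ᵐ q, |F q| ≤ M) (i j : Fin 2) (t : ℝ) (x : Plane) :
    Tendsto (fun p : ℝ × ℝ => truncConv p.1 p.2 i (fun y => stConv (stProfile ν α T 0 j) F (t, y)) x)
      pvFilter (𝓝 (stConv (stProfile ν α T i.succ j) F (t, x))) := by
  have h := (tendsto_integral_abs_spaceConv_sub hν hα hT i j).mul_const M
  rw [zero_mul] at h
  rw [tendsto_iff_dist_tendsto_zero]
  refine squeeze_zero' (Eventually.of_forall fun _ => dist_nonneg) ?_ h
  have hr : ∀ᶠ p : ℝ × ℝ in pvFilter, 0 < p.1 := tendsto_fst.eventually self_mem_nhdsWithin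
  filter_upwards [hr] with p h0
  have hkm := measurable_stProfile hν hα T 0 j
  have hk := integrable_stProfile hν hα hT 0 j
  have hk' := integrable_stProfile hν hα hT i.succ j
  have ha := integrable_annulus_K h0 p.2 i
  have hs := integrable_spaceConv (measurable_annulus_K p.1 p.2 i) ha hkm hk
  rw [Real.dist_eq, truncConv, conv_stConv (measurable_annulus_K p.1 p.2 i) ha hkm hk hF hM]
  refine le_trans (le_of_eq ?_) (abs_stConv_le (hs.sub hk') hM (t, x))
  congr 1
  rw [stConv, stConv, ← integral_sub (integrable_stConv hs hF hM _) (integrable_stConv hk' hF hM _)]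
  congr 1; ext q
  rw [Pi.sub_apply, sub_mul]

omit hν hα in
/-- Convolution with an integrable function preserves a dominated principal value. -/
theorem tendsto_truncConv_conv {g f w : Plane → ℝ} {M : ℝ} (hg : Integrable g)
    (hf : Measurable f) (hM : ∀ x, |f x| ≤ M) (i : Fin 2)
    (hw : ∀ᵐ x, Tendsto (fun p : ℝ × ℝ => truncConv p.1 p.2 i f x) pvFilter (𝓝 (w x))) {C : ℝ}
    (hC : ∀ r R : ℝ, 0 < r → 0 < R → ∀ᵐ x, |truncConv r R i f x| ≤ C) (x : Plane) :
    Tendsto (fun p : ℝ × ℝ => truncConv p.1 p.2 i (conv g f) x) pvFilter (𝓝 (conv g w x)) := by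
  have hr : ∀ᶠ p : ℝ × ℝ in pvFilter, 0 < p.1 := tendsto_fst.eventually self_mem_nhdsWithin
  have hR : ∀ᶠ p : ℝ × ℝ in pvFilter, 0 < p.2 := tendsto_snd.eventually (eventually_gt_atTop 0)
  have hm (r R : ℝ) : Measurable (truncConv r R i f) :=
    measurable_conv (measurable_annulus_K r R i) hf
  have h : Tendsto (fun p : ℝ × ℝ => conv g (truncConv p.1 p.2 i f) x) pvFilter
      (𝓝 (conv g w x)) := by
    -- The bound over all annuli provides the majorant `|g| C`; pointwise convergence alone would
    -- not suffice.
    refine tendsto_integral_filter_of_dominated_convergence (fun y => |g (x - y)| * C) ?_ ?_ ?_ ?_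
    · exact Eventually.of_forall fun p =>
        (hg.comp_sub_left x).1.mul (hm _ _).aestronglyMeasurable
    · filter_upwards [hr, hR] with p h0 h1
      filter_upwards [hC p.1 p.2 h0 h1] with y hy
      rw [norm_mul, Real.norm_eq_abs, Real.norm_eq_abs]
      gcongr
    · exact (hg.comp_sub_left x).abs.mul_const C
    · filter_upwards [hw] with y hy using hy.const_mul _
  refine h.congr' ?_
  filter_upwards [hr] with p h0
  exact conv_conv_comm hg (integrable_annulus_K h0 p.2 i) hf hM x

end

/-! ### The solution -/

lemma norm_le_abs_add_abs (v : Plane) : ‖v‖ ≤ |v 0| + |v 1| := by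
  rw [EuclideanSpace.norm_eq, Fin.sum_univ_two, Real.sqrt_le_iff]
  refine ⟨by positivity, ?_⟩
  simp only [Real.norm_eq_abs]
  nlinarith [abs_nonneg (v 0), abs_nonneg (v 1)]

lemma ae_abs_le_of_eLpNorm_le {f : Plane → ℝ} {C : ℝ}
    (h : eLpNorm f ∞ volume ≤ ENNReal.ofReal C) : ∀ᵐ x, |f x| ≤ (ENNReal.ofReal C).toReal := by
  filter_upwards [ae_le_eLpNormEssSup (f := f) (μ := volume)] with x hx
  rw [← eLpNorm_exponent_top, ← ofReal_norm] at hx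
  exact (ENNReal.ofReal_le_iff_le_toReal ENNReal.ofReal_ne_top).1 (hx.trans h)

lemma continuousInLinfty_of_eventually {F : Type*} [NormedAddCommGroup F] {T : ℝ}
    {f : ℝ → Plane → F} (hm : ∀ t ∈ Ioc 0 T, MemLp (f t) ∞ volume)
    (h : ∀ t ∈ Ioc 0 T, ∀ ε > 0, ∀ᶠ s in 𝓝[Ioc 0 T] t, ∀ x, ‖f s x - f t x‖ ≤ ε) :
    ContinuousInLinfty T f := by
  refine ⟨hm, fun t ht => ENNReal.tendsto_nhds_zero.2 fun ε hε => ?_⟩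
  rcases eq_or_ne ε ∞ with rfl | hε'
  · exact Eventually.of_forall fun _ => le_top
  filter_upwards [h t ht ε.toReal (ENNReal.toReal_pos hε.ne' hε')] with s hs
  rw [eLpNorm_exponent_top]
  refine (eLpNormEssSup_le_of_ae_bound (ae_of_all _ hs)).trans_eq ?_
  exact ENNReal.ofReal_toReal hε'

lemma exists_bounded_representatives {θ₀ : Plane → ℝ} {u₀ : Plane → Plane}
    (hθ₀ : MemLp θ₀ ∞ volume) (hu₀ : MemLp u₀ ∞ volume) :
    ∃ (w : Fin 3 → Plane → ℝ) (M : ℝ), (∀ i, Measurable (w i)) ∧ (∀ i x, |w i x| ≤ M) ∧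
      w 0 =ᵐ[volume] θ₀ ∧ ∀ i : Fin 2, w i.succ =ᵐ[volume] fun x => u₀ x i := by
  have h : ∀ i : Fin 3, ∃ (g : Plane → ℝ) (M : ℝ), Measurable g ∧ (∀ x, |g x| ≤ M) ∧
      g =ᵐ[volume] (Fin.cons θ₀ fun i x => u₀ x i : Fin 3 → Plane → ℝ) i := by
    refine Fin.cases (exists_bounded_representative hθ₀) fun i => exists_bounded_representative ?_
    refine hu₀.mono ?_ (ae_of_all _ fun x => abs_coord_le_norm (u₀ x) i)
    exact (by fun_prop : Continuous fun v : Plane => v i).comp_aestronglyMeasurable hu₀.1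
  choose w M hm hb he using h
  refine ⟨w, ∑ i, |M i|, hm, fun i x => ?_, he 0, fun i => he i.succ⟩
  exact ((hb i x).trans (le_abs_self _)).trans
    (Finset.single_le_sum (f := fun i => |M i|) (fun _ _ => abs_nonneg _) (Finset.mem_univ i))

/-- The first component of a state, extended by the datum to nonpositive times. -/
def thetaOf (θ₀ : Plane → ℝ) (z : SpaceTime → Fin 3 → ℝ) (t : ℝ) (x : Plane) : ℝ :=
  if t ≤ 0 then θ₀ x else z (t, x) 0

/-- The velocity components of a state, extended by the datum to nonpositive times. -/
def velocityOf (u₀ : Plane → Plane) (z : SpaceTime → Fin 3 → ℝ) (t : ℝ) (x : Plane) : Plane :=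
  if t ≤ 0 then u₀ x else WithLp.toLp 2 fun i => z (t, x) i.succ

section

variable {θ₀ : Plane → ℝ} {u₀ : Plane → Plane} {z : SpaceTime → Fin 3 → ℝ} {T B : ℝ}

lemma thetaOf_of_pos {t : ℝ} (ht : 0 < t) (x : Plane) : thetaOf θ₀ z t x = z (t, x) 0 :=
  if_neg ht.not_ge

lemma velocityOf_of_pos {t : ℝ} (ht : 0 < t) (x : Plane) :
    velocityOf u₀ z t x = WithLp.toLp 2 fun i => z (t, x) i.succ := if_neg ht.not_ge

lemma stateOf_of_pos {t : ℝ} (ht : 0 < t) (x : Plane) :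
    stateOf (thetaOf θ₀ z) (velocityOf u₀ z) (t, x) = z (t, x) := by
  ext i
  refine Fin.cases ?_ (fun i => ?_) i
  · exact thetaOf_of_pos ht x
  · change velocityOf u₀ z t x i = _
    rw [velocityOf_of_pos ht]

lemma ae_pos_of_slab (T : ℝ) :
    ∀ᵐ p ∂(volume.restrict (Icc 0 T)).prod (volume : Measure Plane), 0 < p.1 := by
  refine Measure.quasiMeasurePreserving_fst.ae (p := fun s : ℝ => 0 < s) ?_
  have hne : ∀ᵐ s ∂(volume : Measure ℝ).restrict (Icc 0 T), s ≠ 0 :=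
    ae_restrict_of_ae (by simp [ae_iff])
  filter_upwards [ae_restrict_mem measurableSet_Icc, hne] with s hs h0
  exact lt_of_le_of_ne hs.1 h0.symm

lemma norm_velocity_le {y : Fin 3 → ℝ} (hy : ∀ i, |y i| ≤ B) :
    ‖(WithLp.toLp 2 fun i => y i.succ : Plane)‖ ≤ 2 * B := by
  refine (norm_le_abs_add_abs _).trans ?_
  have h0 := hy (Fin.succ 0)
  have h1 := hy (Fin.succ 1)
  simp only [] at h0 h1 ⊢
  linarith

lemma measurable_velocity {X : Type*} [MeasurableSpace X] {y : X → Fin 3 → ℝ}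
    (hy : ∀ i, Measurable fun q => y q i) :
    Measurable fun q => (WithLp.toLp 2 fun i => y q i.succ : Plane) :=
  (PiLp.continuous_toLp 2 _).measurable.comp (measurable_pi_lambda _ fun i => hy i.succ)

variable (hz : ∀ i, Measurable fun q => z q i) (hB : ∀ q i, |z q i| ≤ B)
include hz hB

lemma memLp_thetaOf_slab : MemLp (fun p : ℝ × Plane => thetaOf θ₀ z p.1 p.2) ∞
    ((volume.restrict (Icc 0 T)).prod volume) := by
  have h : MemLp (fun p : SpaceTime => z p 0) ∞ ((volume.restrict (Icc 0 T)).prod volume) :=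
    memLp_top_of_bound (hz 0).aestronglyMeasurable B (ae_of_all _ fun q => hB q 0)
  refine h.ae_eq ?_
  filter_upwards [ae_pos_of_slab T] with p hp
  exact (thetaOf_of_pos hp p.2).symm

lemma memLp_velocityOf_slab : MemLp (fun p : ℝ × Plane => velocityOf u₀ z p.1 p.2) ∞
    ((volume.restrict (Icc 0 T)).prod volume) := by
  have h : MemLp (fun p : SpaceTime => (WithLp.toLp 2 fun i => z p i.succ : Plane)) ∞
      ((volume.restrict (Icc 0 T)).prod volume) :=
    memLp_top_of_bound (measurable_velocity hz).aestronglyMeasurable (2 * B)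
      (ae_of_all _ fun q => norm_velocity_le (hB q))
  refine h.ae_eq ?_
  filter_upwards [ae_pos_of_slab T] with p hp
  exact (velocityOf_of_pos hp p.2).symm

lemma memLp_thetaOf {t : ℝ} (ht : 0 < t) : MemLp (thetaOf θ₀ z t) ∞ volume := by
  rw [funext fun x => thetaOf_of_pos (θ₀ := θ₀) (z := z) ht x]
  exact memLp_top_of_bound ((hz 0).comp measurable_prodMk_left).aestronglyMeasurable B
    (ae_of_all _ fun x => hB _ 0)

lemma memLp_velocityOf {t : ℝ} (ht : 0 < t) : MemLp (velocityOf u₀ z t) ∞ volume := by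
  rw [funext fun x => velocityOf_of_pos (u₀ := u₀) (z := z) ht x]
  exact memLp_top_of_bound (measurable_velocity fun i =>
    (hz i).comp measurable_prodMk_left).aestronglyMeasurable (2 * B)
    (ae_of_all _ fun x => norm_velocity_le (hB _))

end

section

variable {ν α : ℝ} (hν : 0 < ν) (hα : 1 / 2 < α)
include hν hα

variable {T M B : ℝ} (hT : 0 < T) {θ₀ : Plane → ℝ} {u₀ : Plane → Plane} {w : Fin 3 → Plane → ℝ}
  (hw0 : w 0 =ᵐ[volume] θ₀) (hw : ∀ i : Fin 2, w i.succ =ᵐ[volume] fun x => u₀ x i)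
  (hwm : ∀ i, Measurable (w i)) (hwM : ∀ i x, |w i x| ≤ M)
  {z : SpaceTime → Fin 3 → ℝ} (hzm : ∀ i, Measurable fun q => z q i) (hzB : ∀ q i, |z q i| ≤ B)
  (hz : ∀ p i, z p i = heatFlow ν α (w i) p - duhamel (stProfile ν α T) (slab T) z p i)

include hw0 hw hzm hzB hz in
lemma isMildSolution_of_fixedPoint :
    IsMildSolution ν α T θ₀ u₀ (thetaOf θ₀ z) (velocityOf u₀ z) := by
  have hθ : MemLp (fun p : ℝ × Plane => thetaOf θ₀ z p.1 p.2) ∞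
    ((volume.restrict (Icc 0 T)).prod volume) := memLp_thetaOf_slab hzm hzB
  have hu : MemLp (fun p : ℝ × Plane => velocityOf u₀ z p.1 p.2) ∞
    ((volume.restrict (Icc 0 T)).prod volume) := memLp_velocityOf_slab hzm hzB
  obtain ⟨B', hB'⟩ := exists_isSource_stateOf hθ hu
  have key (p) (i) : duhamel (stProfile ν α T) (slab T) z p i
      = duhamel (stProfile ν α T) (slab T) (stateOf (thetaOf θ₀ z) (velocityOf u₀ z)) p i := by
    refine (duhamel_congr_of_slices (aestronglyMeasurable_stateOf hθ hu) hzm ?_ p i).symm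
    refine fun t ht => ae_of_all _ fun x i => ?_
    rw [stateOf_of_pos ht.1]
  refine ⟨hθ, hu, fun t ht => ae_of_all _ fun x => ?_, fun t ht => ae_of_all _ fun x i => ?_⟩
  · rw [thetaOf_of_pos ht.1, hz, key, heatFlow_of_pos _ _ _ ht.1, conv_congr_right hw0,
      duhamel_zero_eq hν hα hB' ⟨ht.1.le, ht.2⟩]
    rfl
  · rw [velocityOf_of_pos ht.1]
    change z (t, x) i.succ = _
    rw [hz, key, heatFlow_of_pos _ _ _ ht.1, conv_congr_right (hw i),
      duhamel_succ_eq hν hα hB' ⟨ht.1.le, ht.2⟩]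
    rfl

include hzm hzB

omit hν hα in
lemma isSource_of_bdd : IsSource T z B :=
  ⟨(abs_nonneg _).trans (hzB 0 0), ae_of_all _ fun q _ => hzB q,
    aestronglyMeasurable_quad (measurableSet_slab T) hzm⟩

include hT in
lemma uniformContinuous_duhamel_stProfile (i : Fin 3) :
    UniformContinuous fun p => duhamel (stProfile ν α T) (slab T) z p i :=
  have hS := isSource_of_bdd (T := T) hzm hzB
  uniformContinuous_duhamel (integrable_stProfile hν hα hT.le) hS.nonneg hS.bound hS.meas i

include hT hwm hwM hz

lemma eventually_abs_state_sub_le {t : ℝ} (ht : 0 < t) {ε : ℝ} (hε : 0 < ε) :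
    ∀ᶠ s in 𝓝 t, ∀ x i, |z (s, x) i - z (t, x) i| ≤ ε := by
  have h : ∀ i, ∀ᶠ s in 𝓝 t, ∀ x, |z (s, x) i - z (t, x) i| ≤ ε := by
    intro i
    obtain ⟨δ, hδ, h⟩ := Metric.uniformContinuous_iff.1
      (uniformContinuous_duhamel_stProfile hν hα hT hzm hzB i) (ε / 2) (half_pos hε)
    filter_upwards [eventually_abs_heatFlow_sub_le hν hα (hwm i) (hwM i) ht (half_pos hε),
      Metric.ball_mem_nhds t hδ] with s h1 h2 x
    have h3 : dist ((s, x) : SpaceTime) (t, x) < δ := by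
      rw [Prod.dist_eq, dist_self]
      exact max_lt h2 hδ
    have h4 := (h h3).le
    rw [Real.dist_eq] at h4
    have h5 := h1 x
    rw [hz, hz (t, x)]
    rw [abs_le] at h4 h5 ⊢
    constructor <;> linarith [h4.1, h4.2, h5.1, h5.2]
  filter_upwards [eventually_all.2 h] with s hs x i using hs i x

lemma continuousInLinfty_thetaOf : ContinuousInLinfty T (thetaOf θ₀ z) := by
  refine continuousInLinfty_of_eventually (fun t ht => memLp_thetaOf hzm hzB ht.1)
    fun t ht ε hε => ?_
  filter_upwards [mem_nhdsWithin_of_mem_nhds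
    (eventually_abs_state_sub_le hν hα hT hwm hwM hzm hzB hz ht.1 hε), self_mem_nhdsWithin]
    with s hs hs' x
  rw [thetaOf_of_pos ht.1, thetaOf_of_pos hs'.1]
  exact hs x 0

lemma continuousInLinfty_velocityOf : ContinuousInLinfty T (velocityOf u₀ z) := by
  refine continuousInLinfty_of_eventually (fun t ht => memLp_velocityOf hzm hzB ht.1)
    fun t ht ε hε => ?_
  filter_upwards [mem_nhdsWithin_of_mem_nhds
    (eventually_abs_state_sub_le hν hα hT hwm hwM hzm hzB hz ht.1 (half_pos hε)),
    self_mem_nhdsWithin] with s hs hs' x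
  rw [velocityOf_of_pos ht.1, velocityOf_of_pos hs'.1]
  refine (norm_velocity_le (y := fun i => z (s, x) i - z (t, x) i) (hs x)).trans_eq ?_
  ring

/-- The Duhamel term is continuous and vanishes at `t = 0`, so the limit is that of the linear flow.
-/
lemma ae_tendsto_state (i : Fin 3) :
    ∀ᵐ x, Tendsto (fun t => z (t, x) i) (𝓝[>] 0) (𝓝 (w i x)) := by
  filter_upwards [ae_tendsto_conv_heatKernel hν hα (hwm i) (hwM i)] with x hx
  have h1 : Tendsto (fun t => duhamel (stProfile ν α T) (slab T) z (t, x) i) (𝓝[>] 0) (𝓝 0) := by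
    have hc : Continuous fun t : ℝ => duhamel (stProfile ν α T) (slab T) z (t, x) i :=
      (uniformContinuous_duhamel_stProfile hν hα hT hzm hzB i).continuous.comp (by fun_prop)
    have := hc.tendsto 0
    rw [duhamel_initial hν hα (isSource_of_bdd hzm hzB) hT.le] at this
    exact this.mono_left nhdsWithin_le_nhds
  have h2 := hx.sub h1
  rw [sub_zero] at h2
  refine h2.congr' ?_
  filter_upwards [self_mem_nhdsWithin] with t ht
  rw [hz, heatFlow_of_pos _ _ _ ht]

include hw0 in
lemma hasInitialValue_thetaOf : HasInitialValue (thetaOf θ₀ z) θ₀ := by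
  refine ⟨ae_of_all _ fun x => if_pos le_rfl, ?_⟩
  filter_upwards [ae_tendsto_state hν hα hT hwm hwM hzm hzB hz 0, hw0] with x hx h0
  rw [h0] at hx
  refine hx.congr' ?_
  filter_upwards [self_mem_nhdsWithin] with t ht using (thetaOf_of_pos ht x).symm

include hw in
lemma hasInitialValue_velocityOf : HasInitialValue (velocityOf u₀ z) u₀ := by
  refine ⟨ae_of_all _ fun x => if_pos le_rfl, ?_⟩
  have h1 : ∀ᵐ x, ∀ i : Fin 2, Tendsto (fun t => z (t, x) i.succ) (𝓝[>] 0) (𝓝 (w i.succ x)) :=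
    ae_all_iff.2 fun i => ae_tendsto_state hν hα hT hwm hwM hzm hzB hz i.succ
  filter_upwards [h1, ae_all_iff.2 hw] with x hx h0
  have h2 : Tendsto (fun t => fun i : Fin 2 => z (t, x) i.succ) (𝓝[>] 0) (𝓝 (u₀ x).ofLp) :=
    tendsto_pi_nhds.2 fun i => by rw [← h0 i]; exact hx i
  have h3 := ((PiLp.continuous_toLp 2 _).tendsto (u₀ x).ofLp).comp h2
  refine h3.congr' ?_
  filter_upwards [self_mem_nhdsWithin] with t ht using (velocityOf_of_pos ht x).symm

include hw0 hw in
-- The truncated convolution is linear, so the limit is taken in each term of the `θ` equation,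
-- producing the terms of the `u` equation. Convolution with integrable kernels turns the almost
-- everywhere hypothesis on the data into convergence at every point.
lemma hasPV_of_fixedPoint (hpv : ∀ᵐ x, HasPV θ₀ x (u₀ x)) (hu : UniformOverAnnuli θ₀) {t : ℝ}
    (ht : 0 < t) (x : Plane) : HasPV (thetaOf θ₀ z t) x (velocityOf u₀ z t x) := by
  intro i
  obtain ⟨C, hC⟩ := hu
  -- Changing the datum on a null set alters no truncated convolution at any point.
  have hcongr (r R : ℝ) : truncConv r R i θ₀ = truncConv r R i (w 0) :=
    funext fun y => (conv_congr_right hw0 y).symm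
  have hlin := tendsto_truncConv_conv (w := w i.succ) (integrable_heatKernel hν hα ht) (hwm 0)
    (hwM 0) i (by
      filter_upwards [hpv, hw i] with y hy hyi
      rw [hyi]
      simpa only [hcongr] using hy i) (fun r R hr hR => by
        rw [← hcongr]; exact ae_abs_le_of_eLpNorm_le (hC r R hr hR i)) x
  have hS := isSource_of_bdd (T := T) hzm hzB
  have hk (i) (j) := integrable_stProfile hν hα hT.le i j
  set D : Fin 2 → Plane → ℝ := fun j y =>
    stConv (stProfile ν α T 0 j) ((slab T).indicator fun q => quad (z q) j) (t, y)
  have hD (j : Fin 2) := tendsto_truncConv_stConv hν hα hT.le (hS.meas j) (hS.ae_abs_le j) i j t x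
  have hDm (j : Fin 2) : Measurable (D j) :=
    ((uniformContinuous_stConv (hk 0 j) (hS.meas j) (hS.ae_abs_le j)).continuous.comp
      (by fun_prop : Continuous fun y : Plane => ((t, y) : SpaceTime))).measurable
  have hDb (j : Fin 2) (y : Plane) := abs_stConv_le (hk 0 j) (hS.ae_abs_le j) (t, y)
  have hg : Measurable (conv (heatKernel ν α t) (w 0)) := by
    rw [← funext fun y => heatFlow_of_pos ν α (w 0) ht y]
    exact (measurable_heatFlow hν hα (hwm 0)).comp measurable_prodMk_left
  have hgb (y : Plane) := abs_conv_le_of_bdd (integrable_heatKernel hν hα ht) (hwM 0) y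
  have hθ : thetaOf θ₀ z t = fun y => conv (heatKernel ν α t) (w 0) y - D 0 y - D 1 y := by
    ext y
    rw [thetaOf_of_pos ht, hz, heatFlow_of_pos _ _ _ ht, duhamel, Fin.sum_univ_two, sub_sub]
  have hv : velocityOf u₀ z t x i = conv (heatKernel ν α t) (w i.succ) x
      - stConv (stProfile ν α T i.succ 0) ((slab T).indicator fun q => quad (z q) 0) (t, x)
      - stConv (stProfile ν α T i.succ 1) ((slab T).indicator fun q => quad (z q) 1) (t, x) := by
    rw [velocityOf_of_pos ht]
    change z (t, x) i.succ = _
    rw [hz, heatFlow_of_pos _ _ _ ht, duhamel, Fin.sum_univ_two, sub_sub]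
  rw [hθ, hv]
  refine ((hlin.sub (hD 0)).sub (hD 1)).congr' ?_
  have hr : ∀ᶠ p : ℝ × ℝ in pvFilter, 0 < p.1 := tendsto_fst.eventually self_mem_nhdsWithin
  filter_upwards [hr] with p hp
  have ha := integrable_annulus_K hp p.2 i
  have hsub (y : Plane) := (abs_sub (conv (heatKernel ν α t) (w 0) y) (D 0 y)).trans
    (add_le_add (hgb y) (hDb 0 y))
  exact ((conv_sub_right ha (hg.sub (hDm 0)) hsub (hDm 1) (hDb 1) x).trans
    (congrArg (· - _) (conv_sub_right ha hg hgb (hDm 0) (hDb 0) x))).symm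

end

end SQG

end

/-! ### Assembly of the theorem -/

theorem theorem1p1 (ν α : ℝ) (hν : 0 < ν) (hα : 1 / 2 < α)
    (θ₀ : SQG.Plane → ℝ) (u₀ : SQG.Plane → SQG.Plane)
    (hθ₀ : MemLp θ₀ ∞ volume) (hu₀ : MemLp u₀ ∞ volume) :
    ∃ T : ℝ, 0 < T ∧ ∃ (θ : ℝ → SQG.Plane → ℝ) (u : ℝ → SQG.Plane → SQG.Plane),
      SQG.IsMildSolution ν α T θ₀ u₀ θ u ∧
      SQG.ContinuousInLinfty T θ ∧ SQG.ContinuousInLinfty T u ∧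
      SQG.HasInitialValue θ θ₀ ∧ SQG.HasInitialValue u u₀ ∧
      (∀ (θ' : ℝ → SQG.Plane → ℝ) (u' : ℝ → SQG.Plane → SQG.Plane),
        SQG.IsMildSolution ν α T θ₀ u₀ θ' u' →
          ∀ t ∈ Ioc 0 T, θ' t =ᵐ[volume] θ t ∧ u' t =ᵐ[volume] u t) ∧
      ((∀ᵐ x, SQG.HasPV θ₀ x (u₀ x)) → SQG.UniformOverAnnuli θ₀ →
        ∀ t ∈ Ioc 0 T, ∀ x, SQG.HasPV (θ t) x (u t x)) := by
  obtain ⟨w, M, hwm, hwM, hw0, hw⟩ := SQG.exists_bounded_representatives hθ₀ hu₀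
  have hM : 0 ≤ M := (abs_nonneg _).trans (hwM 0 0)
  have hh (q i) := SQG.abs_heatFlow_le hν hα (hwM i) q
  set H := (∫ x, |SQG.heatKernel ν α 1 x|) * M
  have hH : 0 ≤ H := by positivity
  -- The factor `4 (H + 1)²` is the smallness required for the contraction on the unit ball, with
  -- `H` the bound of the linear flow.
  obtain ⟨T, hT, hsmall⟩ := SQG.exists_small_time hν hα (4 * (H + 1) ^ 2)
  have hhm (i) := SQG.measurable_heatFlow hν hα (hwm i)
  obtain ⟨v, hvc, hv1, ev⟩ := SQG.exists_duhamel_fixedPoint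
    (fun i j => SQG.integrable_stProfile hν hα hT.le i j) (SQG.measurableSet_slab T)
    (h := fun q i => SQG.heatFlow ν α (w i) q) hhm hH hh hsmall
  have hvm (i) : Measurable fun p => v p i := (hvc i).measurable
  -- The fixed point `v` is the Duhamel term, so the state is recovered by subtracting it from the
  -- linear flow.
  set z : SQG.SpaceTime → Fin 3 → ℝ := fun q i => SQG.heatFlow ν α (w i) q - v q i
  have hzm (i) : Measurable fun q => z q i := (hhm i).sub (hvm i)
  have hzB (q i) : |z q i| ≤ H + 1 := (abs_sub _ _).trans (add_le_add (hh q i) (hv1 q i))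
  have hz (p i) : z p i = SQG.heatFlow ν α (w i) p
      - SQG.duhamel (SQG.stProfile ν α T) (SQG.slab T) z p i := by rw [← ev]
  refine ⟨T, hT, SQG.thetaOf θ₀ z, SQG.velocityOf u₀ z,
    SQG.isMildSolution_of_fixedPoint hν hα hw0 hw hzm hzB hz,
    SQG.continuousInLinfty_thetaOf hν hα hT hwm hwM hzm hzB hz,
    SQG.continuousInLinfty_velocityOf hν hα hT hwm hwM hzm hzB hz,
    SQG.hasInitialValue_thetaOf hν hα hT hw0 hwm hwM hzm hzB hz,
    SQG.hasInitialValue_velocityOf hν hα hT hw hwm hwM hzm hzB hz,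
    fun θ' u' h t ht => ?_,
    fun hpv hu t ht x =>
      SQG.hasPV_of_fixedPoint hν hα hT hw0 hw hwm hwM hzm hzB hz hpv hu ht.1 x⟩
  have h1 := h.ae_eq hν hα hT.le hw0 hw hwm hwM hvm hv1 ev ht
  constructor
  · filter_upwards [h1] with x hx
    rw [SQG.thetaOf_of_pos ht.1]
    exact hx 0
  · filter_upwards [h1] with x hx
    rw [SQG.velocityOf_of_pos ht.1]
    ext i
    exact hx i.succ
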